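/- Let $(M,g)$ be a smooth Riemannian manifold (without boundary, Hausdorff, second countable) with volume element $dv$, and let $f:M\to\mathbb R$ be of class $C^2$ and convex, i.e. $f\circ c$ is a convex function for every geodesic $c:(-\varepsilon,\varepsilon)\to M$. If $f$ is a submersion, i.e. $|df|\neq 0$ everywhere on $M$, then $f$ is $p$-subharmonic for every real $p\ge 1$ (including $p=1$). Here a $C^2$ function $f$ with $|df|\ne 0$ everywhere is called $p$-subharmonic ($p\in\mathbb R$) if: (i) $\operatorname{div}(|df|^{p-2}df)\ge 0$ weakly on $M$, that is, for every nonnegative $\varphi\in C_0^\infty(M)$ the function $|df|^{p-2}\langle df,d\varphi\rangle$ is integrable and $$\int_M \langle |df|^{p-2}df,\,d\varphi\rangle\,dv\le 0 ;$$ (ii) in case $p>1$, moreover: for every nonempty connected open set $\Omega\subset M$ with compact closure and every continuous $h:\overline\Omega\to\mathbb R$ that is $p$-harmonic in $\Omega$ (that is, $h\in H^{1,p}_{loc}(\Omega)$ and $h$ is a weak solution of $\operatorname{div}(|\nabla h|^{p-2}\nabla h)=0$ in $\Omega$), if $f\le h$ on $\partial\Omega$, then $f\le h$ in $\Omega$.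 The range $p\ge1$ is sharp: for every $n\ge 1$, on $M=\mathbb R^n\setminus\{0\}$ with the Euclidean metric, the function $f(x)=e^{|x|^2}$ is a $C^2$ convex submersion, and it is not $p$-subharmonic for any real $p<1$. -/

import Mathlib

open Set Filter Topology MeasureTheory
open scoped Manifold ContDiff ENNReal

universe u

noncomputable section

namespace PSub

/-- The model space of `n`-dimensional manifolds without boundary. -/
abbrev E (n : ℕ) : Type := EuclideanSpace ℝ (Fin n)

/-- A smooth Riemannian metric on an `n`-dimensional smooth manifold `M`. -/
abbrev Metric (n : ℕ) (M : Type*) [TopologicalSpace M] [ChartedSpace (E n) M]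
    [IsManifold (𝓡 n) ∞ M] : Type _ :=
  Bundle.ContMDiffRiemannianMetric (𝓡 n) ∞ (E n) (fun x : M => TangentSpace (𝓡 n) x)

section Differential

variable {n : ℕ} {M : Type*} [TopologicalSpace M] [ChartedSpace (E n) M]

/-- The differential of a real function at `x`, as a cotangent vector. -/
def dif (f : M → ℝ) (x : M) : TangentSpace (𝓡 n) x →L[ℝ] ℝ :=
  mfderiv (𝓡 n) 𝓘(ℝ, ℝ) f x

/-- The coordinate frame of the chart `chartAt x` at the point with coordinates `y`: the vector
`frame x y e` is the derivative of the inverse chart at `y` in the direction `e`. -/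
def frame (x : M) (y : E n) : E n →L[ℝ] TangentSpace (𝓡 n) ((chartAt (E n) x).symm y) :=
  mfderiv 𝓘(ℝ, E n) (𝓡 n) (chartAt (E n) x).symm y

/-- The coordinate expression, in the chart `chartAt x`, of a field `α` of covectors. -/
def chartForm (α : (z : M) → TangentSpace (𝓡 n) z →L[ℝ] ℝ) (x : M) (y : E n) : E n →L[ℝ] ℝ :=
  (α ((chartAt (E n) x).symm y)).comp (frame x y)

/-- Test functions: smooth compactly supported functions on `M`. -/
def IsTest (n : ℕ) {M : Type*} [TopologicalSpace M] [ChartedSpace (E n) M] (φ : M → ℝ) : Prop :=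
  ContMDiff (𝓡 n) 𝓘(ℝ, ℝ) ∞ φ ∧ HasCompactSupport φ

end Differential

section Riemannian

variable {n : ℕ} {M : Type*} [TopologicalSpace M] [ChartedSpace (E n) M] [IsManifold (𝓡 n) ∞ M]

/-- The tangent vector dual to the covector `α` (for `α = df` it is the gradient of `f`). -/
def sharp (g : Metric n M) {x : M} (α : TangentSpace (𝓡 n) x →L[ℝ] ℝ) : TangentSpace (𝓡 n) x :=
  (g.inner x).inverse α

theorem exists_equiv (B : E n →L[ℝ] (E n →L[ℝ] ℝ)) (hB : ∀ v, v ≠ 0 → 0 < B v v) :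
    ∃ e : E n ≃L[ℝ] (E n →L[ℝ] ℝ), (e : E n →L[ℝ] (E n →L[ℝ] ℝ)) = B := by
  have hinj : Function.Injective (B : E n →ₗ[ℝ] (E n →L[ℝ] ℝ)) := by
    rw [← LinearMap.ker_eq_bot, LinearMap.ker_eq_bot']
    intro v hv
    by_contra h
    have h1 := hB v h
    have h2 : B v = 0 := hv
    simp [h2] at h1
  have hfin : Module.finrank ℝ (E n) = Module.finrank ℝ (E n →L[ℝ] ℝ) := by
    rw [← (InnerProductSpace.toDual ℝ (E n)).toLinearEquiv.finrank_eq]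
  refine ⟨(LinearEquiv.ofInjectiveOfFinrankEq _ hinj hfin).toContinuousLinearEquiv, ?_⟩
  ext v w
  rfl

theorem apply_inverse (B : E n →L[ℝ] (E n →L[ℝ] ℝ)) (hB : ∀ v, v ≠ 0 → 0 < B v v)
    (α : E n →L[ℝ] ℝ) : B (B.inverse α) = α := by
  obtain ⟨e, rfl⟩ := exists_equiv B hB
  rw [ContinuousLinearMap.inverse_equiv]
  exact e.apply_symm_apply α

/-- The defining property of the dual vector. -/
theorem inner_sharp (g : Metric n M) {x : M} (α : TangentSpace (𝓡 n) x →L[ℝ] ℝ)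
    (v : TangentSpace (𝓡 n) x) : g.inner x (sharp g α) v = α v :=
  congrArg (fun β : E n →L[ℝ] ℝ => β v) (apply_inverse (g.inner x) (g.pos x) α)

/-- The inner product that the metric induces on covectors. -/
def coInner (g : Metric n M) {x : M} (α β : TangentSpace (𝓡 n) x →L[ℝ] ℝ) : ℝ :=
  β (sharp g α)

/-- The norm of a covector. -/
def coNorm (g : Metric n M) {x : M} (α : TangentSpace (𝓡 n) x →L[ℝ] ℝ) : ℝ :=
  √(coInner g α α)

/-- The metric in the chart `chartAt x`, as a family of bilinear forms on the model space. -/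
def chartMetric (g : Metric n M) (x : M) (y : E n) (v w : E n) : ℝ :=
  g.inner ((chartAt (E n) x).symm y) (frame x y v) (frame x y w)

/-- The Gram matrix `(g_ij)` of the metric in the chart `chartAt x`. -/
def gram (g : Metric n M) (x : M) (y : E n) : Matrix (Fin n) (Fin n) ℝ :=
  Matrix.of fun i j =>
    chartMetric g x y (EuclideanSpace.single i 1) (EuclideanSpace.single j 1)

/-- Christoffel symbols of the first kind in the chart `chartAt x`, contracted with `a b w`:
`Γ_{ij,k} = (∂_i g_jk + ∂_j g_ik - ∂_k g_ij) / 2`. -/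
def christoffel (g : Metric n M) (x : M) (y a b w : E n) : ℝ :=
  (fderiv ℝ (fun z => chartMetric g x z b w) y a
    + fderiv ℝ (fun z => chartMetric g x z a w) y b
    - fderiv ℝ (fun z => chartMetric g x z a b) y w) / 2

/-- `c` is a geodesic on the open set `s` of times: a `C^2` curve that at each time satisfies, in a
chart around the current position, the geodesic equation
`g_kl u''^l + Γ_{ij,k} u'^i u'^j = 0` (all `k`) for its coordinate expression `u`.
The validity of the equation at a given time does not depend on the chart. -/
def IsGeodesicOn (g : Metric n M) (c : ℝ → M) (s : Set ℝ) : Prop :=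
  ContMDiffOn 𝓘(ℝ, ℝ) (𝓡 n) 2 c s ∧
  ∀ t ∈ s, ∃ x : M, c t ∈ (chartAt (E n) x).source ∧
    ∀ w : E n,
      chartMetric g x (chartAt (E n) x (c t))
          (deriv (deriv fun r => chartAt (E n) x (c r)) t) w
        + christoffel g x (chartAt (E n) x (c t))
          (deriv (fun r => chartAt (E n) x (c r)) t)
          (deriv (fun r => chartAt (E n) x (c r)) t) w = 0

/-- `f` is convex along every geodesic. -/
def IsConvex (g : Metric n M) (f : M → ℝ) : Prop :=
  ∀ ε : ℝ, 0 < ε → ∀ c : ℝ → M, IsGeodesicOn g c (Ioo (-ε) ε) →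
    ConvexOn ℝ (Ioo (-ε) ε) (fun t => f (c t))

section Volume

variable [MeasurableSpace M]

/-- The measure `√det(g_ij) dy` of the chart domain of `chartAt x`, carried to `M`. -/
def chartVolume (g : Metric n M) (x : M) : Measure M :=
  ((volume.restrict (chartAt (E n) x).target).withDensity
    (fun y => ENNReal.ofReal √(gram g x y).det)).map (chartAt (E n) x).symm

/-- The Riemannian measure: the least measure that dominates `√det(g_ij) dy` in each chart.
As these chart measures agree on overlaps, it equals `√det(g_ij) dy` in each chart. -/
def vol (g : Metric n M) : Measure M :=
  ⨆ x : M, chartVolume g x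

/-- `f` is a weak subsolution of the `p`-Laplace equation, `div (|df|^(p-2) df) ≥ 0`:
`∫ |df|^(p-2) ⟨df, dφ⟩ dv ≤ 0` for all nonnegative test functions `φ`. -/
def IsSubsolution (g : Metric n M) (p : ℝ) (f : M → ℝ) : Prop :=
  ∀ φ : M → ℝ, IsTest n φ → (∀ x, 0 ≤ φ x) →
    Integrable (fun x => coNorm g (dif f x) ^ (p - 2) * coInner g (dif f x) (dif φ x)) (vol g) ∧
    ∫ x, coNorm g (dif f x) ^ (p - 2) * coInner g (dif f x) (dif φ x) ∂(vol g) ≤ 0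

end Volume

end Riemannian

/-- `A` is the weak derivative of `u` on the open set `U` of the model space. -/
def HasWeakDeriv {n : ℕ} (U : Set (E n)) (u : E n → ℝ) (A : E n → E n →L[ℝ] ℝ) : Prop :=
  LocallyIntegrableOn u U ∧ LocallyIntegrableOn A U ∧
  ∀ ψ : E n → ℝ, ContDiff ℝ ∞ ψ → HasCompactSupport ψ → tsupport ψ ⊆ U → ∀ v : E n,
    ∫ y, u y * fderiv ℝ ψ y v = -∫ y, A y v * ψ y

section Sobolev

variable {n : ℕ} {M : Type*} [TopologicalSpace M] [ChartedSpace (E n) M]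

/-- The part of the open set `Ω` in the chart `chartAt x`, in coordinates. -/
def chartRegion (n : ℕ) {M : Type*} [TopologicalSpace M] [ChartedSpace (E n) M]
    (Ω : Set M) (x : M) : Set (E n) :=
  (chartAt (E n) x).target ∩ (chartAt (E n) x).symm ⁻¹' Ω

/-- `h` lies in `H^{1,p}_loc(Ω)` and has the field of covectors `α` as its weak differential:
in each chart, the function and its weak derivative are in `L^p` on compact subsets. -/
def HasSobolevDif (p : ℝ) (Ω : Set M) (h : M → ℝ)
    (α : (z : M) → TangentSpace (𝓡 n) z →L[ℝ] ℝ) : Prop :=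
  ∀ x : M,
    HasWeakDeriv (chartRegion n Ω x) (fun y => h ((chartAt (E n) x).symm y)) (chartForm α x) ∧
    ∀ K : Set (E n), IsCompact K → K ⊆ chartRegion n Ω x →
      MemLp (fun y => h ((chartAt (E n) x).symm y)) (ENNReal.ofReal p) (volume.restrict K) ∧
      MemLp (chartForm α x) (ENNReal.ofReal p) (volume.restrict K)

end Sobolev

section Subharmonic

variable {n : ℕ} {M : Type*} [TopologicalSpace M] [ChartedSpace (E n) M] [IsManifold (𝓡 n) ∞ M]
  [MeasurableSpace M]

/-- `h` is `p`-harmonic in the open set `Ω`: a continuous weak solution in `H^{1,p}_loc(Ω)` of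
`div (|∇h|^(p-2) ∇h) = 0`. -/
def IsPHarmonicOn (g : Metric n M) (p : ℝ) (Ω : Set M) (h : M → ℝ) : Prop :=
  ContinuousOn h Ω ∧
  ∃ α : (z : M) → TangentSpace (𝓡 n) z →L[ℝ] ℝ, HasSobolevDif p Ω h α ∧
    ∀ φ : M → ℝ, IsTest n φ → tsupport φ ⊆ Ω →
      ∫ x in Ω, coNorm g (α x) ^ (p - 2) * coInner g (α x) (dif φ x) ∂(vol g) = 0

/-- The comparison principle with `p`-harmonic functions on relatively compact domains. -/
def IsBelowPHarmonic (g : Metric n M) (p : ℝ) (f : M → ℝ) : Prop :=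
  ∀ Ω : Set M, IsOpen Ω → IsConnected Ω → IsCompact (closure Ω) →
    ∀ h : M → ℝ, ContinuousOn h (closure Ω) → IsPHarmonicOn g p Ω h →
      (∀ x ∈ frontier Ω, f x ≤ h x) → ∀ x ∈ Ω, f x ≤ h x

/-- `p`-subharmonicity of a real function: upper semicontinuity, the weak inequality
`div (|df|^(p-2) df) ≥ 0`, and, in the range `1 < p` in which `p`-harmonic functions have a
comparison principle, the comparison with `p`-harmonic functions. -/
def IsPSubharmonic (g : Metric n M) (p : ℝ) (f : M → ℝ) : Prop :=
  UpperSemicontinuous f ∧ IsSubsolution g p f ∧ (1 < p → IsBelowPHarmonic g p f)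

end Subharmonic

/-- Punctured Euclidean space, as an open submanifold of Euclidean space. -/
def punctured (n : ℕ) : TopologicalSpace.Opens (E n) :=
  ⟨{0}ᶜ, isOpen_compl_singleton⟩

/-- The derivative of the inclusion of an open subset `U` of Euclidean space. -/
def inclDeriv {n : ℕ} {U : TopologicalSpace.Opens (E n)} (x : U) :
    TangentSpace (𝓡 n) x →L[ℝ] E n :=
  mfderiv (𝓡 n) 𝓘(ℝ, E n) (Subtype.val : U → E n) x

/-- `g` is the Euclidean metric of the open subset `U` of Euclidean space. -/
def IsEuclidean {n : ℕ} {U : TopologicalSpace.Opens (E n)} (g : Metric n U) : Prop :=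
  ∀ (x : U) (v w : TangentSpace (𝓡 n) x),
    g.inner x v w = inner ℝ (inclDeriv x v) (inclDeriv x w)

end PSub

end

noncomputable section

namespace PSub

/-! Convexity along geodesics means that the covariant Hessian is nonnegative: a geodesic runs
through every point with any prescribed velocity (`exists_geodesic`), and the second derivative of
`f` along it is the Hessian evaluated on that velocity (`hasDerivAt_fderiv_geodesic`). Let X be the
gradient of `f` and put h = Hess f(X, X) / |X|². In a chart, `divergence_flux` says that div(√det g
|df|^(p-2) X) = √det g |df|^(p-2) (tr Hess f + (p-2) h). The bracket is (tr Hess f - h) + (p-1) h. A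
nonnegative form on a unit vector is at most its trace, so both terms are nonnegative once p ≥ 1.
Since df never vanishes, the flux is C¹ and the formula holds everywhere; integration by parts in
charts and a partition of unity give the weak inequality.

For the comparison with a p-harmonic h, suppose that f > h somewhere in Ω. Replacing f by f + κ exp
f adds κ exp(f) df ⊗ df to the Hessian (up to a positive factor on Hess f), so the bracket becomes
strictly positive when p > 1. For small κ the maximum of f + κ exp f - h is still interior.
Subtracting |y - y₀|⁴ in coordinates makes this maximum strict and leaves the 2-jet at y₀ unchanged.
But a C² strict subsolution minus a weak solution has no strict local maximum
(`not_eventually_sub_lt_of_divergence_pos`): for a test function concentrated near the peak,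
monotonicity of the flux makes the weak form nonnegative, while positivity of the divergence makes
it negative. As the difference is only a Sobolev function, the test function is built from its
mollifications.

For sharpness, the Hessian of exp(|x|²) is exp(|x|²) (2 I + 4 x ⊗ x), and the bracket is exp(|x|²)
(2n + 2(p-2) - 4(1-p)|x|²). When p < 1 it is negative far from the origin, and a bump function
placed there violates the weak inequality. -/

/-- Bilinear forms on the model space. -/
abbrev Form (n : ℕ) : Type := E n →L[ℝ] E n →L[ℝ] ℝ

/-- The bilinear form is an inner product. -/
structure IsInner {n : ℕ} (B : Form n) : Prop where
  symm : ∀ v w, B v w = B w v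
  pos : ∀ v, v ≠ 0 → 0 < B v v

/-- The vector dual to a covector with respect to a bilinear form. -/
def raise {n : ℕ} (B : Form n) (a : E n →L[ℝ] ℝ) : E n := B.inverse a

/-- The volume density of a bilinear form. -/
def density {n : ℕ} (B : Form n) : ℝ :=
  √(Matrix.of fun i j : Fin n =>
    B (EuclideanSpace.single i 1) (EuclideanSpace.single j 1)).det

/-! ### Linear algebra of an inner product: orthonormal bases, volume density, monotonicity. -/

section Algebra

variable {n : ℕ} {B : Form n}

theorem IsInner.nonneg (hB : IsInner B) (v : E n) : 0 ≤ B v v := by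
  by_cases h : v = 0
  · simp [h]
  · exact (hB.pos v h).le

theorem IsInner.apply_raise (hB : IsInner B) (a : E n →L[ℝ] ℝ) (v : E n) :
    B (raise B a) v = a v :=
  congrArg (fun β : E n →L[ℝ] ℝ => β v) (apply_inverse B hB.pos a)

theorem IsInner.ext_left (hB : IsInner B) {v w : E n} (h : ∀ z, B v z = B w z) : v = w := by
  by_contra hne
  have h1 := hB.pos (v - w) (sub_ne_zero.2 hne)
  rw [map_sub B, sub_apply, h (v - w), sub_self] at h1
  exact lt_irrefl _ h1

theorem IsInner.raise_eq_iff (hB : IsInner B) (a : E n →L[ℝ] ℝ) (v : E n) :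
    raise B a = v ↔ ∀ w, B v w = a w :=
  ⟨fun h w => by rw [← h, hB.apply_raise], fun h => hB.ext_left fun w => by
    rw [hB.apply_raise, h]⟩

theorem raise_sub (B : Form n) (a b : E n →L[ℝ] ℝ) : raise B (a - b) = raise B a - raise B b :=
  map_sub _ _ _

theorem raise_smul (B : Form n) (c : ℝ) (a : E n →L[ℝ] ℝ) : raise B (c • a) = c • raise B a :=
  map_smul _ _ _

theorem IsInner.raise_ne_zero (hB : IsInner B) {a : E n →L[ℝ] ℝ} (ha : a ≠ 0) :
    raise B a ≠ 0 := by
  intro h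
  apply ha
  ext v
  rw [← hB.apply_raise, h]
  simp

theorem IsInner.apply_raise_self (hB : IsInner B) (a : E n →L[ℝ] ℝ) :
    a (raise B a) = B (raise B a) (raise B a) :=
  (hB.apply_raise a _).symm

theorem IsInner.raise_pos (hB : IsInner B) {a : E n →L[ℝ] ℝ} (ha : a ≠ 0) :
    0 < a (raise B a) := by
  rw [hB.apply_raise_self]
  exact hB.pos _ (hB.raise_ne_zero ha)

theorem IsInner.raise_comm (hB : IsInner B) (a b : E n →L[ℝ] ℝ) :
    a (raise B b) = b (raise B a) := by
  rw [← hB.apply_raise a, hB.symm, hB.apply_raise]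

/-- A symmetric form has an orthogonal basis; positivity allows each vector to be divided by its
length. -/
theorem IsInner.exists_orthonormal_basis (hB : IsInner B) :
    ∃ e : Module.Basis (Fin n) ℝ (E n), ∀ i j, B (e i) (e j) = if i = j then 1 else 0 := by
  have hsymm : LinearMap.IsSymm (B.toLinearMap₁₂ : LinearMap.BilinForm ℝ (E n)) :=
    (LinearMap.isSymm_def).2 fun x y => hB.symm x y
  obtain ⟨v, hv⟩ := LinearMap.BilinForm.exists_orthogonal_basis hsymm
  have hfin : Module.finrank ℝ (E n) = n := by simp
  let b : Module.Basis (Fin n) ℝ (E n) := v.reindex (finCongr hfin)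
  have hb : ∀ i j, i ≠ j → B (b i) (b j) = 0 := by
    intro i j hij
    have := hv (i := (finCongr hfin).symm i) (j := (finCongr hfin).symm j)
      (fun h => hij ((finCongr hfin).symm.injective h))
    simpa [b] using this
  have hpos : ∀ i, 0 < B (b i) (b i) := fun i => hB.pos _ (b.ne_zero i)
  have hu : ∀ i, IsUnit ((√(B (b i) (b i)))⁻¹) := fun i =>
    (inv_ne_zero (Real.sqrt_pos.2 (hpos i)).ne').isUnit
  refine ⟨b.isUnitSMul hu, fun i j => ?_⟩
  simp only [Module.Basis.isUnitSMul_apply, map_smul, smul_apply, smul_eq_mul]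
  split_ifs with h
  · subst h
    have h1 := Real.mul_self_sqrt (hpos i).le
    have h2 := (Real.sqrt_pos.2 (hpos i)).ne'
    field_simp
    nlinarith
  · rw [hb i j h]; simp

variable {e : Module.Basis (Fin n) ℝ (E n)}

theorem repr_orthonormal
    (he : ∀ i j, B (e i) (e j) = if i = j then 1 else 0) (v : E n) (i : Fin n) :
    e.repr v i = B (e i) v := by
  conv_rhs => rw [← e.sum_repr v]
  simp only [map_sum, map_smul, smul_eq_mul, he, mul_ite, mul_one, mul_zero, Finset.sum_ite_eq,
    Finset.mem_univ, if_true]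

theorem trace_orthonormal
    (he : ∀ i j, B (e i) (e j) = if i = j then 1 else 0) (T : E n →L[ℝ] E n) :
    LinearMap.trace ℝ (E n) (T : E n →ₗ[ℝ] E n) = ∑ i, B (e i) (T (e i)) := by
  rw [LinearMap.trace_eq_matrix_trace ℝ e, Matrix.trace]
  refine Finset.sum_congr rfl fun i _ => ?_
  rw [Matrix.diag_apply, LinearMap.toMatrix_apply, repr_orthonormal he]
  rfl

theorem apply_self_orthonormal
    (he : ∀ i j, B (e i) (e j) = if i = j then 1 else 0) (v : E n) :
    B v v = ∑ i, (e.repr v i) ^ 2 := by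
  conv_lhs => rw [← e.sum_repr v]
  simp only [map_sum, map_smul, sum_apply, smul_apply, smul_eq_mul, he, mul_ite, mul_one, mul_zero,
    Finset.mem_univ, if_true, pow_two, Finset.sum_ite_eq']

/-- A nonnegative quadratic form is at most its trace times the inner product. -/
theorem apply_le_trace_orthonormal
    (he : ∀ i j, B (e i) (e j) = if i = j then 1 else 0) (H : E n →ₗ[ℝ] E n →ₗ[ℝ] ℝ)
    (hsymm : ∀ v w, H v w = H w v) (hH : ∀ v, 0 ≤ H v v) (v : E n) :
    H v v ≤ B v v * ∑ i, H (e i) (e i) := by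
  -- Cauchy–Schwarz for the semidefinite form `H`, by the discriminant. It bounds the off-diagonal
  -- entries, so that `H v v ≤ (∑ |vᵢ| √Hᵢᵢ)²`, and Cauchy–Schwarz for sums finishes.
  have hcs : ∀ v w, H v w ≤ √(H v v) * √(H w w) := by
    intro v w
    have h1 : ∀ t : ℝ, 0 ≤ H w w * (t * t) + (2 * H v w) * t + H v v := by
      intro t
      have := hH (v + t • w)
      simp only [map_add, map_smul, LinearMap.add_apply, LinearMap.smul_apply,
        smul_eq_mul, hsymm w v] at this
      linarith
    have h2 := discrim_le_zero h1
    rw [discrim] at h2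
    rw [← Real.sqrt_mul (hH v)]
    apply Real.le_sqrt_of_sq_le
    nlinarith
  have h1 : H v v = ∑ i, ∑ j, e.repr v i * (e.repr v j * H (e i) (e j)) := by
    conv_lhs => rw [← e.sum_repr v]
    simp only [map_sum, map_smul, LinearMap.sum_apply, LinearMap.smul_apply,
      smul_eq_mul, Finset.mul_sum]
    rw [Finset.sum_comm]
    refine Finset.sum_congr rfl fun i _ => Finset.sum_congr rfl fun j _ => ?_
    ring
  have h2 : H v v ≤ (∑ i, |e.repr v i| * √(H (e i) (e i))) ^ 2 := by
    rw [h1, pow_two, Finset.sum_mul_sum]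
    refine Finset.sum_le_sum fun i _ => Finset.sum_le_sum fun j _ => ?_
    have h3 : |H (e i) (e j)| ≤ √(H (e i) (e i)) * √(H (e j) (e j)) := by
      rw [abs_le']
      refine ⟨hcs _ _, ?_⟩
      have := hcs (-(e i)) (e j)
      simpa using this
    calc e.repr v i * (e.repr v j * H (e i) (e j))
        ≤ |e.repr v i * (e.repr v j * H (e i) (e j))| := le_abs_self _
      _ = |e.repr v i| * |e.repr v j| * |H (e i) (e j)| := by rw [abs_mul, abs_mul]; ring
      _ ≤ |e.repr v i| * |e.repr v j| * (√(H (e i) (e i)) * √(H (e j) (e j))) := by gcongr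
      _ = _ := by ring
  refine h2.trans ((Finset.sum_mul_sq_le_sq_mul_sq _ _ _).trans_eq ?_)
  rw [apply_self_orthonormal he]
  congr 1
  · simp
  · exact Finset.sum_congr rfl fun i _ => Real.sq_sqrt (hH _)

/-- The determinant is multilinear in the rows, and replacing row `i` of the identity by `b` gives
determinant `b i`; hence its derivative at the identity is the trace. -/
theorem hasFDerivAt_det_one {V ι : Type*} [NormedAddCommGroup V] [NormedSpace ℝ V] [Fintype ι]
    [DecidableEq ι] {A : V → Matrix ι ι ℝ} {A' : ι → ι → V →L[ℝ] ℝ} {y : V}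
    (hA : ∀ i j, HasFDerivAt (fun z => A z i j) (A' i j) y) (h1 : A y = 1) :
    HasFDerivAt (fun z => (A z).det) (∑ i, A' i i) y := by
  let D : ContinuousMultilinearMap ℝ (fun _ : ι => ι → ℝ) ℝ :=
    ⟨(Matrix.detRowAlternating : (ι → ℝ) [⋀^ι]→ₗ[ℝ] ℝ).toMultilinearMap,
      Continuous.matrix_det (A := fun x : ι → ι → ℝ => Matrix.of x) continuous_id⟩
  have h := HasFDerivAt.multilinear_comp D (g := fun i z => A z i)
    (g' := fun i => ContinuousLinearMap.pi (A' i)) (x := y) fun i => hasFDerivAt_pi.2 (hA i)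
  refine h.congr_fderiv ?_
  refine Finset.sum_congr rfl fun i _ => ?_
  ext v
  have h2 : ∀ b : ι → ℝ, Matrix.det (Matrix.updateRow (1 : Matrix ι ι ℝ) i b) = b i := by
    intro b
    have h3 := congrFun (Matrix.cramer_apply (1 : Matrix ι ι ℝ) b |> fun h => funext h) i
    rw [Matrix.cramer_one] at h3
    rw [← Matrix.det_transpose, ← Matrix.updateCol_transpose, Matrix.transpose_one, ← h3]
    rfl
  have h4 := h2 (fun j => A' i j v)
  rw [← h1] at h4
  exact h4

theorem det_gram_family (B : Form n) (e : Fin n → E n) :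
    (Matrix.of fun i j : Fin n => B (e i) (e j)).det =
      ((EuclideanSpace.basisFun (Fin n) ℝ).toBasis.toMatrix e).det ^ 2 *
      (Matrix.of fun i j : Fin n =>
        B (EuclideanSpace.single i 1) (EuclideanSpace.single j 1)).det := by
  set b := (EuclideanSpace.basisFun (Fin n) ℝ).toBasis with hb
  have hbi : ∀ i, b i = EuclideanSpace.single i 1 := by intro i; simp [hb]
  have : (Matrix.of fun i j : Fin n => B (e i) (e j)) =
      (b.toMatrix e).transpose * (Matrix.of fun i j : Fin n => B (b i) (b j)) * b.toMatrix e := by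
    ext i j
    simp only [Matrix.of_apply, Matrix.mul_apply, Matrix.transpose_apply, Module.Basis.toMatrix_apply]
    conv_lhs => rw [← b.sum_repr (e i), ← b.sum_repr (e j)]
    simp only [map_sum, map_smul, sum_apply, smul_apply,
      smul_eq_mul, Finset.sum_mul, Finset.mul_sum]
    refine Finset.sum_congr rfl fun k _ => Finset.sum_congr rfl fun l _ => ?_
    ring
  rw [this, Matrix.det_mul, Matrix.det_mul, Matrix.det_transpose]
  simp only [hbi]
  ring

theorem det_mul_det_orthonormal
    (he : ∀ i j, B (e i) (e j) = if i = j then 1 else 0) :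
    ((EuclideanSpace.basisFun (Fin n) ℝ).toBasis.toMatrix e).det ^ 2 *
      (Matrix.of fun i j : Fin n =>
        B (EuclideanSpace.single i 1) (EuclideanSpace.single j 1)).det = 1 := by
  rw [← det_gram_family]
  have : (Matrix.of fun i j : Fin n => B (e i) (e j)) = 1 := by
    ext i j
    simp [he, Matrix.one_apply]
  rw [this, Matrix.det_one]

theorem IsInner.det_pos (hB : IsInner B) :
    0 < (Matrix.of fun i j : Fin n =>
        B (EuclideanSpace.single i 1) (EuclideanSpace.single j 1)).det := by
  obtain ⟨e, he⟩ := hB.exists_orthonormal_basis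
  have h := det_mul_det_orthonormal he
  by_contra hneg
  nlinarith [sq_nonneg ((EuclideanSpace.basisFun (Fin n) ℝ).toBasis.toMatrix e).det]

theorem IsInner.density_pos (hB : IsInner B) : 0 < density B := Real.sqrt_pos.2 hB.det_pos

theorem contDiff_det_gram {k : WithTop ℕ∞} : ContDiff ℝ k fun B : Form n =>
    (Matrix.of fun i j : Fin n =>
      B (EuclideanSpace.single i 1) (EuclideanSpace.single j 1)).det := by
  simp only [Matrix.det_apply]
  refine ContDiff.sum fun σ _ => ContDiff.const_smul _ (contDiff_prod fun i _ => ?_)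
  simp only [Matrix.of_apply]
  fun_prop

theorem IsInner.contDiffAt_density {k : WithTop ℕ∞} (hB : IsInner B) :
    ContDiffAt ℝ k (density (n := n)) B :=
  contDiff_det_gram.contDiffAt.sqrt hB.det_pos.ne'

theorem IsInner.contDiffAt_inverse {k : WithTop ℕ∞} (hB : IsInner B) :
    ContDiffAt ℝ k (ContinuousLinearMap.inverse : Form n → (E n →L[ℝ] ℝ) →L[ℝ] E n) B := by
  obtain ⟨e, rfl⟩ := exists_equiv B hB.pos
  exact contDiffAt_map_inverse e

/-- Jacobi's formula. In the basis `e` the Gram matrix of `B` is the identity, where the derivative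
of the determinant is the trace; the change of basis multiplies all Gram determinants by one
constant `c`, with `c⁻¹ = d B`. The square root gives the factor 1/2. -/
theorem IsInner.fderiv_density (hB : IsInner B)
    (he : ∀ i j, B (e i) (e j) = if i = j then 1 else 0) (C : Form n) :
    fderiv ℝ (density (n := n)) B C = density B * ((∑ i, C (e i) (e i)) / 2) := by
  set c := ((EuclideanSpace.basisFun (Fin n) ℝ).toBasis.toMatrix e).det ^ 2 with hc
  set d : Form n → ℝ := fun B => (Matrix.of fun i j : Fin n =>
      B (EuclideanSpace.single i 1) (EuclideanSpace.single j 1)).det with hd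
  have hcd : c * d B = 1 := det_mul_det_orthonormal he
  have hc0 : c ≠ 0 := left_ne_zero_of_mul_eq_one hcd
  have hdB : 0 < d B := hB.det_pos
  let ev : Fin n → Fin n → Form n →L[ℝ] ℝ := fun i j =>
    (ContinuousLinearMap.apply ℝ ℝ (e j)).comp (ContinuousLinearMap.apply ℝ (E n →L[ℝ] ℝ) (e i))
  have h1 : HasFDerivAt (fun B' : Form n => (Matrix.of fun i j : Fin n => B' (e i) (e j)).det)
      (∑ i, ev i i) B := by
    refine hasFDerivAt_det_one (A := fun B' : Form n => Matrix.of fun i j : Fin n => B' (e i) (e j))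
      (A' := ev)
      (fun i j => ContinuousLinearMap.hasFDerivAt (𝕜 := ℝ) (E := Form n) (F := ℝ) (ev i j)) ?_
    ext i j
    simp [he, Matrix.one_apply]
  have h2 : HasFDerivAt d (c⁻¹ • ∑ i, ev i i) B := by
    refine (HasFDerivAt.const_mul (𝕜 := ℝ) (E := Form n) (𝔸 := ℝ) h1 c⁻¹).congr_of_eventuallyEq
      (Eventually.of_forall fun B' => ?_)
    show d B' = c⁻¹ * _
    rw [det_gram_family B' e]
    show d B' = c⁻¹ * (c * d B')
    field_simp
  have h3 : HasFDerivAt (density (n := n)) _ B := h2.sqrt hdB.ne'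
  rw [h3.fderiv]
  have h4 : density B = √(d B) := rfl
  have h5 : c⁻¹ = d B := by field_simp; linarith
  have h6 := Real.sqrt_pos.2 hdB
  rw [h5, h4]
  simp only [smul_apply, sum_apply, smul_eq_mul]
  have h7 : ∀ i, ev i i C = C (e i) (e i) := fun i => rfl
  simp only [h7]
  have h8 := Real.mul_self_sqrt hdB.le
  field_simp
  rw [Real.sq_sqrt hdB.le]

theorem IsInner.cauchy_schwarz (hB : IsInner B) (v w : E n) :
    B v w ≤ √(B v v) * √(B w w) := by
  have h1 : ∀ t : ℝ, 0 ≤ B w w * (t * t) + (2 * B v w) * t + B v v := by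
    intro t
    have := hB.nonneg (v + t • w)
    simp only [map_add, map_smul, add_apply, smul_apply,
      smul_eq_mul, hB.symm w v] at this
    linarith
  have h2 := discrim_le_zero h1
  rw [discrim] at h2
  rw [← Real.sqrt_mul (hB.nonneg v)]
  apply Real.le_sqrt_of_sq_le
  nlinarith

theorem rpow_sub_two_mul_sq {p s : ℝ} (hs : 0 ≤ s) : s ^ (p - 2) * s ^ 2 = s ^ (p - 1) * s := by
  rcases hs.eq_or_lt with rfl | h
  · simp
  · rw [pow_two, ← mul_assoc]
    congr 1
    rw [← Real.rpow_add_one h.ne']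
    congr 1
    ring

/-- Monotonicity of `a ↦ |a|^(p-2) a`. -/
theorem IsInner.monotone_flux (hB : IsInner B) {p : ℝ} (hp : 1 < p) (v w : E n) :
    0 ≤ B (√(B v v) ^ (p - 2) • v - √(B w w) ^ (p - 2) • w) (v - w) := by
  set s := √(B v v) with hs
  set t := √(B w w) with ht
  have hs0 : 0 ≤ s := Real.sqrt_nonneg _
  have ht0 : 0 ≤ t := Real.sqrt_nonneg _
  have hv : B v v = s ^ 2 := (Real.sq_sqrt (hB.nonneg v)).symm
  have hw : B w w = t ^ 2 := (Real.sq_sqrt (hB.nonneg w)).symm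
  have hcs : B v w ≤ s * t := hB.cauchy_schwarz v w
  have h1 : 0 ≤ s ^ (p - 2) := Real.rpow_nonneg hs0 _
  have h2 : 0 ≤ t ^ (p - 2) := Real.rpow_nonneg ht0 _
  have hm : ∀ a b : ℝ, 0 ≤ a → 0 ≤ b → a ^ (p - 2) * (a * b) ≤ a ^ (p - 1) * b := by
    intro a b ha hb
    rcases ha.eq_or_lt with rfl | h
    · simp only [zero_mul, mul_zero]
      positivity
    · rw [← mul_assoc, ← Real.rpow_add_one h.ne']
      apply le_of_eq
      congr 2
      ring
  have h3 : s ^ (p - 2) * s ^ 2 = s ^ (p - 1) * s := rpow_sub_two_mul_sq hs0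
  have h4 : t ^ (p - 2) * t ^ 2 = t ^ (p - 1) * t := rpow_sub_two_mul_sq ht0
  have h5 := hm s t hs0 ht0
  have h6 := hm t s ht0 hs0
  -- By Cauchy–Schwarz the pairing is at least this product, which is nonnegative because `s ↦ s ^
  -- (p - 1)` is increasing.
  have h7 : 0 ≤ (s ^ (p - 1) - t ^ (p - 1)) * (s - t) := by
    rcases le_total s t with h | h
    · exact mul_nonneg_of_nonpos_of_nonpos
        (sub_nonpos.2 (Real.rpow_le_rpow hs0 h (by linarith))) (sub_nonpos.2 h)
    · exact mul_nonneg
        (sub_nonneg.2 (Real.rpow_le_rpow ht0 h (by linarith))) (sub_nonneg.2 h)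
  have h8 := mul_le_mul_of_nonneg_left hcs h1
  have h9 := mul_le_mul_of_nonneg_left hcs h2
  simp only [map_sub, map_smul, sub_apply, smul_apply,
    smul_eq_mul, hv, hw, hB.symm w v]
  nlinarith

end Algebra

/-! ### Flux, divergence and covariant Hessian in coordinates. -/

/-- The vector density `√det(g_ij) |a|^(p-2) a♯` of a covector `a`. -/
def flux {n : ℕ} (B : Form n) (p : ℝ) (a : E n →L[ℝ] ℝ) : E n :=
  (density B * √(a (raise B a)) ^ (p - 2)) • raise B a

/-- The divergence of a vector field on the model space. -/
def divergence {n : ℕ} (V : E n → E n) (y : E n) : ℝ :=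
  LinearMap.trace ℝ (E n) (fderiv ℝ V y : E n →ₗ[ℝ] E n)

/-- The covariant Hessian of `F` at `y` for the metric `G`. -/
def hess {n : ℕ} (G : E n → Form n) (F : E n → ℝ) (y : E n) : E n →ₗ[ℝ] E n →ₗ[ℝ] ℝ :=
  LinearMap.mk₂ ℝ (fun v w => fderiv ℝ (fderiv ℝ F) y v w -
      (fderiv ℝ G y v w (raise (G y) (fderiv ℝ F y)) + fderiv ℝ G y w v (raise (G y) (fderiv ℝ F y))
        - fderiv ℝ G y (raise (G y) (fderiv ℝ F y)) v w) / 2)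
    (fun v v' w => by simp only [map_add, add_apply]; ring)
    (fun c v w => by simp only [map_smul, smul_apply, smul_eq_mul]; ring)
    (fun v w w' => by simp only [map_add, add_apply]; ring)
    (fun c v w => by simp only [map_smul, smul_apply, smul_eq_mul]; ring)

section Divergence

variable {n : ℕ} {G : E n → Form n} {F : E n → ℝ} {y : E n}

theorem hess_apply (v w : E n) : hess G F y v w = fderiv ℝ (fderiv ℝ F) y v w -
      (fderiv ℝ G y v w (raise (G y) (fderiv ℝ F y)) + fderiv ℝ G y w v (raise (G y) (fderiv ℝ F y))
        - fderiv ℝ G y (raise (G y) (fderiv ℝ F y)) v w) / 2 := rfl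

theorem fderiv_apply₂ (hG : DifferentiableAt ℝ G y) (v w z : E n) :
    fderiv ℝ (fun z => G z v w) y z = fderiv ℝ G y z v w := by
  have h1 : HasFDerivAt (fun z => G z v) (_ : E n →L[ℝ] E n →L[ℝ] ℝ) y :=
    hG.hasFDerivAt.clm_apply (hasFDerivAt_const v y)
  have h2 : HasFDerivAt (fun z => G z v w) (_ : E n →L[ℝ] ℝ) y :=
    h1.clm_apply (hasFDerivAt_const w y)
  rw [h2.fderiv]
  simp

theorem fderiv_symm (hG : DifferentiableAt ℝ G y) (hI : ∀ᶠ z in 𝓝 y, IsInner (G z))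
    (z v w : E n) : fderiv ℝ G y z v w = fderiv ℝ G y z w v := by
  rw [← fderiv_apply₂ hG, ← fderiv_apply₂ hG]
  congr 1
  exact Filter.EventuallyEq.fderiv_eq (hI.mono fun z hz => hz.symm v w)

theorem hess_symm (hG : DifferentiableAt ℝ G y) (hI : ∀ᶠ z in 𝓝 y, IsInner (G z))
    (hF : ContDiffAt ℝ 2 F y) (v w : E n) : hess G F y v w = hess G F y w v := by
  have h1 := (hF.isSymmSndFDerivAt (by simp)).eq v w
  rw [hess_apply, hess_apply, h1, fderiv_symm hG hI (raise _ _) v w]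
  ring

theorem contDiffAt_raise {k : WithTop ℕ∞} {a : E n → E n →L[ℝ] ℝ} (hG : ContDiffAt ℝ k G y)
    (hI : IsInner (G y)) (ha : ContDiffAt ℝ k a y) :
    ContDiffAt ℝ k (fun z => raise (G z) (a z)) y := by
  have h1 : ContDiffAt ℝ k (fun z => (G z).inverse) y :=
    ContDiffAt.comp (𝕜 := ℝ) (F := Form n) y hI.contDiffAt_inverse hG
  exact h1.clm_apply ha

theorem contDiffAt_flux {k : WithTop ℕ∞} {a : E n → E n →L[ℝ] ℝ} (p : ℝ)
    (hG : ContDiffAt ℝ k G y) (hI : IsInner (G y)) (ha : ContDiffAt ℝ k a y) (h0 : a y ≠ 0) :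
    ContDiffAt ℝ k (fun z => flux (G z) p (a z)) y := by
  have h1 := contDiffAt_raise hG hI ha
  have h2 : ContDiffAt ℝ k (fun z => density (G z)) y :=
    ContDiffAt.comp (𝕜 := ℝ) (F := Form n) y hI.contDiffAt_density hG
  have h3 := (hI.raise_pos h0).ne'
  exact (h2.mul (((ha.clm_apply h1).sqrt h3).rpow_const_of_ne
    (Real.sqrt_ne_zero'.2 (hI.raise_pos h0)))).smul h1

/-- Differentiating the identity `G z w (X z) = dF w` gives the derivative of the gradient `X`. The
product rule then has three contributions: the trace of this derivative, the derivative of the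
density along `X`, and that of `|dF|^(p-2)` along `X`. The first two combine to the trace of the
Hessian, the third yields the term with `p - 2`. -/
theorem divergence_flux (p : ℝ) (hG : ContDiffAt ℝ 1 G y) (hI : ∀ᶠ z in 𝓝 y, IsInner (G z))
    (hF : ContDiffAt ℝ 2 F y) (h0 : fderiv ℝ F y ≠ 0) {e : Module.Basis (Fin n) ℝ (E n)}
    (he : ∀ i j, G y (e i) (e j) = if i = j then 1 else 0) :
    divergence (fun z => flux (G z) p (fderiv ℝ F z)) y =
      density (G y) * √(fderiv ℝ F y (raise (G y) (fderiv ℝ F y))) ^ (p - 2) *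
      (∑ i, hess G F y (e i) (e i) + (p - 2) *
        hess G F y (raise (G y) (fderiv ℝ F y)) (raise (G y) (fderiv ℝ F y)) /
          fderiv ℝ F y (raise (G y) (fderiv ℝ F y))) := by
  have hIy : IsInner (G y) := hI.self_of_nhds
  have hdG : DifferentiableAt ℝ G y := hG.differentiableAt one_ne_zero
  have ha : ContDiffAt ℝ 1 (fderiv ℝ F) y := hF.fderiv_right (by norm_num)
  have hda := (ha.differentiableAt one_ne_zero).hasFDerivAt
  set X : E n → E n := fun z => raise (G z) (fderiv ℝ F z) with hX
  have hdX : HasFDerivAt X (fderiv ℝ X y) y :=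
    ((contDiffAt_raise hG hIy ha).differentiableAt one_ne_zero).hasFDerivAt
  set X' := fderiv ℝ X y
  set G' := fderiv ℝ G y with hG'
  set a' := fderiv ℝ (fderiv ℝ F) y with ha'
  -- derivative of the dual vector field
  have key : ∀ v w, G y w (X' v) = a' v w - G' v w (X y) := by
    intro v w
    have h1 : HasFDerivAt (fun z => G z w) (_ : E n →L[ℝ] E n →L[ℝ] ℝ) y :=
      hdG.hasFDerivAt.clm_apply (hasFDerivAt_const w y)
    have h2 := h1.clm_apply hdX
    have h3 : HasFDerivAt (fun z => fderiv ℝ F z w) _ y := hda.clm_apply (hasFDerivAt_const w y)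
    have h4 : (fun z => fderiv ℝ F z w) =ᶠ[𝓝 y] fun z => G z w (X z) :=
      hI.mono fun z hz => by
        show fderiv ℝ F z w = G z w (X z)
        rw [hz.symm, hz.apply_raise]
    have h5 := DFunLike.congr_fun ((h3.congr_of_eventuallyEq h4.symm).unique h2) v
    simp at h5
    linarith
  set q : E n → ℝ := fun z => fderiv ℝ F z (X z) with hq
  have hqy : 0 < q y := hIy.raise_pos h0
  have hdq : HasFDerivAt q _ y := hda.clm_apply hdX
  have hds := (hdq.sqrt hqy.ne').rpow_const (p := p - 2) (Or.inl (Real.sqrt_ne_zero'.2 hqy))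
  have hdens : HasFDerivAt (fun z => density (G z)) ((fderiv ℝ (density (n := n)) (G y)).comp G') y :=
    HasFDerivAt.comp (𝕜 := ℝ) (F := Form n) y
      (hIy.contDiffAt_density.differentiableAt one_ne_zero).hasFDerivAt hdG.hasFDerivAt
  obtain ⟨c', hc', hc⟩ : ∃ c', HasFDerivAt (fun z => density (G z) * √(q z) ^ (p - 2)) c' y ∧
      c' = _ := ⟨_, hdens.mul hds, rfl⟩
  have hV : HasFDerivAt (fun z => flux (G z) p (fderiv ℝ F z)) _ y := hc'.smul hdX
  rw [divergence, hV.fderiv, trace_orthonormal he]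
  have hs : 0 < √(q y) := Real.sqrt_pos.2 hqy
  have hs2 : √(q y) ^ 2 = q y := Real.sq_sqrt hqy.le
  have hpow : √(q y) ^ (p - 2 - 1) = √(q y) ^ (p - 2) / √(q y) := by
    rw [Real.rpow_sub hs _ 1, Real.rpow_one]
  have hsum : ∀ ℓ : E n →L[ℝ] ℝ, ∑ i, ℓ (e i) * G y (e i) (X y) = ℓ (X y) := by
    intro ℓ
    conv_rhs => rw [← e.sum_repr (X y)]
    simp only [map_sum, map_smul, smul_eq_mul, repr_orthonormal he]
    exact Finset.sum_congr rfl fun i _ => mul_comm _ _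
  have hXX : fderiv ℝ F y (X' (X y)) = a' (X y) (X y) - G' (X y) (X y) (X y) := by
    rw [← key, ← hIy.apply_raise]
  simp only [add_apply, smul_apply, ContinuousLinearMap.smulRight_apply, map_add, map_smul,
    smul_eq_mul, Finset.sum_add_distrib]
  have hX2 : raise (G y) (fderiv ℝ F y) = X y := rfl
  simp only [hX2]
  rw [hsum, hc]
  simp only [add_apply, smul_apply, smul_eq_mul, ContinuousLinearMap.comp_apply,
    ContinuousLinearMap.flip_apply, hIy.fderiv_density he]
  rw [← Finset.mul_sum]
  simp only [key, hXX, hess_apply]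
  simp only [hX2, ← hG', ← ha']
  have hq2 : fderiv ℝ F y (X y) = q y := rfl
  simp only [hq2, hpow]
  -- The first part is the diagonal entry of the derivative of `X`; the last is the share of the
  -- density's derivative.
  have h6 : ∀ i, a' (e i) (e i) - (G' (e i) (e i) (X y) + G' (e i) (e i) (X y) -
      G' (X y) (e i) (e i)) / 2 = (a' (e i) (e i) - G' (e i) (e i) (X y)) +
      G' (X y) (e i) (e i) / 2 := fun i => by ring
  simp only [h6, Finset.sum_add_distrib, ← Finset.sum_div]
  generalize √(q y) = s at hs hs2 ⊢
  rw [← hs2]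
  field_simp
  ring

theorem hess_le_trace (hG : ContDiffAt ℝ 1 G y) (hI : ∀ᶠ z in 𝓝 y, IsInner (G z))
    (hF : ContDiffAt ℝ 2 F y) (h0 : fderiv ℝ F y ≠ 0) {e : Module.Basis (Fin n) ℝ (E n)}
    (he : ∀ i j, G y (e i) (e j) = if i = j then 1 else 0) (hH : ∀ v, 0 ≤ hess G F y v v) :
    hess G F y (raise (G y) (fderiv ℝ F y)) (raise (G y) (fderiv ℝ F y)) /
      fderiv ℝ F y (raise (G y) (fderiv ℝ F y)) ≤ ∑ i, hess G F y (e i) (e i) := by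
  have hIy : IsInner (G y) := hI.self_of_nhds
  rw [div_le_iff₀' (hIy.raise_pos h0), hIy.apply_raise_self]
  exact apply_le_trace_orthonormal he _ (hess_symm (hG.differentiableAt one_ne_zero) hI hF) hH _

/-- With `h` the Hessian in the normalized gradient direction, `tr + (p - 2) h = (tr - h) + (p - 1)
h`, and both summands are nonnegative. This is where `1 ≤ p` enters. -/
theorem divergence_flux_nonneg {p : ℝ} (hp : 1 ≤ p) (hG : ContDiffAt ℝ 1 G y)
    (hI : ∀ᶠ z in 𝓝 y, IsInner (G z)) (hF : ContDiffAt ℝ 2 F y) (h0 : fderiv ℝ F y ≠ 0)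
    (hH : ∀ v, 0 ≤ hess G F y v v) :
    0 ≤ divergence (fun z => flux (G z) p (fderiv ℝ F z)) y := by
  have hIy : IsInner (G y) := hI.self_of_nhds
  obtain ⟨e, he⟩ := hIy.exists_orthonormal_basis
  rw [divergence_flux p hG hI hF h0 he]
  have h1 := hess_le_trace hG hI hF h0 he hH
  have h2 := div_nonneg (hH (raise (G y) (fderiv ℝ F y))) (hIy.raise_pos h0).le
  refine mul_nonneg (mul_nonneg hIy.density_pos.le (Real.rpow_nonneg (Real.sqrt_nonneg _) _)) ?_
  rw [mul_div_assoc]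
  nlinarith

/-- The same splitting: the summand `(p - 1) h` is now strictly positive. -/
theorem divergence_flux_pos {p : ℝ} (hp : 1 < p) (hG : ContDiffAt ℝ 1 G y)
    (hI : ∀ᶠ z in 𝓝 y, IsInner (G z)) (hF : ContDiffAt ℝ 2 F y) (h0 : fderiv ℝ F y ≠ 0)
    (hH : ∀ v, 0 ≤ hess G F y v v)
    (hX : 0 < hess G F y (raise (G y) (fderiv ℝ F y)) (raise (G y) (fderiv ℝ F y))) :
    0 < divergence (fun z => flux (G z) p (fderiv ℝ F z)) y := by
  have hIy : IsInner (G y) := hI.self_of_nhds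
  obtain ⟨e, he⟩ := hIy.exists_orthonormal_basis
  rw [divergence_flux p hG hI hF h0 he]
  have h1 := hess_le_trace hG hI hF h0 he hH
  have h2 := div_pos hX (hIy.raise_pos h0)
  refine mul_pos (mul_pos hIy.density_pos
    (Real.rpow_pos_of_pos (Real.sqrt_pos.2 (hIy.raise_pos h0)) _)) ?_
  rw [mul_div_assoc]
  nlinarith

theorem divergence_eq_sum (V : E n → E n) (y : E n) :
    divergence V y = ∑ i, fderiv ℝ V y (EuclideanSpace.single i 1) i := by
  rw [divergence, LinearMap.trace_eq_matrix_trace ℝ (EuclideanSpace.basisFun (Fin n) ℝ).toBasis,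
    Matrix.trace]
  refine Finset.sum_congr rfl fun i _ => ?_
  rw [Matrix.diag_apply, LinearMap.toMatrix_apply]
  simp

theorem continuousOn_divergence {V : E n → E n} {U : Set (E n)} (hU : IsOpen U)
    (hV : ContDiffOn ℝ 1 V U) : ContinuousOn (divergence V) U := by
  have h1 : divergence V = fun y => ∑ i, fderiv ℝ V y (EuclideanSpace.single i 1) i :=
    funext (divergence_eq_sum V)
  rw [h1]
  have h2 := hV.continuousOn_fderiv_of_isOpen hU le_rfl
  refine continuousOn_finsetSum _ fun i _ => ?_
  have h3 := h2.clm_apply (continuousOn_const (c := EuclideanSpace.single i (1 : ℝ)))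
  exact (EuclideanSpace.proj (𝕜 := ℝ) i).continuous.comp_continuousOn h3

/-- Nothing is known of `f` off `U`, but near such points the factor `ζ` vanishes identically. -/
theorem continuous_mul_of_tsupport_subset {X : Type*} [TopologicalSpace X] {U : Set X}
    (hU : IsOpen U) {f ζ : X → ℝ} (hf : ContinuousOn f U) (hζ : Continuous ζ)
    (hs : tsupport ζ ⊆ U) : Continuous fun x => f x * ζ x := by
  refine continuous_of_tsupport fun x hx => ?_
  have hx' : x ∈ U := hs (closure_mono (Function.support_mul_subset_right f ζ) hx)
  exact (hf.continuousAt (hU.mem_nhds hx')).mul hζ.continuousAt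

theorem integrable_mul_of_tsupport_subset {U : Set (E n)} (hU : IsOpen U) {f ζ : E n → ℝ}
    (hf : ContinuousOn f U) (hζ : Continuous ζ) (hc : HasCompactSupport ζ) (hs : tsupport ζ ⊆ U) :
    Integrable fun x => f x * ζ x :=
  (continuous_mul_of_tsupport_subset hU hf hζ hs).integrable_of_hasCompactSupport hc.mul_left

/-- Integration by parts in each coordinate; the compact support of `ζ` inside `U` removes boundary
terms and any dependence on `V` outside `U`. -/
theorem integral_fderiv_apply {V : E n → E n} {U : Set (E n)} (hU : IsOpen U)
    (hV : ContDiffOn ℝ 1 V U) {ζ : E n → ℝ} (hζ : ContDiff ℝ 1 ζ) (hc : HasCompactSupport ζ)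
    (hs : tsupport ζ ⊆ U) :
    ∫ y, fderiv ℝ ζ y (V y) = -∫ y, divergence V y * ζ y := by
  have hVi : ∀ i, ContDiffOn ℝ 1 (fun y => V y i) U := fun i =>
    (EuclideanSpace.proj (𝕜 := ℝ) i).contDiff.comp_contDiffOn hV
  have hdV : ∀ y ∈ U, DifferentiableAt ℝ V y := fun y hy =>
    (hV.contDiffAt (hU.mem_nhds hy)).differentiableAt one_ne_zero
  have hdVi : ∀ i, ∀ y ∈ U, ∀ v, fderiv ℝ (fun y => V y i) y v = fderiv ℝ V y v i := by
    intro i y hy v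
    have := ((EuclideanSpace.proj (𝕜 := ℝ) i).hasFDerivAt.comp y (hdV y hy).hasFDerivAt).fderiv
    exact DFunLike.congr_fun this v
  have hcζ : ∀ v, Continuous fun y => fderiv ℝ ζ y v := fun v =>
    (hζ.continuous_fderiv one_ne_zero).clm_apply continuous_const
  have hsupp : ∀ v, tsupport (fun y => fderiv ℝ ζ y v) ⊆ tsupport ζ := fun v =>
    tsupport_fderiv_apply_subset ℝ v
  have hi1 : ∀ i, Integrable fun y => V y i * fderiv ℝ ζ y (EuclideanSpace.single i 1) := fun i =>
    integrable_mul_of_tsupport_subset hU (hVi i).continuousOn (hcζ _)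
      (hc.fderiv_apply ℝ (EuclideanSpace.single i (1 : ℝ))) ((hsupp _).trans hs)
  have hi2 : ∀ i, Integrable fun y =>
      fderiv ℝ (fun y => V y i) y (EuclideanSpace.single i 1) * ζ y := fun i =>
    integrable_mul_of_tsupport_subset hU
      (((hVi i).continuousOn_fderiv_of_isOpen hU le_rfl).clm_apply continuousOn_const)
      hζ.continuous hc hs
  have hibp : ∀ i, ∫ y, V y i * fderiv ℝ ζ y (EuclideanSpace.single i 1) =
      -∫ y, fderiv ℝ (fun y => V y i) y (EuclideanSpace.single i 1) * ζ y := fun i =>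
    integral_mul_fderiv_eq_neg_fderiv_mul_of_integrable (hi2 i) (hi1 i)
      (integrable_mul_of_tsupport_subset hU (hVi i).continuousOn hζ.continuous hc hs)
      (fun y hy => ((hVi i).contDiffAt (hU.mem_nhds (hs hy))).differentiableAt one_ne_zero)
      (fun y _ => (hζ.differentiable one_ne_zero) y)
  have h1 : ∀ y, fderiv ℝ ζ y (V y) =
      ∑ i, V y i * fderiv ℝ ζ y (EuclideanSpace.single i 1) := by
    intro y
    conv_lhs => rw [← (EuclideanSpace.basisFun (Fin n) ℝ).sum_repr (V y)]
    simp
  have h2 : ∀ y, divergence V y * ζ y =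
      ∑ i, fderiv ℝ (fun y => V y i) y (EuclideanSpace.single i 1) * ζ y := by
    intro y
    rw [divergence_eq_sum, Finset.sum_mul]
    refine Finset.sum_congr rfl fun i _ => ?_
    by_cases hy : y ∈ U
    · rw [hdVi i y hy]
    · rw [image_eq_zero_of_notMem_tsupport (fun h => hy (hs h)), mul_zero, mul_zero]
  simp only [h1, h2]
  rw [integral_finsetSum _ fun i _ => hi1 i, integral_finsetSum _ fun i _ => hi2 i,
    ← Finset.sum_neg_distrib]
  exact Finset.sum_congr rfl fun i _ => hibp i

end Divergence

/-! ### Mollification in L^p and of weak derivatives. -/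

/-- Convolution with a normalized bump function. -/
def mollify {n : ℕ} (φ : ContDiffBump (0 : E n)) (f : E n → ℝ) : E n → ℝ :=
  convolution (φ.normed volume) f (ContinuousLinearMap.lsmul ℝ ℝ) volume

section Mollify

variable {n : ℕ} (φ : ContDiffBump (0 : E n))

theorem mollify_apply (f : E n → ℝ) (x : E n) :
    mollify φ f x = ∫ t, φ.normed volume t * f (x - t) := rfl

theorem mollify_apply_swap (f : E n → ℝ) (x : E n) :
    mollify φ f x = ∫ t, φ.normed volume (x - t) * f t :=
  convolution_eq_swap (ContinuousLinearMap.lsmul ℝ ℝ)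

theorem contDiff_mollify {f : E n → ℝ} (hf : LocallyIntegrable f) : ContDiff ℝ ∞ (mollify φ f) :=
  φ.hasCompactSupport_normed.contDiff_convolution_left _ φ.contDiff_normed hf

theorem mollify_sub {f g : E n → ℝ} (hf : LocallyIntegrable f) (hg : LocallyIntegrable g) :
    mollify φ (f - g) = mollify φ f - mollify φ g := by
  have hi : ∀ {h : E n → ℝ}, LocallyIntegrable h → ∀ x,
      Integrable fun t => φ.normed volume (x - t) * h t := by
    intro h hh x
    have hc : HasCompactSupport fun t => φ.normed volume (x - t) :=
      φ.hasCompactSupport_normed.comp_homeomorph (Homeomorph.subLeft x)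
    have := hh.integrable_smul_left_of_hasCompactSupport
      (φ.continuous_normed.comp (continuous_const.sub continuous_id)) hc
    exact this
  ext x
  rw [Pi.sub_apply, mollify_apply_swap, mollify_apply_swap, mollify_apply_swap,
    ← integral_sub (hi hf x) (hi hg x)]
  exact integral_congr_ae (Eventually.of_forall fun t => by simp [mul_sub])

/-- The probability measure with density a normalized bump function. -/
def bumpMeasure : Measure (E n) :=
  volume.withDensity fun t => ENNReal.ofReal (φ.normed volume t)

instance : IsProbabilityMeasure (bumpMeasure φ) := ⟨by
  rw [bumpMeasure, withDensity_apply _ MeasurableSet.univ, Measure.restrict_univ,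
    ← ofReal_integral_eq_lintegral_ofReal φ.integrable_normed
      (Eventually.of_forall φ.nonneg_normed), φ.integral_normed, ENNReal.ofReal_one]⟩

theorem aestronglyMeasurable_bumpMeasure {f : E n → ℝ} (hf : AEStronglyMeasurable f volume) (x : E n) :
    AEStronglyMeasurable (fun t => f (x - t)) (bumpMeasure φ) := by
  have h1 : AEStronglyMeasurable (fun t => f (x - t)) volume :=
    hf.comp_quasiMeasurePreserving (quasiMeasurePreserving_sub_left volume x)
  exact h1.mono_ac (withDensity_absolutelyContinuous _ _)

/-- A mollification is an average against the probability measure `bumpMeasure φ`, for which L¹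
norms are at most L^p norms. -/
theorem enorm_mollify_le {f : E n → ℝ} (hf : AEStronglyMeasurable f volume) {p : ℝ≥0∞} (hp : 1 ≤ p)
    (x : E n) : ‖mollify φ f x‖ₑ ≤ eLpNorm (fun t => f (x - t)) p (bumpMeasure φ) := by
  refine le_trans ?_ (eLpNorm_le_eLpNorm_of_exponent_le hp
    (aestronglyMeasurable_bumpMeasure φ hf x))
  rw [mollify_apply, eLpNorm_one_eq_lintegral_enorm, bumpMeasure,
    lintegral_withDensity_eq_lintegral_mul_non_measurable _
      φ.continuous_normed.measurable.ennreal_ofReal (by simp)]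
  refine (enorm_integral_le_lintegral_enorm _).trans_eq (lintegral_congr fun t => ?_)
  rw [enorm_mul, Pi.mul_apply, Real.enorm_of_nonneg (φ.nonneg_normed t)]

/-- Mollification does not increase `L^p` norms. -/
theorem eLpNorm_mollify_le {f : E n → ℝ} (hf : AEStronglyMeasurable f volume) {p : ℝ≥0∞} (hp : 1 ≤ p)
    (hp' : p ≠ ⊤) : eLpNorm (mollify φ f) p volume ≤ eLpNorm f p volume := by
  have hp0 : p ≠ 0 := (zero_lt_one.trans_le hp).ne'
  have hpr : 0 < p.toReal := ENNReal.toReal_pos hp0 hp'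
  rw [eLpNorm_eq_lintegral_rpow_enorm_toReal hp0 hp', eLpNorm_eq_lintegral_rpow_enorm_toReal hp0 hp']
  refine ENNReal.rpow_le_rpow ?_ (by positivity)
  -- Integrate the pointwise bound, exchange the integrals by Tonelli and use translation
  -- invariance.
  calc ∫⁻ x, ‖mollify φ f x‖ₑ ^ p.toReal
      ≤ ∫⁻ x, ∫⁻ t, ‖f (x - t)‖ₑ ^ p.toReal ∂(bumpMeasure φ) := by
        refine lintegral_mono fun x => ?_
        refine (ENNReal.rpow_le_rpow (enorm_mollify_le φ hf hp x) hpr.le).trans_eq ?_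
        rw [eLpNorm_eq_lintegral_rpow_enorm_toReal hp0 hp', ← ENNReal.rpow_mul,
          one_div_mul_cancel hpr.ne', ENNReal.rpow_one]
    _ = ∫⁻ t, (∫⁻ x, ‖f (x - t)‖ₑ ^ p.toReal) ∂(bumpMeasure φ) := by
        refine lintegral_lintegral_swap ?_
        have h1 : AEStronglyMeasurable (fun z : E n × E n => f (z.1 - z.2))
            (volume.prod (bumpMeasure φ)) :=
          hf.comp_quasiMeasurePreserving (quasiMeasurePreserving_sub volume (bumpMeasure φ))
        exact h1.enorm.pow_const _
    _ = ∫⁻ _, (∫⁻ x, ‖f x‖ₑ ^ p.toReal) ∂(bumpMeasure φ) := by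
        refine lintegral_congr fun t => ?_
        exact lintegral_sub_right_eq_self (fun x => ‖f x‖ₑ ^ p.toReal) t
    _ = ∫⁻ x, ‖f x‖ₑ ^ p.toReal := by simp

theorem dist_mollify_le {f : E n → ℝ} (hf : AEStronglyMeasurable f volume) {x : E n} {ε : ℝ}
    (h : ∀ z ∈ Metric.ball x φ.rOut, dist (f z) (f x) ≤ ε) : dist (mollify φ f x) (f x) ≤ ε :=
  φ.dist_normed_convolution_le hf h

theorem support_mollify_subset (f : E n → ℝ) :
    Function.support (mollify φ f) ⊆ Metric.cthickening φ.rOut (Function.support f) := by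
  intro x hx
  by_contra hcon
  apply hx
  rw [mollify_apply]
  refine integral_eq_zero_of_ae (Eventually.of_forall fun t => ?_)
  by_contra hne
  have h1 : t ∈ Function.support (φ.normed volume) := left_ne_zero_of_mul hne
  rw [φ.support_normed_eq, mem_ball_zero_iff] at h1
  have h2 : x - t ∈ Function.support f := right_ne_zero_of_mul hne
  refine hcon (Metric.mem_cthickening_of_dist_le x (x - t) _ _ h2 ?_)
  simpa using h1.le

/-- Once the radii are at most 1, all differences are supported in one compact set, on which uniform
continuity of `g` makes them uniformly small. -/
theorem tendsto_eLpNorm_mollify_sub_of_continuous {g : E n → ℝ} (hg : Continuous g)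
    (hc : HasCompactSupport g) (p : ℝ≥0∞) {ψ : ℕ → ContDiffBump (0 : E n)}
    (hψ : Tendsto (fun k => (ψ k).rOut) atTop (𝓝 0)) :
    Tendsto (fun k => eLpNorm (mollify (ψ k) g - g) p volume) atTop (𝓝 0) := by
  set K := Metric.cthickening 1 (tsupport g) with hK
  have hKc : IsCompact K := hc.isCompact.cthickening
  have hKt : volume K ^ p.toReal⁻¹ ≠ ⊤ :=
    ENNReal.rpow_ne_top_of_nonneg (by positivity) hKc.measure_lt_top.ne
  have huc := hc.uniformContinuous_of_continuous hg
  rw [ENNReal.tendsto_nhds_zero]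
  intro ε hε
  obtain ⟨c, hc0, hcε⟩ : ∃ c : ℝ, 0 < c ∧ volume K ^ p.toReal⁻¹ * ENNReal.ofReal c ≤ ε := by
    have h1 : Tendsto (fun c : ℝ => volume K ^ p.toReal⁻¹ * ENNReal.ofReal c) (𝓝[>] 0) (𝓝 0) := by
      have h2 : Tendsto (fun c : ℝ => ENNReal.ofReal c) (𝓝[>] 0) (𝓝 0) := by
        have := (ENNReal.continuous_ofReal.tendsto 0).mono_left (nhdsWithin_le_nhds (s := Ioi 0))
        simpa using this
      simpa using ENNReal.Tendsto.const_mul h2 (Or.inr hKt)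
    have h3 := (h1.eventually (ge_mem_nhds hε)).and self_mem_nhdsWithin
    obtain ⟨c, h4, h5⟩ := h3.exists
    exact ⟨c, h5, h4⟩
  obtain ⟨δ, hδ, hgδ⟩ := Metric.uniformContinuous_iff.1 huc c hc0
  have h1 : ∀ᶠ k in atTop, (ψ k).rOut < min δ 1 :=
    hψ.eventually (gt_mem_nhds (lt_min hδ one_pos))
  filter_upwards [h1] with k hk
  have hsupp : Function.support (mollify (ψ k) g - g) ⊆ K := by
    refine (Function.support_sub _ _).trans (union_subset ?_ ?_)
    · refine (support_mollify_subset (ψ k) g).trans ((Metric.cthickening_mono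
        (hk.le.trans (min_le_right _ _)) _).trans (Metric.cthickening_subset_of_subset _ subset_closure))
    · exact subset_closure.trans (Metric.self_subset_cthickening _)
  rw [← eLpNorm_restrict_eq_of_support_subset hsupp]
  refine (eLpNorm_le_of_ae_bound (C := c) (Eventually.of_forall fun x => ?_)).trans ?_
  · rw [Pi.sub_apply, ← dist_eq_norm]
    refine dist_mollify_le (ψ k) hg.aestronglyMeasurable fun z hz => (hgδ ?_).le
    exact (Metric.mem_ball.1 hz).trans (hk.trans_le (min_le_left _ _))
  · rwa [Measure.restrict_apply_univ]

/-- Mollifications converge in `L^p`. -/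
theorem tendsto_eLpNorm_mollify_sub {f : E n → ℝ} {p : ℝ≥0∞} (hp : 1 ≤ p) (hp' : p ≠ ⊤)
    (hf : MemLp f p volume) {ψ : ℕ → ContDiffBump (0 : E n)}
    (hψ : Tendsto (fun k => (ψ k).rOut) atTop (𝓝 0)) :
    Tendsto (fun k => eLpNorm (mollify (ψ k) f - f) p volume) atTop (𝓝 0) := by
  rw [ENNReal.tendsto_nhds_zero]
  intro ε hε
  have hε3 : ε / 3 ≠ 0 := by simpa using hε.ne'
  obtain ⟨g, hgc, hfg, hg, hgp⟩ := hf.exists_hasCompactSupport_eLpNorm_sub_le hp' hε3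
  filter_upwards [(ENNReal.tendsto_nhds_zero.1
    (tendsto_eLpNorm_mollify_sub_of_continuous hg hgc p hψ)) (ε / 3) (pos_iff_ne_zero.2 hε3)]
    with k hk
  have hfl := hf.locallyIntegrable hp
  have hgl := hgp.locallyIntegrable hp
  -- An ε/3 argument with `g` continuous of compact support and L^p-close to `f`; the first term is
  -- small because mollification is an L^p contraction.
  have h1 : mollify (ψ k) f - f = mollify (ψ k) (f - g) + ((mollify (ψ k) g - g) - (f - g)) := by
    rw [mollify_sub _ hfl hgl]
    abel
  have hm : ∀ {h : E n → ℝ}, LocallyIntegrable h → AEStronglyMeasurable (mollify (ψ k) h) volume :=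
    fun hh => (contDiff_mollify _ hh).continuous.aestronglyMeasurable
  have hfgm : AEStronglyMeasurable (f - g) volume := hf.1.sub hgp.1
  rw [h1]
  calc _ ≤ eLpNorm (mollify (ψ k) (f - g)) p volume +
        eLpNorm ((mollify (ψ k) g - g) - (f - g)) p volume :=
        eLpNorm_add_le (hm (hfl.sub hgl)) (((hm hgl).sub hgp.1).sub hfgm) hp
    _ ≤ ε / 3 + (ε / 3 + ε / 3) := by
        gcongr
        · exact (eLpNorm_mollify_le _ hfgm hp hp').trans hfg
        · exact (eLpNorm_sub_le ((hm hgl).sub hgp.1) hfgm hp).trans (add_le_add hk hfg)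
    _ = ε := by rw [← add_assoc, ENNReal.add_thirds]

/-- The derivative of a mollification is the mollification of the weak derivative. -/
theorem fderiv_mollify_of_hasWeakDeriv {U K : Set (E n)} {u : E n → ℝ} {A : E n → E n →L[ℝ] ℝ}
    (h : HasWeakDeriv U u A) (hK : IsCompact K) (hKU : K ⊆ U) {y : E n}
    (hy : Metric.closedBall y φ.rOut ⊆ K) (v : E n) :
    fderiv ℝ (mollify φ (K.indicator u)) y v = mollify φ (K.indicator fun z => A z v) y := by
  have hu : LocallyIntegrable (K.indicator u) :=
    ((integrable_indicator_iff hK.measurableSet).2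
      (h.1.integrableOn_compact_subset hKU hK)).locallyIntegrable
  have h1 := (φ.hasCompactSupport_normed (μ := volume)).hasFDerivAt_convolution_left (μ := volume)
    (ContinuousLinearMap.lsmul ℝ ℝ) (φ.contDiff_normed (n := 1)) hu y
  have h2 : fderiv ℝ (mollify φ (K.indicator u)) y = _ := h1.fderiv
  rw [h2, convolution_eq_swap]
  set L := ContinuousLinearMap.precompL (E n) (ContinuousLinearMap.lsmul ℝ ℝ : ℝ →L[ℝ] ℝ →L[ℝ] ℝ)
    with hL
  have hint : Integrable fun t => L (fderiv ℝ (φ.normed volume) (y - t)) (K.indicator u t) :=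
    ((φ.hasCompactSupport_normed.fderiv ℝ).convolutionExists_left L
      ((φ.contDiff_normed (μ := volume) (n := 1)).continuous_fderiv one_ne_zero) hu y).integrable_swap
  rw [ContinuousLinearMap.integral_apply hint]
  -- The derivative of the mollification falls on the kernel. As a function of the integration
  -- variable the kernel is an admissible test function, and the sign from `y - z` cancels the sign
  -- in the definition of the weak derivative.
  set ψ : E n → ℝ := fun z => φ.normed volume (y - z) with hψ
  have hψd : ContDiff ℝ ∞ ψ := φ.contDiff_normed.comp (contDiff_const.sub contDiff_id)
  have hψc : HasCompactSupport ψ :=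
    (φ.hasCompactSupport_normed (μ := volume)).comp_homeomorph (Homeomorph.subLeft y)
  have hψt : tsupport ψ ⊆ K := by
    refine subset_trans ?_ hy
    refine closure_minimal (fun z hz => ?_) Metric.isClosed_closedBall
    have h3 : y - z ∈ Function.support (φ.normed volume) := hz
    rw [φ.support_normed_eq, mem_ball_zero_iff, ← dist_eq_norm] at h3
    rw [Metric.mem_closedBall, dist_comm]
    exact h3.le
  have hψf : ∀ z, fderiv ℝ ψ z v = -fderiv ℝ (φ.normed volume) (y - z) v := by
    intro z
    have h4 : HasFDerivAt (fun z => y - z) (-ContinuousLinearMap.id ℝ (E n)) z := by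
      simpa using (hasFDerivAt_id z).const_sub y
    have h5 := (((φ.contDiff_normed (n := 1) (μ := volume)).differentiable one_ne_zero
      (y - z)).hasFDerivAt.comp z h4).fderiv
    have h6 : fderiv ℝ ψ z v = _ := DFunLike.congr_fun h5 v
    rw [h6]
    simp
  have h7 := h.2.2 ψ hψd hψc (hψt.trans hKU) v
  rw [mollify_apply_swap]
  have h8 : ∀ z, L (fderiv ℝ (φ.normed volume) (y - z)) (K.indicator u z) v =
      -(u z * fderiv ℝ ψ z v) := by
    intro z
    rw [hψf]
    by_cases hz : z ∈ K
    · simp [hL, hz, mul_comm]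
    · have : fderiv ℝ ψ z v = 0 := by
        have := image_eq_zero_of_notMem_tsupport (f := fun z => fderiv ℝ ψ z v) (x := z)
          (fun hh => hz (hψt (tsupport_fderiv_apply_subset ℝ v hh)))
        exact this
      rw [hψf] at this
      simp [hL, hz, this]
  simp only [h8, integral_neg, h7, neg_neg]
  refine integral_congr_ae (Eventually.of_forall fun z => ?_)
  by_cases hz : z ∈ K
  · simp [hψ, hz, mul_comm]
  · have h9 : ψ z = 0 := image_eq_zero_of_notMem_tsupport fun hh => hz (hψt hh)
    simp [hz, h9]

end Mollify

/-! ### Monotonicity, growth and integrability of the flux. -/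

section Flux

variable {n : ℕ} {B : Form n}

theorem IsInner.flux_monotone (hB : IsInner B) {p : ℝ} (hp : 1 < p) (a b : E n →L[ℝ] ℝ) :
    0 ≤ (a - b) (flux B p a - flux B p b) := by
  have h := mul_nonneg hB.density_pos.le (hB.monotone_flux hp (raise B a) (raise B b))
  rw [← hB.apply_raise_self, ← hB.apply_raise_self] at h
  rw [← hB.apply_raise (a - b), raise_sub, hB.symm, flux, flux]
  refine h.trans_eq ?_
  rw [← smul_eq_mul, ← smul_apply, ← map_smul, smul_sub, smul_smul, smul_smul]

/-- Growth of order `p - 1`, with a constant continuous in `B`: this puts the flux of an L^p field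
in the conjugate space. -/
theorem IsInner.norm_flux_le (hB : IsInner B) {p : ℝ} (hp : 1 < p) (a : E n →L[ℝ] ℝ) :
    ‖flux B p a‖ ≤ density B * ‖B.inverse‖ * √‖B‖ * √‖B.inverse‖ ^ (p - 1) * ‖a‖ ^ (p - 1) := by
  set X := raise B a with hX
  set s := √(a X) with hs
  have hs0 : 0 ≤ s := Real.sqrt_nonneg _
  have haX : 0 ≤ a X := by rw [hB.apply_raise_self]; exact hB.nonneg _
  have h1 : ‖X‖ ≤ ‖B.inverse‖ * ‖a‖ := B.inverse.le_opNorm a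
  have h2 : s ≤ √‖B.inverse‖ * ‖a‖ := by
    rw [hs, Real.sqrt_le_left (by positivity), mul_pow,
      Real.sq_sqrt (norm_nonneg (ContinuousLinearMap.inverse B))]
    calc a X ≤ ‖a‖ * ‖X‖ := (le_abs_self _).trans (a.le_opNorm X)
      _ ≤ ‖a‖ * (‖B.inverse‖ * ‖a‖) := by gcongr
      _ = _ := by ring
  have h3 : ‖a‖ ≤ √‖B‖ * s := by
    refine a.opNorm_le_bound (by positivity) fun v => ?_
    have h4 : B v v ≤ ‖B‖ * ‖v‖ ^ 2 := by
      refine (le_abs_self _).trans ((B.le_opNorm₂ v v).trans_eq (by ring))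
    have h5 : √(B v v) ≤ √‖B‖ * ‖v‖ := by
      rw [Real.sqrt_le_left (by positivity), mul_pow, Real.sq_sqrt (norm_nonneg B)]
      exact h4
    have h6 : ∀ v, a v ≤ s * √(B v v) := fun v => by
      rw [hs, hB.apply_raise_self, ← hB.apply_raise]
      exact hB.cauchy_schwarz _ _
    rw [Real.norm_eq_abs, abs_le']
    have h7 : s * √(B v v) ≤ √‖B‖ * s * ‖v‖ := by nlinarith
    refine ⟨(h6 v).trans h7, ?_⟩
    have h8 := h6 (-v)
    simp only [map_neg, neg_apply, neg_neg] at h8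
    exact h8.trans h7
  have hd := hB.density_pos.le
  rw [flux, norm_smul, Real.norm_of_nonneg (by positivity)]
  -- The exponent `p - 2` may be negative, so `‖X‖` is first bounded by a multiple of `s`; only then
  -- is `s ^ (p - 1)` compared with a power of `‖a‖`.
  calc density B * s ^ (p - 2) * ‖X‖
      ≤ density B * s ^ (p - 2) * (‖B.inverse‖ * (√‖B‖ * s)) := by
        gcongr
        exact h1.trans (by gcongr)
    _ = density B * ‖B.inverse‖ * √‖B‖ * (s ^ (p - 2) * s) := by ring
    _ ≤ density B * ‖B.inverse‖ * √‖B‖ * (√‖B.inverse‖ * ‖a‖) ^ (p - 1) := by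
        gcongr
        refine le_trans ?_ (Real.rpow_le_rpow hs0 h2 (by linarith))
        rcases hs0.eq_or_lt with h | h
        · rw [← h, mul_zero]
          positivity
        · rw [← Real.rpow_add_one h.ne']
          apply le_of_eq
          congr 1
          ring
    _ = _ := by rw [Real.mul_rpow (by positivity) (by positivity)]; ring

variable {U K : Set (E n)} {G : E n → Form n}

theorem continuousOn_inverse (hG : ContinuousOn G U) (hI : ∀ y ∈ U, IsInner (G y)) :
    ContinuousOn (fun y => (G y).inverse) U := fun y hy =>
  ContinuousAt.comp_continuousWithinAt (β := Form n)
    ((hI y hy).contDiffAt_inverse (k := 0)).continuousAt (hG y hy)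

theorem continuousOn_density (hG : ContinuousOn G U) (hI : ∀ y ∈ U, IsInner (G y)) :
    ContinuousOn (fun y => density (G y)) U := fun y hy =>
  ContinuousAt.comp_continuousWithinAt (β := Form n)
    ((hI y hy).contDiffAt_density (k := 0)).continuousAt (hG y hy)

/-- The flux of an `L^p` field of covectors is in `L^(p/(p-1))`. -/
theorem memLp_flux {p : ℝ} (hp : 1 < p) (hK : IsCompact K) (hG : ContinuousOn G K)
    (hI : ∀ y ∈ K, IsInner (G y)) {A : E n → E n →L[ℝ] ℝ}
    (hA : MemLp A (ENNReal.ofReal p) (volume.restrict K)) :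
    MemLp (fun y => flux (G y) p (A y)) (ENNReal.ofReal (p / (p - 1))) (volume.restrict K) := by
  have hp1 : 0 < p - 1 := by linarith
  have hinv := continuousOn_inverse hG hI
  have hden := continuousOn_density hG hI
  have hGn : ContinuousOn (fun y => ‖G y‖) K :=
    (continuous_norm (E := Form n)).comp_continuousOn hG
  have hin : ContinuousOn (fun y => ‖(G y).inverse‖) K := by
    refine (continuous_norm (E := (E n →L[ℝ] ℝ) →L[ℝ] E n)).comp_continuousOn ?_
    exact hinv
  obtain ⟨C, hC⟩ := hK.exists_bound_of_continuousOn (f := fun y =>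
    density (G y) * ‖(G y).inverse‖ * √‖G y‖ * √‖(G y).inverse‖ ^ (p - 1))
    (((hden.mul hin).mul hGn.sqrt).mul
      (hin.sqrt.rpow_const fun _ _ => Or.inr hp1.le))
  have hX : AEStronglyMeasurable (fun y => raise (G y) (A y)) (volume.restrict K) :=
    (isBoundedBilinearMap_apply (𝕜 := ℝ) (E := E n →L[ℝ] ℝ)
      (F := E n)).continuous.comp_aestronglyMeasurable
      ((hinv.aestronglyMeasurable hK.measurableSet).prodMk hA.1)
  have haX : AEStronglyMeasurable (fun y => A y (raise (G y) (A y))) (volume.restrict K) :=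
    (isBoundedBilinearMap_apply (𝕜 := ℝ) (E := E n) (F := ℝ)).continuous.comp_aestronglyMeasurable
      (hA.1.prodMk hX)
  have hmeas : AEStronglyMeasurable (fun y => flux (G y) p (A y)) (volume.restrict K) :=
    ((hden.aestronglyMeasurable hK.measurableSet).mul
      ((haX.aemeasurable.sqrt.pow_const (p - 2)).aestronglyMeasurable)).smul hX
  -- `‖A‖ ^ (p - 1)` lies in L^(p/(p-1)) because `A` lies in L^p.
  have hN := hA.norm_rpow_div (ENNReal.ofReal (p - 1))
  rw [← ENNReal.ofReal_div_of_pos hp1, ENNReal.toReal_ofReal hp1.le] at hN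
  refine hN.of_le_mul (c := C) hmeas ?_
  refine (ae_restrict_iff' hK.measurableSet).2 (Eventually.of_forall fun y hy => ?_)
  refine ((hI y hy).norm_flux_le hp (A y)).trans ?_
  rw [Real.norm_of_nonneg (by positivity)]
  gcongr
  exact (le_abs_self _).trans (hC y hy)

end Flux

/-! ### Weak derivatives of differences. -/

section WeakDeriv

variable {n : ℕ} {U : Set (E n)} {F h : E n → ℝ} {A : E n → E n →L[ℝ] ℝ}

theorem integrable_mul_of_locallyIntegrableOn {f ψ : E n → ℝ} (hf : LocallyIntegrableOn f U)
    (hψ : Continuous ψ) (hc : HasCompactSupport ψ) (hs : tsupport ψ ⊆ U) :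
    Integrable fun y => f y * ψ y := by
  have h1 : IntegrableOn (fun y => f y * ψ y) (tsupport ψ) :=
    (hf.integrableOn_compact_subset hs hc).mul_continuousOn hψ.continuousOn hc
  refine (integrableOn_iff_integrable_of_support_subset ?_).1 h1
  exact (Function.support_mul_subset_right _ _).trans subset_closure

theorem HasWeakDeriv.of_contDiffOn (hU : IsOpen U) (hF : ContDiffOn ℝ 1 F U) :
    HasWeakDeriv U F (fderiv ℝ F) := by
  have hF' : ContinuousOn (fderiv ℝ F) U := hF.continuousOn_fderiv_of_isOpen hU le_rfl
  refine ⟨hF.continuousOn.locallyIntegrableOn hU.measurableSet,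
    hF'.locallyIntegrableOn hU.measurableSet, fun ψ hψ hc hs v => ?_⟩
  have h1 := hψ.of_le (m := 1) (by exact_mod_cast le_top)
  refine integral_mul_fderiv_eq_neg_fderiv_mul_of_integrable ?_ ?_ ?_ ?_ ?_
  · exact integrable_mul_of_tsupport_subset hU (hF'.clm_apply continuousOn_const) hψ.continuous hc hs
  · exact integrable_mul_of_tsupport_subset hU hF.continuousOn
      ((h1.continuous_fderiv one_ne_zero).clm_apply continuous_const) (hc.fderiv_apply ℝ v)
      ((tsupport_fderiv_apply_subset ℝ v).trans hs)
  · exact integrable_mul_of_tsupport_subset hU hF.continuousOn hψ.continuous hc hs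
  · exact fun y hy => (hF.contDiffAt (hU.mem_nhds (hs hy))).differentiableAt one_ne_zero
  · exact fun y _ => h1.differentiable one_ne_zero y

theorem locallyIntegrableOn_clm_apply (hA : LocallyIntegrableOn A U) (v : E n) :
    LocallyIntegrableOn (fun y => A y v) U := fun y hy => by
  obtain ⟨s, hs, hi⟩ := hA y hy
  exact ⟨s, hs, (ContinuousLinearMap.apply ℝ ℝ v).integrable_comp hi⟩

theorem HasWeakDeriv.sub {D : E n → E n →L[ℝ] ℝ} (hF : HasWeakDeriv U F D)
    (hh : HasWeakDeriv U h A) : HasWeakDeriv U (fun y => F y - h y) (fun y => D y - A y) := by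
  refine ⟨hF.1.sub hh.1, hF.2.1.sub hh.2.1, fun ψ hψ hc hs v => ?_⟩
  have h1 := hψ.of_le (m := 1) (by exact_mod_cast le_top)
  have h2 : Continuous fun y => fderiv ℝ ψ y v :=
    (h1.continuous_fderiv one_ne_zero).clm_apply continuous_const
  have h3 : tsupport (fun y => fderiv ℝ ψ y v) ⊆ U := (tsupport_fderiv_apply_subset ℝ v).trans hs
  simp only [sub_mul, sub_apply]
  rw [integral_sub (integrable_mul_of_locallyIntegrableOn hF.1 h2 (hc.fderiv_apply ℝ v) h3)
      (integrable_mul_of_locallyIntegrableOn hh.1 h2 (hc.fderiv_apply ℝ v) h3),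
    integral_sub (integrable_mul_of_locallyIntegrableOn (locallyIntegrableOn_clm_apply hF.2.1 v) hψ.continuous hc hs)
      (integrable_mul_of_locallyIntegrableOn (locallyIntegrableOn_clm_apply hh.2.1 v) hψ.continuous hc hs),
    hF.2.2 ψ hψ hc hs v, hh.2.2 ψ hψ hc hs v]
  ring

end WeakDeriv

/-! ### Local comparison of a strict subsolution with a weak solution. -/

/-- Passage to the limit in an integral of a product of a function in `L^q`, a bounded pointwise
convergent sequence, and a sequence that converges in `L^p`. -/
theorem tendsto_integral_mul_mul {X : Type*} [MeasurableSpace X] {μ : Measure X} {p q : ℝ≥0∞}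
    [q.HolderConjugate p] {T D : X → ℝ} {b : ℕ → X → ℝ} {d : ℕ → X → ℝ} {b' : X → ℝ} {C : ℝ}
    (hT : MemLp T q μ) (hD : MemLp D p μ) (hd : ∀ k, MemLp (d k) p μ)
    (hlim : Tendsto (fun k => eLpNorm (d k - D) p μ) atTop (𝓝 0))
    (hb : ∀ k, AEStronglyMeasurable (b k) μ) (hbC : ∀ k x, ‖b k x‖ ≤ C)
    (hbb : ∀ x, Tendsto (fun k => b k x) atTop (𝓝 (b' x))) :
    Tendsto (fun k => ∫ x, T x * (b k x * d k x) ∂μ) atTop (𝓝 (∫ x, T x * (b' x * D x) ∂μ)) := by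
  have hTD : Integrable (fun x => T x * D x) μ := hT.integrable_mul hD
  have hTd : ∀ k, Integrable (fun x => T x * (d k - D) x) μ := fun k =>
    hT.integrable_mul ((hd k).sub hD)
  have hi1 : ∀ k, Integrable (fun x => b k x * (T x * (d k - D) x)) μ := fun k =>
    (hTd k).bdd_mul (hb k) (Eventually.of_forall (hbC k))
  have hi2 : ∀ k, Integrable (fun x => b k x * (T x * D x)) μ := fun k =>
    hTD.bdd_mul (hb k) (Eventually.of_forall (hbC k))
  -- Split `d k = D + (d k - D)`: dominated convergence treats the first part, Hölder and the bound
  -- `C` the second.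
  have h1 : Tendsto (fun k => ∫ x, b k x * (T x * D x) ∂μ) atTop
      (𝓝 (∫ x, b' x * (T x * D x) ∂μ)) := by
    refine tendsto_integral_of_dominated_convergence (fun x => C * ‖T x * D x‖)
      (fun k => (hi2 k).1) (hTD.norm.const_mul C) (fun k => Eventually.of_forall fun x => ?_)
      (Eventually.of_forall fun x => (hbb x).mul_const _)
    rw [norm_mul]
    exact mul_le_mul_of_nonneg_right (hbC k x) (norm_nonneg _)
  have h2 : Tendsto (fun k => ∫ x, b k x * (T x * (d k - D) x) ∂μ) atTop (𝓝 0) := by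
    rw [tendsto_zero_iff_enorm_tendsto_zero]
    have h3 : Tendsto (fun k => ENNReal.ofReal C * (eLpNorm T q μ * eLpNorm (d k - D) p μ)) atTop
        (𝓝 0) := by
      have h4 := ENNReal.Tendsto.const_mul hlim (Or.inr hT.eLpNorm_lt_top.ne)
      rw [mul_zero] at h4
      simpa using ENNReal.Tendsto.const_mul h4 (Or.inr ENNReal.ofReal_ne_top)
    refine tendsto_of_tendsto_of_tendsto_of_le_of_le tendsto_const_nhds h3 (fun _ => zero_le) fun k => ?_
    refine (enorm_integral_le_lintegral_enorm _).trans ?_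
    calc ∫⁻ x, ‖b k x * (T x * (d k - D) x)‖ₑ ∂μ
        ≤ ∫⁻ x, ENNReal.ofReal C * ‖T x * (d k - D) x‖ₑ ∂μ := by
          refine lintegral_mono fun x => ?_
          rw [enorm_mul]
          gcongr
          rw [← ofReal_norm]
          exact ENNReal.ofReal_le_ofReal (hbC k x)
      _ = ENNReal.ofReal C * ∫⁻ x, ‖T x * (d k - D) x‖ₑ ∂μ :=
          lintegral_const_mul' _ _ ENNReal.ofReal_ne_top
      _ ≤ _ := by
          gcongr
          have h5 := eLpNorm_smul_le_mul_eLpNorm (r := 1) (p := q) (q := p) ((hd k).sub hD).1 hT.1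
          rwa [eLpNorm_one_eq_lintegral_enorm] at h5
  have h6 := h1.add h2
  rw [add_zero] at h6
  refine (h6.congr fun k => ?_).trans_eq ?_
  · rw [← integral_add (hi2 k) (hi1 k)]
    refine integral_congr_ae (Eventually.of_forall fun x => ?_)
    simp only [Pi.sub_apply]
    ring
  · congr 1
    refine integral_congr_ae (Eventually.of_forall fun x => ?_)
    ring

theorem integrable_clm_apply {n : ℕ} {K : Set (E n)} {L : E n → E n →L[ℝ] ℝ} {X : E n → E n}
    (hK : IsCompact K) (hL : Continuous L) (hs : tsupport L ⊆ K) (hX : IntegrableOn X K) :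
    Integrable fun y => L y (X y) := by
  have hc : HasCompactSupport L := hK.of_isClosed_subset (isClosed_tsupport L) hs
  obtain ⟨C, hC⟩ := hc.exists_bound_of_continuous hL
  have h1 : IntegrableOn (fun y => L y (X y)) K := by
    refine (hX.norm.const_mul C).mono' ?_ (Eventually.of_forall fun y => ?_)
    · exact (isBoundedBilinearMap_apply (𝕜 := ℝ) (E := E n)
        (F := ℝ)).continuous.comp_aestronglyMeasurable (hL.aestronglyMeasurable.prodMk hX.1)
    · exact (L y).le_of_opNorm_le (hC y) _
  refine (integrableOn_iff_integrable_of_support_subset ?_).1 h1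
  intro y hy
  refine hs (subset_closure ?_)
  intro h
  exact hy (by simp [h])

theorem exists_lt_forall_le_of_isCompact {X : Type*} [TopologicalSpace X] {S : Set X}
    (hS : IsCompact S) {u : X → ℝ} (hu : ContinuousOn u S) {m : ℝ} (hm : ∀ y ∈ S, u y < m) :
    ∃ c < m, ∀ y ∈ S, u y ≤ c := by
  rcases S.eq_empty_or_nonempty with rfl | hne
  · exact ⟨m - 1, by linarith, by simp⟩
  · obtain ⟨y, hy, hmax⟩ := hS.exists_isMaxOn hne hu
    exact ⟨u y, hm y hy, fun z hz => hmax hz⟩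

theorem tendsto_mollify {n : ℕ} {f : E n → ℝ} (hf : AEStronglyMeasurable f volume) {y : E n}
    (hc : ContinuousAt f y) {φ : ℕ → ContDiffBump (0 : E n)}
    (hφ : Tendsto (fun k => (φ k).rOut) atTop (𝓝 0)) :
    Tendsto (fun k => mollify (φ k) f y) atTop (𝓝 (f y)) := by
  rw [Metric.tendsto_nhds]
  intro ε hε
  obtain ⟨δ, hδ, h⟩ := Metric.continuousAt_iff.1 hc (ε / 2) (half_pos hε)
  filter_upwards [hφ.eventually (gt_mem_nhds hδ)] with k hk
  refine lt_of_le_of_lt (dist_mollify_le (φ k) hf fun z hz => (h ?_).le) (half_lt_self hε)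
  exact (Metric.mem_ball.1 hz).trans hk

/-- A strict `C^2` subsolution minus a weak solution has no strict local maximum. -/
theorem not_eventually_sub_lt_of_divergence_pos {n : ℕ} {U : Set (E n)} (hU : IsOpen U)
    {G : E n → Form n} (hG : ContDiffOn ℝ 1 G U) (hI : ∀ y ∈ U, IsInner (G y)) {p : ℝ} (hp : 1 < p)
    {F h : E n → ℝ} {A : E n → E n →L[ℝ] ℝ} {y₀ : E n} (hy₀ : y₀ ∈ U) (hF : ContDiffOn ℝ 2 F U)
    (h0 : fderiv ℝ F y₀ ≠ 0)
    (hdiv : 0 < divergence (fun z => flux (G z) p (fderiv ℝ F z)) y₀)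
    (hh : ContinuousOn h U) (hA : HasWeakDeriv U h A)
    (hAp : ∀ K, IsCompact K → K ⊆ U → MemLp A (ENNReal.ofReal p) (volume.restrict K))
    (hsol : ∀ ζ : E n → ℝ, ContDiff ℝ ∞ ζ → HasCompactSupport ζ → tsupport ζ ⊆ U →
      ∫ y, fderiv ℝ ζ y (flux (G y) p (A y)) = 0) :
    ¬ ∀ᶠ y in 𝓝[≠] y₀, F y - h y < F y₀ - h y₀ := by
  intro hmax
  set V : E n → E n := fun z => flux (G z) p (fderiv ℝ F z) with hV
  have hdF : ContinuousOn (fderiv ℝ F) U := hF.continuousOn_fderiv_of_isOpen hU (by norm_num)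
  -- The flux of `F` is C¹ where `dF` does not vanish, so its classical divergence is used only on
  -- `W`.
  set W : Set (E n) := U ∩ (fderiv ℝ F) ⁻¹' {0}ᶜ with hW
  have hWo : IsOpen W := hdF.isOpen_inter_preimage hU isOpen_compl_singleton
  have hVW : ContDiffOn ℝ 1 V W := fun y hy =>
    (contDiffAt_flux p (hG.contDiffAt (hU.mem_nhds hy.1)) (hI y hy.1)
      ((hF.contDiffAt (hU.mem_nhds hy.1)).fderiv_right (by norm_num)) hy.2).contDiffWithinAt
  have hdivW := continuousOn_divergence hWo hVW
  have hy₀W : y₀ ∈ W := ⟨hy₀, h0⟩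
  have hnear : ∀ᶠ y in 𝓝 y₀, y ∈ W ∧ 0 < divergence V y ∧ (y ≠ y₀ → F y - h y < F y₀ - h y₀) :=
    Eventually.and (hWo.mem_nhds hy₀W) (((hdivW.continuousAt (hWo.mem_nhds hy₀W)).eventually
      (lt_mem_nhds hdiv)).and (eventually_nhdsWithin_iff.1 hmax))
  obtain ⟨r, hr, hball⟩ := Metric.nhds_basis_closedBall.mem_iff.1 hnear
  set K := Metric.closedBall y₀ r with hK
  have hKc : IsCompact K := isCompact_closedBall y₀ r
  have hKW : K ⊆ W := fun y hy => (hball hy).1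
  have hKU : K ⊆ U := fun y hy => (hKW hy).1
  -- the difference and its superlevel sets
  set u : E n → ℝ := fun y => F y - h y with hu
  have huU : ContinuousOn u U := hF.continuousOn.sub hh
  have huK : ContinuousOn u K := huU.mono hKU
  -- The strict maximum leaves a gap: on the closed annulus between radii `r / 2` and `r` the
  -- difference is at most some `c < u y₀`.
  obtain ⟨c, hcm, hcS⟩ := exists_lt_forall_le_of_isCompact
    (hKc.diff (Metric.isOpen_ball (x := y₀) (ε := r / 2))) (huK.mono sdiff_subset) (m := u y₀)
    (fun y hy => (hball hy.1).2.2 fun hyy => hy.2 (by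
      rw [hyy]; exact Metric.mem_ball_self (by positivity)))
  -- Half the gap is the truncation level and half is the mollification error: `c + ε₀ = c₁`, so any
  -- function within `ε₀` of `u` stays at or below `c₁` on the annulus.
  set c₁ := (c + u y₀) / 2 with hc₁
  set ε₀ := (u y₀ - c) / 2 with hε₀
  have hε₀pos : 0 < ε₀ := by rw [hε₀]; linarith
  -- A smooth nondecreasing substitute for the positive part of `t - c₁`.
  set ψ : ℝ → ℝ := fun t => expNegInvGlue (t - c₁) with hψ
  have hψd : ContDiff ℝ ∞ ψ := expNegInvGlue.contDiff.comp (contDiff_id.sub contDiff_const)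
  have hψm : Monotone ψ := fun s t hst => expNegInvGlue.monotone (by linarith)
  have hψ0 : ∀ t ≤ c₁, ψ t = 0 := fun t ht => expNegInvGlue.zero_of_nonpos (by linarith)
  have hψnn : ∀ t, 0 ≤ ψ t := fun t => expNegInvGlue.nonneg _
  have hψpos : 0 < ψ (u y₀) := expNegInvGlue.pos_of_pos (by rw [hc₁]; linarith)
  have hψ1 : Continuous (deriv ψ) := hψd.continuous_deriv (by exact_mod_cast le_top)
  -- mollification
  obtain ⟨δ, hδ, huδ⟩ := Metric.uniformContinuousOn_iff.1
    (hKc.uniformContinuousOn_of_continuous huK) ε₀ hε₀pos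
  -- `δ` keeps the mollification within `ε₀` of `u`; `r / 4` keeps balls of radius `ρ` centred in
  -- `B` inside `K`.
  set ρ := min δ (r / 4) with hρ
  have hρ0 : 0 < ρ := lt_min hδ (by positivity)
  let φ : ℕ → ContDiffBump (0 : E n) := fun k =>
    ⟨ρ / (2 * ((k : ℝ) + 1)), ρ / ((k : ℝ) + 1), by positivity, by
      apply div_lt_div_of_pos_left hρ0 (by positivity)
      have : (0 : ℝ) ≤ k := Nat.cast_nonneg k
      linarith⟩
  have hφρ : ∀ k, (φ k).rOut ≤ ρ := fun k => by
    refine div_le_self hρ0.le ?_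
    have : (0 : ℝ) ≤ k := Nat.cast_nonneg k
    linarith
  have hφ0 : Tendsto (fun k => (φ k).rOut) atTop (𝓝 0) :=
    (tendsto_const_div_atTop_nhds_zero_nat ρ).comp (tendsto_add_atTop_nat 1) |>.congr fun k => by
      simp [φ]
  set B := Metric.closedBall y₀ (3 * r / 4) with hB
  have hBK : ∀ k, ∀ y ∈ B, Metric.closedBall y (φ k).rOut ⊆ K := by
    intro k y hy
    refine Metric.closedBall_subset_closedBall' ?_
    have h1 := Metric.mem_closedBall.1 hy
    have h2 := (hφρ k).trans (min_le_right _ _)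
    linarith
  have hBsub : B ⊆ K := Metric.closedBall_subset_closedBall (by linarith)
  set v : ℕ → E n → ℝ := fun k => mollify (φ k) (K.indicator u) with hv
  have huint : IntegrableOn u K := huK.integrableOn_compact hKc
  have huloc : LocallyIntegrable (K.indicator u) :=
    ((integrable_indicator_iff hKc.measurableSet).2 huint).locallyIntegrable
  have humeas : AEStronglyMeasurable (K.indicator u) volume := huloc.aestronglyMeasurable
  have hvd : ∀ k, ContDiff ℝ ∞ (v k) := fun k => contDiff_mollify _ huloc
  have hvu : ∀ k, ∀ y ∈ B, |v k y - u y| ≤ ε₀ := by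
    intro k y hy
    have h1 : dist (v k y) (K.indicator u y) ≤ ε₀ := by
      refine dist_mollify_le (φ k) humeas fun z hz => ?_
      have hzK := hBK k y hy (Metric.ball_subset_closedBall hz)
      rw [indicator_of_mem hzK, indicator_of_mem (hBsub hy)]
      exact (huδ z hzK y (hBsub hy) ((Metric.mem_ball.1 hz).trans_le
        ((hφρ k).trans (min_le_left _ _)))).le
    rwa [indicator_of_mem (hBsub hy), Real.dist_eq] at h1
  have hvlim : ∀ y ∈ B, Tendsto (fun k => v k y) atTop (𝓝 (u y)) := by
    intro y hy
    have hKy : K ∈ 𝓝 y := by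
      refine mem_of_superset (Metric.ball_mem_nhds y (by positivity : 0 < r / 4)) ?_
      refine Metric.ball_subset_closedBall.trans (Metric.closedBall_subset_closedBall' ?_)
      have h1 := Metric.mem_closedBall.1 hy
      linarith
    have h1 := tendsto_mollify humeas (y := y) ((huK.continuousAt hKy).congr
      (mem_of_superset hKy fun z hz => (indicator_of_mem hz u).symm)) hφ0
    rwa [indicator_of_mem (hBsub hy)] at h1
  -- cutoff and test functions
  let η : ContDiffBump y₀ := ⟨r / 2, 3 * r / 4, by positivity, by linarith⟩
  have hηt : tsupport η = B := η.tsupport_eq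
  have hηB : ∀ y ∉ B, η y = 0 := fun y hy => image_eq_zero_of_notMem_tsupport (by rwa [hηt])
  have hηd : ContDiff ℝ ∞ η := η.contDiff
  set ζ : ℕ → E n → ℝ := fun k y => η y * ψ (v k y) with hζ
  have hζd : ∀ k, ContDiff ℝ ∞ (ζ k) := fun k => hηd.mul (hψd.comp (hvd k))
  have hζc : ∀ k, HasCompactSupport (ζ k) := fun k => η.hasCompactSupport.mul_right
  have hζs : ∀ k, tsupport (ζ k) ⊆ K := fun k =>
    ((tsupport_mul_subset_left).trans hηt.le).trans hBsub
  have hψv : ∀ k, ∀ y ∈ B, y ∉ Metric.ball y₀ (r / 2) → ψ (v k y) = 0 := by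
    intro k y hy hy2
    refine hψ0 _ ?_
    have h1 := (abs_le.1 (hvu k y hy)).2
    have h2 := hcS y ⟨hBsub hy, hy2⟩
    rw [hc₁]
    linarith
  -- The cutoff contributes nothing: `η` is constant on the inner ball, and on the rest of `B` the
  -- factor `ψ (v k y)` vanishes.
  have hζf : ∀ k y, fderiv ℝ (ζ k) y = (η y * deriv ψ (v k y)) • fderiv ℝ (v k) y := by
    intro k y
    have h1 : HasFDerivAt (fun y => ψ (v k y)) (deriv ψ (v k y) • fderiv ℝ (v k) y) y :=
      ((hψd.differentiable (by simp)) _).hasDerivAt.comp_hasFDerivAt y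
        ((hvd k).differentiable (by simp) y).hasFDerivAt
    have h2 : HasFDerivAt (ζ k) _ y := (hηd.differentiable (by simp) y).hasFDerivAt.mul h1
    rw [h2.fderiv, smul_smul]
    have h3 : ψ (v k y) • fderiv ℝ η y = 0 := by
      by_cases hyB : y ∈ B
      · by_cases hyb : y ∈ Metric.ball y₀ (r / 2)
        · have h4 : η =ᶠ[𝓝 y] fun _ => 1 := by
            filter_upwards [Metric.isOpen_ball.mem_nhds hyb] with z hz
            exact η.one_of_mem_closedBall (Metric.ball_subset_closedBall hz)
          rw [h4.fderiv_eq]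
          simp
        · rw [hψv k y hyB hyb, zero_smul]
      · have h4 : fderiv ℝ η y = 0 := image_eq_zero_of_notMem_tsupport fun hh =>
          hyB (hηt ▸ tsupport_fderiv_subset ℝ hh)
        rw [h4, smul_zero]
    rw [h3, add_zero]
  -- weak derivative of the difference
  set D : E n → E n →L[ℝ] ℝ := fun y => fderiv ℝ F y - A y with hD
  have hF1 : ContDiffOn ℝ 1 F U := hF.of_le (by norm_num)
  have huD : HasWeakDeriv U u D := (HasWeakDeriv.of_contDiffOn hU hF1).sub hA
  set e : Fin n → E n := fun i => EuclideanSpace.single i 1 with he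
  set Di : Fin n → E n → ℝ := fun i => K.indicator fun z => D z (e i) with hDi
  have hvD : ∀ k, ∀ y ∈ B, ∀ i, fderiv ℝ (v k) y (e i) = mollify (φ k) (Di i) y :=
    fun k y hy i => fderiv_mollify_of_hasWeakDeriv (φ k) huD hKc hKU (hBK k y hy) (e i)
  -- integrability
  have hp1 : 0 < p - 1 := by linarith
  have hGK : ContinuousOn G K := hG.continuousOn.mono hKU
  have hIK : ∀ y ∈ K, IsInner (G y) := fun y hy => hI y (hKU hy)
  have hAK := hAp K hKc hKU
  have hfin : IsFiniteMeasure (volume.restrict K) :=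
    ⟨by rw [Measure.restrict_apply_univ]; exact hKc.measure_lt_top⟩
  have hdFK : MemLp (fderiv ℝ F) (ENNReal.ofReal p) (volume.restrict K) := by
    obtain ⟨C, hC⟩ := hKc.exists_bound_of_continuousOn (hdF.mono hKU)
    exact MemLp.of_bound ((hdF.mono hKU).aestronglyMeasurable hKc.measurableSet) C
      ((ae_restrict_iff' hKc.measurableSet).2 (Eventually.of_forall hC))
  have hconj : (p / (p - 1)).HolderConjugate p := (Real.HolderConjugate.conjExponent hp).symm
  have hconj' : (ENNReal.ofReal (p / (p - 1))).HolderConjugate (ENNReal.ofReal p) :=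
    hconj.ennrealOfReal
  have hq1 : 1 ≤ ENNReal.ofReal (p / (p - 1)) := by
    rw [ENNReal.one_le_ofReal]
    exact hconj.lt.le
  have hpp1 : 1 ≤ ENNReal.ofReal p := by
    rw [ENNReal.one_le_ofReal]
    exact hp.le
  have hVq := memLp_flux hp hKc hGK hIK hdFK
  have hAq := memLp_flux hp hKc hGK hIK hAK
  set T : E n → E n := fun y => V y - flux (G y) p (A y) with hT
  have hTq : MemLp T (ENNReal.ofReal (p / (p - 1))) (volume.restrict K) := hVq.sub hAq
  set Ti : Fin n → E n → ℝ := fun i => K.indicator fun z => T z i with hTi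
  have hTiq : ∀ i, MemLp (Ti i) (ENNReal.ofReal (p / (p - 1))) volume := fun i =>
    (memLp_indicator_iff_restrict hKc.measurableSet).2
      ((EuclideanSpace.proj (𝕜 := ℝ) i).comp_memLp' hTq)
  have hDiq : ∀ i, MemLp (Di i) (ENNReal.ofReal p) volume := fun i =>
    (memLp_indicator_iff_restrict hKc.measurableSet).2
      ((ContinuousLinearMap.apply ℝ ℝ (e i)).comp_memLp' (hdFK.sub hAK))
  have hmq : ∀ k i, MemLp (mollify (φ k) (Di i)) (ENNReal.ofReal p) volume := fun k i =>
    ⟨(contDiff_mollify _ ((hDiq i).locallyIntegrable hpp1)).continuous.aestronglyMeasurable,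
      (eLpNorm_mollify_le _ (hDiq i).1 hpp1 ENNReal.ofReal_ne_top).trans_lt (hDiq i).eLpNorm_lt_top⟩
  -- the bounded factor
  set b : ℕ → E n → ℝ := fun k y => η y * deriv ψ (v k y) with hb
  set b' : E n → ℝ := fun y => η y * deriv ψ (u y) with hb'
  obtain ⟨R, hR⟩ := hKc.exists_bound_of_continuousOn huK
  have hvR : ∀ k, ∀ y ∈ B, v k y ∈ Icc (-(R + ε₀)) (R + ε₀) := by
    intro k y hy
    have h1 := abs_le.1 (hvu k y hy)
    have h2 := abs_le.1 (hR y (hBsub hy))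
    exact ⟨by linarith, by linarith⟩
  obtain ⟨C, hC⟩ := isCompact_Icc.exists_bound_of_continuousOn
    (hψ1.continuousOn (s := Icc (-(R + ε₀)) (R + ε₀)))
  obtain ⟨C', hC'⟩ := isCompact_Icc.exists_bound_of_continuousOn
    (hψd.continuous.continuousOn (s := Icc (-(R + ε₀)) (R + ε₀)))
  have hη1 : ∀ y, ‖η y‖ ≤ 1 := fun y => by
    rw [Real.norm_of_nonneg η.nonneg]
    exact η.le_one
  have hbC : ∀ k y, ‖b k y‖ ≤ |C| := by
    intro k y
    by_cases hy : y ∈ B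
    · rw [hb, norm_mul]
      calc ‖η y‖ * ‖deriv ψ (v k y)‖ ≤ 1 * C :=
            mul_le_mul (hη1 y) (hC _ (hvR k y hy)) (norm_nonneg _) zero_le_one
        _ ≤ |C| := by rw [one_mul]; exact le_abs_self C
    · simp [hb, hηB y hy]
  have hbb : ∀ y, Tendsto (fun k => b k y) atTop (𝓝 (b' y)) := by
    intro y
    by_cases hy : y ∈ B
    · exact ((hψ1.tendsto (u y)).comp (hvlim y hy)).const_mul (η y)
    · simp [hb, hb', hηB y hy]
  have hbm : ∀ k, AEStronglyMeasurable (b k) volume := fun k =>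
    (hηd.continuous.mul (hψ1.comp (hvd k).continuous)).aestronglyMeasurable
  have hb'm : AEStronglyMeasurable b' volume :=
    aestronglyMeasurable_of_tendsto_ae atTop hbm (Eventually.of_forall hbb)
  have hb'C : ∀ y, ‖b' y‖ ≤ |C| := fun y =>
    le_of_tendsto (hbb y).norm (Eventually.of_forall fun k => hbC k y)
  have hb'0 : ∀ y, 0 ≤ b' y := fun y => mul_nonneg η.nonneg hψm.deriv_nonneg
  -- limit of the left-hand side
  have hlim : ∀ i, Tendsto (fun k => ∫ y, Ti i y * (b k y * mollify (φ k) (Di i) y)) atTop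
      (𝓝 (∫ y, Ti i y * (b' y * Di i y))) := fun i =>
    tendsto_integral_mul_mul (hTiq i) (hDiq i) (fun k => hmq k i)
      (tendsto_eLpNorm_mollify_sub hpp1 ENNReal.ofReal_ne_top (hDiq i) hφ0) hbm hbC hbb
  have hexp : ∀ (L : E n →L[ℝ] ℝ) (w : E n), L w = ∑ i, w i * L (e i) := by
    intro L w
    conv_lhs => rw [← (EuclideanSpace.basisFun (Fin n) ℝ).sum_repr w]
    simp [he]
  have hleft : ∀ k, ∫ y, fderiv ℝ (ζ k) y (T y) =
      ∑ i, ∫ y, Ti i y * (b k y * mollify (φ k) (Di i) y) := by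
    intro k
    rw [← integral_finsetSum]
    · refine integral_congr_ae (Eventually.of_forall fun y => ?_)
      show fderiv ℝ (ζ k) y (T y) = ∑ i, Ti i y * (b k y * mollify (φ k) (Di i) y)
      rw [hζf, hexp]
      refine Finset.sum_congr rfl fun i _ => ?_
      by_cases hy : y ∈ B
      · have h1 : Ti i y = T y i := indicator_of_mem (hBsub hy) _
        rw [smul_apply, hvD k y hy i, smul_eq_mul, h1]
      · simp [hb, hηB y hy]
    · intro i _
      have h1 : Integrable (fun y => Ti i y * mollify (φ k) (Di i) y) :=
        (hTiq i).integrable_mul (hmq k i)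
      refine (h1.bdd_mul (hbm k) (Eventually.of_forall (hbC k))).congr
        (Eventually.of_forall fun y => ?_)
      show b k y * (Ti i y * mollify (φ k) (Di i) y) = Ti i y * (b k y * mollify (φ k) (Di i) y)
      ring
  have hlim2 : Tendsto (fun k => ∫ y, fderiv ℝ (ζ k) y (T y)) atTop
      (𝓝 (∑ i, ∫ y, Ti i y * (b' y * Di i y))) := by
    simp only [hleft]
    exact tendsto_finsetSum _ fun i _ => hlim i
  -- The integrand is `η ψ'(u)` times `dF - A` applied to the difference of the fluxes of `dF` and
  -- `A`, nonnegative by monotonicity of the flux.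
  have hnonneg : 0 ≤ ∑ i, ∫ y, Ti i y * (b' y * Di i y) := by
    rw [← integral_finsetSum]
    · refine integral_nonneg fun y => ?_
      show 0 ≤ ∑ i, Ti i y * (b' y * Di i y)
      by_cases hy : y ∈ K
      · have h1 : ∑ i, Ti i y * (b' y * Di i y) = b' y * D y (T y) := by
          rw [hexp, Finset.mul_sum]
          refine Finset.sum_congr rfl fun i _ => ?_
          have h1 : Ti i y = T y i := indicator_of_mem hy _
          have h2 : Di i y = D y (e i) := indicator_of_mem hy _
          rw [h1, h2]
          ring
        rw [h1]
        exact mul_nonneg (hb'0 y) ((hIK y hy).flux_monotone hp _ _)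
      · simp [hTi, hy]
    · intro i _
      have h1 : Integrable (fun y => Ti i y * Di i y) := (hTiq i).integrable_mul (hDiq i)
      refine (h1.bdd_mul hb'm (Eventually.of_forall hb'C)).congr (Eventually.of_forall fun y => ?_)
      show b' y * (Ti i y * Di i y) = Ti i y * (b' y * Di i y)
      ring
  -- the right-hand side
  have hright : ∀ k, ∫ y, fderiv ℝ (ζ k) y (T y) = -∫ y, divergence V y * ζ k y := by
    intro k
    have hζ1 : ContDiff ℝ 1 (ζ k) := (hζd k).of_le (by exact_mod_cast le_top)
    have h1 : Continuous (fderiv ℝ (ζ k)) := hζ1.continuous_fderiv one_ne_zero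
    have h2 : tsupport (fderiv ℝ (ζ k)) ⊆ K := (tsupport_fderiv_subset ℝ).trans (hζs k)
    rw [← integral_fderiv_apply hWo hVW hζ1 (hζc k) ((hζs k).trans hKW)]
    have h3 : ∀ y, fderiv ℝ (ζ k) y (T y) =
        fderiv ℝ (ζ k) y (V y) - fderiv ℝ (ζ k) y (flux (G y) p (A y)) := fun y => map_sub _ _ _
    simp only [h3]
    rw [integral_sub (integrable_clm_apply hKc h1 h2 (hVq.integrable hq1))
      (integrable_clm_apply hKc h1 h2 (hAq.integrable hq1)),
      hsol (ζ k) (hζd k) (hζc k) ((hζs k).trans hKU), sub_zero]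
  have hlim3 : Tendsto (fun k => ∫ y, divergence V y * ζ k y) atTop
      (𝓝 (∫ y, divergence V y * (η y * ψ (u y)))) := by
    have hdK : IntegrableOn (divergence V) K := (hdivW.mono hKW).integrableOn_compact hKc
    refine tendsto_integral_of_dominated_convergence
      (fun y => |C'| * K.indicator (fun z => ‖divergence V z‖) y) (fun k => ?_)
      (((integrable_indicator_iff hKc.measurableSet).2 hdK.norm).const_mul _)
      (fun k => Eventually.of_forall fun y => ?_) (Eventually.of_forall fun y => ?_)
    · exact (integrable_mul_of_tsupport_subset hWo hdivW (hζd k).continuous (hζc k)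
        ((hζs k).trans hKW)).1
    · by_cases hy : y ∈ B
      · rw [indicator_of_mem (hBsub hy), norm_mul, mul_comm]
        refine mul_le_mul_of_nonneg_right ?_ (norm_nonneg _)
        rw [hζ, norm_mul]
        calc ‖η y‖ * ‖ψ (v k y)‖ ≤ 1 * C' :=
              mul_le_mul (hη1 y) (hC' _ (hvR k y hy)) (norm_nonneg _) zero_le_one
          _ ≤ |C'| := by rw [one_mul]; exact le_abs_self C'
      · have h1 : ζ k y = 0 := by simp [hζ, hηB y hy]
        rw [h1, mul_zero, norm_zero]
        exact mul_nonneg (abs_nonneg _) (indicator_nonneg (fun _ _ => norm_nonneg _) _)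
    · by_cases hy : y ∈ B
      · exact (((hψd.continuous.tendsto (u y)).comp (hvlim y hy)).const_mul (η y)).const_mul _
      · simp [hζ, hηB y hy]
  -- The divergence is positive on all of `K`, and the test function is positive at `y₀`.
  have hpos : 0 < ∫ y, divergence V y * (η y * ψ (u y)) := by
    have h1 : Continuous fun y => (divergence V y * ψ (u y)) * η y :=
      continuous_mul_of_tsupport_subset hWo
        (hdivW.mul (hψd.continuous.comp_continuousOn (huU.mono fun y hy => hy.1))) hηd.continuous
        (hηt.le.trans (hBsub.trans hKW))
    have h2 : ∀ y, divergence V y * (η y * ψ (u y)) = (divergence V y * ψ (u y)) * η y :=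
      fun y => by ring
    simp only [h2]
    refine h1.integral_pos_of_hasCompactSupport_nonneg_nonzero η.hasCompactSupport.mul_left
      (fun y => ?_) (x := y₀) ?_
    · by_cases hy : y ∈ B
      · exact mul_nonneg (mul_nonneg (hball (hBsub hy)).2.1.le (hψnn _)) η.nonneg
      · simp [hηB y hy]
    · have h3 : η y₀ = 1 := η.one_of_mem_closedBall (Metric.mem_closedBall_self η.rIn_pos.le)
      rw [h3, mul_one]
      exact (mul_pos hdiv hψpos).ne'
  -- One sequence would have both a nonnegative and a negative limit.
  have huniq := tendsto_nhds_unique hlim2 (by simpa only [hright] using hlim3.neg)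
  linarith

/-! ### The metric and covectors in a chart. -/

section Chart

variable {n : ℕ} {M : Type*} [TopologicalSpace M] [ChartedSpace (E n) M]

theorem contMDiffOn_chart_symm_apply (x : M) {k : WithTop ℕ∞} {f : M → ℝ} [IsManifold (𝓡 n) k M]
    (hf : ContMDiffOn (𝓡 n) 𝓘(ℝ, ℝ) k f (chartAt (E n) x).source) :
    ContDiffOn ℝ k (fun y => f ((chartAt (E n) x).symm y)) (chartAt (E n) x).target := by
  rw [← contMDiffOn_iff_contDiffOn]
  exact hf.comp (contMDiffOn_chart_symm (I := 𝓡 n)) (chartAt (E n) x).symm.mapsTo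

variable [IsManifold (𝓡 n) ∞ M]

/-- The frame of a chart, as an endomorphism of the model space. -/
def frameL (x : M) (y : E n) : E n →L[ℝ] E n := frame x y

/-- The metric at a point, as a form on the model space. -/
def formAt (g : Metric n M) (z : M) : Form n := g.inner z

/-- The metric in the chart `chartAt x`, as a field of forms on the model space. -/
def chartGram (g : Metric n M) (x : M) (y : E n) : Form n :=
  ContinuousLinearMap.bilinearComp (formAt g ((chartAt (E n) x).symm y)) (frameL x y) (frameL x y)

theorem chartGram_apply (g : Metric n M) (x : M) (y v w : E n) :
    chartGram g x y v w = chartMetric g x y v w := rfl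

theorem isInner_formAt (g : Metric n M) (z : M) : IsInner (formAt g z) :=
  ⟨g.symm z, g.pos z⟩

theorem mdifferentiable_chartAt (x : M) :
    (chartAt (E n) x).MDifferentiable (𝓡 n) 𝓘(ℝ, E n) :=
  mdifferentiable_chart (I := 𝓡 n) x

theorem mdifferentiableAt_chartAt_symm (x : M) {y : E n} (hy : y ∈ (chartAt (E n) x).target) :
    MDifferentiableAt 𝓘(ℝ, E n) (𝓡 n) (chartAt (E n) x).symm y :=
  (mdifferentiable_chartAt x).mdifferentiableAt_symm hy

theorem frameL_bijective (x : M) {y : E n} (hy : y ∈ (chartAt (E n) x).target) :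
    Function.Bijective (frameL x y) :=
  (mdifferentiable_chartAt x).symm.mfderiv_bijective hy

theorem isInner_chartGram (g : Metric n M) (x : M) {y : E n} (hy : y ∈ (chartAt (E n) x).target) :
    IsInner (chartGram g x y) where
  symm v w := (isInner_formAt g ((chartAt (E n) x).symm y)).symm (frameL x y v) (frameL x y w)
  pos v hv := (isInner_formAt g ((chartAt (E n) x).symm y)).pos (frameL x y v) fun h =>
    hv ((frameL_bijective x hy).1 (h.trans (map_zero (frameL x y)).symm))

theorem chartForm_dif (f : M → ℝ) (x : M) {y : E n} (hy : y ∈ (chartAt (E n) x).target)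
    (hf : MDifferentiableAt (𝓡 n) 𝓘(ℝ, ℝ) f ((chartAt (E n) x).symm y)) :
    chartForm (dif f) x y = fderiv ℝ (fun y => f ((chartAt (E n) x).symm y)) y := by
  have h1 := mfderiv_comp y hf (mdifferentiableAt_chartAt_symm x hy)
  rw [mfderiv_eq_fderiv] at h1
  exact h1.symm

/-- Covectors in the chart: the induced inner product is computed with `chartGram`. -/
theorem coInner_eq_chart (g : Metric n M) (x : M) {y : E n} (hy : y ∈ (chartAt (E n) x).target)
    (α β : (z : M) → TangentSpace (𝓡 n) z →L[ℝ] ℝ) :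
    coInner g (α ((chartAt (E n) x).symm y)) (β ((chartAt (E n) x).symm y)) =
      chartForm β x y (raise (chartGram g x y) (chartForm α x y)) := by
  set z := (chartAt (E n) x).symm y
  set X := raise (chartGram g x y) (chartForm α x y) with hX
  have h1 : ∀ v, formAt g z (frameL x y X) (frameL x y v) = α z (frameL x y v) := fun v =>
    (isInner_chartGram g x hy).apply_raise (chartForm α x y) v
  have h2 : raise (formAt g z) (α z) = frameL x y X := by
    refine ((isInner_formAt g z).raise_eq_iff _ _).2 fun w => ?_
    obtain ⟨v, rfl⟩ := (frameL_bijective x hy).2 w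
    exact h1 v
  exact congrArg (fun w : E n => (β z : E n →L[ℝ] ℝ) w) h2

/-- The sections `e.symmL ℝ m v` are constant in the trivialization `e`, hence smooth over its base
set, which is the chart domain; a smooth metric pairs them smoothly. -/
theorem contMDiffOn_metric_frame (g : Metric n M) (x : M) (v w : E n) :
    ContMDiffOn (𝓡 n) 𝓘(ℝ, ℝ) ∞ (fun m : M => g.inner m
      ((trivializationAt (E n) (TangentSpace (𝓡 n)) x).symmL ℝ m v)
      ((trivializationAt (E n) (TangentSpace (𝓡 n)) x).symmL ℝ m w)) (chartAt (E n) x).source := by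
  set e := trivializationAt (E n) (TangentSpace (𝓡 n) : M → Type _) x with he
  have hs : ∀ v : E n, ContMDiffOn (𝓡 n) ((𝓡 n).prod 𝓘(ℝ, E n)) ∞
      (fun m : M => Bundle.TotalSpace.mk' (E n) (E := fun m : M => TangentSpace (𝓡 n) m) m
        (e.symmL ℝ m v)) e.baseSet := by
    intro v
    rw [e.contMDiffOn_section_baseSet_iff]
    refine (contMDiffOn_const (c := v)).congr fun m hm => ?_
    rw [e.symmL_apply hm, e.apply_mk_symm hm]
  have hb : e.baseSet = (chartAt (E n) x).source := TangentBundle.trivializationAt_baseSet x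
  rw [hb] at hs
  intro m hm
  have h1 : ContMDiffWithinAt (𝓡 n) ((𝓡 n).prod 𝓘(ℝ)) ∞
      (fun m : M => Bundle.TotalSpace.mk' ℝ (E := Bundle.Trivial M ℝ) m
        (g.inner m (e.symmL ℝ m v) (e.symmL ℝ m w))) (chartAt (E n) x).source m := by
    apply ContMDiffWithinAt.clm_bundle_apply₂ (F₁ := E n) (F₂ := E n)
    · exact g.contMDiff.contMDiffAt.contMDiffWithinAt
    · exact hs v m hm
    · exact hs w m hm
  simp only [Bundle.contMDiffWithinAt_totalSpace] at h1
  exact h1.2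

theorem contDiffOn_chartMetric (g : Metric n M) (x : M) (v w : E n) :
    ContDiffOn ℝ ∞ (fun y => chartMetric g x y v w) (chartAt (E n) x).target := by
  refine (contMDiffOn_chart_symm_apply x (contMDiffOn_metric_frame g x v w)).congr fun y hy => ?_
  -- The local frame of the trivialization at `x` is the coordinate frame of the chart.
  have h1 : ∀ v : E n, (trivializationAt (E n) (TangentSpace (𝓡 n)) x).symmL ℝ
      ((chartAt (E n) x).symm y) v = frame x y v := by
    intro v
    rw [TangentBundle.symmL_trivializationAt ((chartAt (E n) x).map_target hy)]
    simp only [mfld_simps, mfderivWithin_univ]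
    rw [(chartAt (E n) x).right_inv hy]
    rfl
  rw [h1, h1]
  rfl

theorem contDiffOn_chartGram (g : Metric n M) (x : M) :
    ContDiffOn ℝ ∞ (chartGram g x) (chartAt (E n) x).target := by
  rw [contDiffOn_clm_apply]
  intro v
  rw [contDiffOn_clm_apply]
  intro w
  exact contDiffOn_chartMetric g x v w

end Chart

/-! ### The Riemannian measure in a chart. -/

section Volume

variable {n : ℕ} {M : Type*} [TopologicalSpace M] [ChartedSpace (E n) M]

theorem density_nonneg (B : Form n) : 0 ≤ density B := Real.sqrt_nonneg _

/-- The transition map between two charts. -/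
def transition (n : ℕ) {M : Type*} [TopologicalSpace M] [ChartedSpace (E n) M] (x x' : M) :
    OpenPartialHomeomorph (E n) (E n) :=
  (chartAt (E n) x).symm.trans (chartAt (E n) x')

theorem mem_transition_source {x x' : M} {y : E n} :
    y ∈ (transition n x x').source ↔
      y ∈ (chartAt (E n) x).target ∧ (chartAt (E n) x).symm y ∈ (chartAt (E n) x').source := by
  simp [transition]

theorem symm_transition {x x' : M} {y : E n} (hy : y ∈ (transition n x x').source) :
    (chartAt (E n) x').symm (transition n x x' y) = (chartAt (E n) x).symm y :=
  (chartAt (E n) x').left_inv (mem_transition_source.1 hy).2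

section Measurability

variable [MeasurableSpace M] [BorelSpace M]

theorem measurableSet_target_inter_preimage (x : M) {A : Set M} (hA : MeasurableSet A) :
    MeasurableSet ((chartAt (E n) x).target ∩ (chartAt (E n) x).symm ⁻¹' A) := by
  have h : Measurable ((chartAt (E n) x).target.domRestrict (chartAt (E n) x).symm) :=
    (continuousOn_iff_continuous_domRestrict.1 (chartAt (E n) x).continuousOn_symm).measurable
  have h1 := (chartAt (E n) x).open_target.measurableSet.subtype_image (h hA)
  convert h1 using 1
  ext y
  simp [Set.domRestrict, and_comm]

theorem aemeasurable_chartAt_symm (x : M) (ρ : E n → ℝ≥0∞) :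
    AEMeasurable (chartAt (E n) x).symm
      ((volume.restrict (chartAt (E n) x).target).withDensity ρ) :=
  ((chartAt (E n) x).continuousOn_symm.aemeasurable
    (chartAt (E n) x).open_target.measurableSet).mono_ac (withDensity_absolutelyContinuous _ _)

theorem measurableEmbedding_chart_symm (x : M) :
    MeasurableEmbedding ((chartAt (E n) x).target.domRestrict (chartAt (E n) x).symm) :=
  (chartAt (E n) x).symm.isOpenEmbedding_restrict.measurableEmbedding

end Measurability

variable [IsManifold (𝓡 n) ∞ M]

theorem mdifferentiableAt_transition {x x' : M} {y : E n} (hy : y ∈ (transition n x x').source) :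
    DifferentiableAt ℝ (transition n x x') y := by
  rw [← mdifferentiableAt_iff_differentiableAt]
  have h := mem_transition_source.1 hy
  exact ((mdifferentiable_chartAt x').mdifferentiableAt h.2).comp y
    (mdifferentiableAt_chartAt_symm x h.1)

theorem frameL_transition {x x' : M} {y : E n} (hy : y ∈ (transition n x x').source) :
    frameL x y = (frameL x' (transition n x x' y)).comp (fderiv ℝ (transition n x x') y) := by
  have h := mem_transition_source.1 hy
  have ht : transition n x x' y ∈ (chartAt (E n) x').target :=
    (chartAt (E n) x').map_source h.2
  have h1 := mfderiv_comp y (mdifferentiableAt_chartAt_symm x' ht)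
    (mdifferentiableAt_iff_differentiableAt.2 (mdifferentiableAt_transition hy))
  rw [mfderiv_eq_fderiv] at h1
  have h2 : (chartAt (E n) x').symm ∘ (transition n x x') =ᶠ[𝓝 y] (chartAt (E n) x).symm := by
    filter_upwards [(transition n x x').open_source.mem_nhds hy] with z hz
    exact symm_transition hz
  have h3 : frameL x y = mfderiv 𝓘(ℝ, E n) (𝓡 n)
      ((chartAt (E n) x').symm ∘ (transition n x x')) y := h2.symm.mfderiv_eq
  exact h3.trans h1

/-- The Gram determinant of the pulled-back form picks up the factor `L.det ^ 2`; its square root is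
the Jacobian. -/
theorem density_bilinearComp {B : Form n} (L : E n →L[ℝ] E n) :
    density (B.bilinearComp L L) = |L.det| * density B := by
  have h := det_gram_family B fun i => L (EuclideanSpace.single i 1)
  have h1 : ((EuclideanSpace.basisFun (Fin n) ℝ).toBasis.toMatrix
      fun i => L (EuclideanSpace.single i 1)).det = L.det := by
    rw [ContinuousLinearMap.det, ← LinearMap.det_toMatrix (EuclideanSpace.basisFun (Fin n) ℝ).toBasis]
    congr 1
  rw [h1] at h
  rw [← Real.sqrt_sq_eq_abs, density, density, ← Real.sqrt_mul (sq_nonneg _)]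
  exact congrArg Real.sqrt h

theorem density_transition (g : Metric n M) {x x' : M} {y : E n}
    (hy : y ∈ (transition n x x').source) :
    density (chartGram g x y) =
      |(fderiv ℝ (transition n x x') y).det| * density (chartGram g x' (transition n x x' y)) := by
  rw [← density_bilinearComp]
  congr 1
  rw [chartGram, chartGram, symm_transition hy, frameL_transition hy]
  rfl

theorem continuousOn_density_chartGram (g : Metric n M) (x : M) :
    ContinuousOn (fun y => density (chartGram g x y)) (chartAt (E n) x).target :=
  continuousOn_density (contDiffOn_chartGram g x).continuousOn fun _ hy => isInner_chartGram g x hy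

theorem aemeasurable_density (g : Metric n M) (x : M) :
    AEMeasurable (fun y => ENNReal.ofReal (density (chartGram g x y)))
      (volume.restrict (chartAt (E n) x).target) :=
  ((continuousOn_density_chartGram g x).aemeasurable
    (chartAt (E n) x).open_target.measurableSet).ennreal_ofReal

section Measure

variable [MeasurableSpace M] [BorelSpace M]

theorem chartVolume_apply (g : Metric n M) (x : M) {A : Set M} (hA : MeasurableSet A) :
    chartVolume g x A = ∫⁻ y in (chartAt (E n) x).target ∩ (chartAt (E n) x).symm ⁻¹' A,
      ENNReal.ofReal (density (chartGram g x y)) := by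
  have hm := measurableSet_target_inter_preimage (n := n) x hA
  have h0 : MeasurableSet (chartAt (E n) x).target := (chartAt (E n) x).open_target.measurableSet
  rw [chartVolume, Measure.map_apply_of_aemeasurable (aemeasurable_chartAt_symm x _) hA,
    withDensity_apply', Measure.restrict_restrict' h0, inter_comm]
  rfl

/-- Change of variables along the transition map, whose Jacobian is exactly the factor between the
two densities. -/
theorem chartVolume_eq_of_subset (g : Metric n M) (x x' : M) {A : Set M} (hA : MeasurableSet A)
    (hx : A ⊆ (chartAt (E n) x).source) (hx' : A ⊆ (chartAt (E n) x').source) :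
    chartVolume g x A = chartVolume g x' A := by
  rw [chartVolume_apply g x hA, chartVolume_apply g x' hA]
  set D := (chartAt (E n) x).target ∩ (chartAt (E n) x).symm ⁻¹' A
  have hD : D ⊆ (transition n x x').source := fun y hy =>
    mem_transition_source.2 ⟨hy.1, hx' hy.2⟩
  have himg : (chartAt (E n) x').target ∩ (chartAt (E n) x').symm ⁻¹' A =
      transition n x x' '' D := by
    ext y
    constructor
    · rintro ⟨hy, hyA⟩
      refine ⟨chartAt (E n) x ((chartAt (E n) x').symm y),
        ⟨(chartAt (E n) x).map_source (hx hyA), ?_⟩, ?_⟩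
      · rw [mem_preimage, (chartAt (E n) x).left_inv (hx hyA)]
        exact hyA
      · change chartAt (E n) x' ((chartAt (E n) x).symm _) = y
        rw [(chartAt (E n) x).left_inv (hx hyA), (chartAt (E n) x').right_inv hy]
    · rintro ⟨z, hz, rfl⟩
      refine ⟨(chartAt (E n) x').map_source (hx' hz.2), ?_⟩
      rw [mem_preimage, symm_transition (hD hz)]
      exact hz.2
  rw [himg, lintegral_image_eq_lintegral_abs_det_fderiv_mul volume
    (measurableSet_target_inter_preimage x hA)
    (fun y hy => (mdifferentiableAt_transition (hD hy)).hasFDerivAt.hasFDerivWithinAt)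
    ((transition n x x').injOn.mono hD)]
  refine setLIntegral_congr_fun (measurableSet_target_inter_preimage x hA) fun y hy => ?_
  rw [density_transition g (hD hy), ENNReal.ofReal_mul (abs_nonneg _)]

theorem chartVolume_compl_source (g : Metric n M) (x : M) :
    chartVolume g x (chartAt (E n) x).sourceᶜ = 0 := by
  rw [chartVolume_apply g x (chartAt (E n) x).open_source.measurableSet.compl]
  have : (chartAt (E n) x).target ∩ (chartAt (E n) x).symm ⁻¹' (chartAt (E n) x).sourceᶜ = ∅ := by
    ext y
    simp only [mem_inter_iff, mem_preimage, mem_compl_iff, mem_empty_iff_false, iff_false, not_and,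
      not_not]
    exact fun hy => (chartAt (E n) x).map_target hy
  rw [this]
  simp

theorem chartVolume_inter_source (g : Metric n M) (x : M) (A : Set M) :
    chartVolume g x (A ∩ (chartAt (E n) x).source) = chartVolume g x A := by
  apply measure_inter_conull'
  exact measure_mono_null (fun y hy => hy.2) (chartVolume_compl_source g x)

/-- A supremum of measures is awkward to evaluate on a set, so it is bounded by one measure: each
chart measure is at most `chartVolume g x` plus `vol g` restricted off the chart domain of `x`,
because chart measures agree on overlaps. -/
theorem vol_restrict_source (g : Metric n M) (x : M) :
    (vol g).restrict (chartAt (E n) x).source = chartVolume g x := by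
  have hS : ∀ x : M, MeasurableSet (chartAt (E n) x).source := fun x =>
    (chartAt (E n) x).open_source.measurableSet
  have hle : ∀ x', chartVolume g x' ≤ vol g := fun x' => le_iSup (chartVolume g) x'
  have h1 : vol g ≤ chartVolume g x + (vol g).restrict (chartAt (E n) x).sourceᶜ := by
    refine iSup_le fun x' => Measure.le_iff.2 fun A hA => ?_
    rw [← measure_inter_add_sdiff A (hS x), sdiff_eq, Measure.add_apply, Measure.restrict_apply hA]
    refine add_le_add ?_ ?_
    · rw [← chartVolume_inter_source g x', ← chartVolume_eq_of_subset g x x'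
        ((hA.inter (hS x)).inter (hS x')) (fun y hy => hy.1.2) fun y hy => hy.2]
      exact measure_mono fun y hy => hy.1.1
    · exact hle x' _
  ext A hA
  rw [Measure.restrict_apply hA]
  refine le_antisymm ?_ ?_
  · refine (h1 _).trans ?_
    rw [Measure.add_apply, Measure.restrict_apply (hA.inter (hS x)), inter_assoc, inter_compl_self,
      inter_empty, measure_empty, add_zero]
    exact measure_mono inter_subset_left
  · rw [← chartVolume_inter_source g x]
    exact hle x _

/-- The volume of a chart domain, carried from the subtype of the coordinates. -/
theorem chartVolume_eq_map (g : Metric n M) (x : M) :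
    chartVolume g x = (Measure.comap (Subtype.val : (chartAt (E n) x).target → E n)
      ((volume.restrict (chartAt (E n) x).target).withDensity
        (fun y => ENNReal.ofReal (density (chartGram g x y))))).map
      ((chartAt (E n) x).target.domRestrict (chartAt (E n) x).symm) := by
  set μ := (volume.restrict (chartAt (E n) x).target).withDensity
        (fun y => ENNReal.ofReal (density (chartGram g x y))) with hμ
  have h0 : MeasurableSet (chartAt (E n) x).target := (chartAt (E n) x).open_target.measurableSet
  have h1 : Measure.map Subtype.val (Measure.comap (Subtype.val : (chartAt (E n) x).target → E n) μ)
      = μ := by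
    rw [map_comap_subtype_coe h0, hμ, restrict_withDensity h0, Measure.restrict_restrict h0,
      inter_self]
  have h2 : AEMeasurable (chartAt (E n) x).symm μ := aemeasurable_chartAt_symm x _
  have h3 : chartVolume g x = Measure.map (chartAt (E n) x).symm μ := rfl
  rw [h3]
  conv_lhs => rw [← h1]
  rw [← h1] at h2
  rw [AEMeasurable.map_map_of_aemeasurable h2 measurable_subtype_coe.aemeasurable]
  rfl

/-- On the subtype of the chart target the inverse chart is a measurable embedding, so the formula
needs no measurability of `Φ`. -/
theorem setIntegral_source_vol (g : Metric n M) (x : M) (Φ : M → ℝ) :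
    ∫ z in (chartAt (E n) x).source, Φ z ∂(vol g) = ∫ y in (chartAt (E n) x).target,
      density (chartGram g x y) * Φ ((chartAt (E n) x).symm y) := by
  have h0 : MeasurableSet (chartAt (E n) x).target := (chartAt (E n) x).open_target.measurableSet
  rw [vol_restrict_source, chartVolume_eq_map, (measurableEmbedding_chart_symm x).integral_map]
  have h1 := integral_subtype_comap (μ := (volume.restrict (chartAt (E n) x).target).withDensity
    (fun y => ENNReal.ofReal (density (chartGram g x y)))) h0
    (fun y => Φ ((chartAt (E n) x).symm y))
  refine h1.trans ?_
  rw [restrict_withDensity h0, Measure.restrict_restrict h0, inter_self,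
    integral_withDensity_eq_integral_toReal_smul₀ (aemeasurable_density g x)
      (Eventually.of_forall fun y => ENNReal.ofReal_lt_top)]
  refine integral_congr_ae (Eventually.of_forall fun y => ?_)
  simp only [smul_eq_mul]
  rw [ENNReal.toReal_ofReal (density_nonneg _)]

theorem integrableOn_source_vol (g : Metric n M) (x : M) (Φ : M → ℝ) :
    IntegrableOn Φ (chartAt (E n) x).source (vol g) ↔
      IntegrableOn (fun y => density (chartGram g x y) * Φ ((chartAt (E n) x).symm y))
        (chartAt (E n) x).target := by
  have h0 : MeasurableSet (chartAt (E n) x).target := (chartAt (E n) x).open_target.measurableSet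
  rw [IntegrableOn, vol_restrict_source, chartVolume_eq_map,
    (measurableEmbedding_chart_symm x).integrable_map_iff]
  have h1 := integrableOn_iff_comap_subtypeVal (μ :=
      (volume.restrict (chartAt (E n) x).target).withDensity
        (fun y => ENNReal.ofReal (density (chartGram g x y))))
    (f := fun y => Φ ((chartAt (E n) x).symm y)) h0
  refine h1.symm.trans ?_
  rw [IntegrableOn, restrict_withDensity h0, Measure.restrict_restrict h0, inter_self,
    integrable_withDensity_iff_integrable_smul₀' (aemeasurable_density g x)
      (Eventually.of_forall fun y => ENNReal.ofReal_lt_top)]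
  refine integrable_congr (Eventually.of_forall fun y => ?_)
  simp only [smul_eq_mul]
  rw [ENNReal.toReal_ofReal (density_nonneg _)]

end Measure

end Volume

/-! ### Test functions and weak integrals between manifold and chart. -/

section Transfer

variable {n : ℕ} {M : Type*} [TopologicalSpace M] [ChartedSpace (E n) M]

theorem dif_eq_zero_of_notMem_tsupport {φ : M → ℝ} {z : M} (hz : z ∉ tsupport φ) :
    dif (n := n) φ z = 0 := by
  have h : φ =ᶠ[𝓝 z] fun _ => 0 := notMem_tsupport_iff_eventuallyEq.1 hz
  have h1 : dif (n := n) φ z = mfderiv (𝓡 n) 𝓘(ℝ, ℝ) (fun _ : M => (0 : ℝ)) z := h.mfderiv_eq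
  rw [h1, mfderiv_const]
  rfl

variable [IsManifold (𝓡 n) ∞ M]

/-- The integrand of the weak `p`-Laplace equation, in a chart. -/
theorem density_mul_coInner (g : Metric n M) (p : ℝ) (x : M) {y : E n}
    (hy : y ∈ (chartAt (E n) x).target) (α : (z : M) → TangentSpace (𝓡 n) z →L[ℝ] ℝ)
    {φ : M → ℝ} (hφ : MDifferentiableAt (𝓡 n) 𝓘(ℝ, ℝ) φ ((chartAt (E n) x).symm y)) :
    density (chartGram g x y) * (coNorm g (α ((chartAt (E n) x).symm y)) ^ (p - 2) *
        coInner g (α ((chartAt (E n) x).symm y)) (dif φ ((chartAt (E n) x).symm y))) =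
      fderiv ℝ (fun y => φ ((chartAt (E n) x).symm y)) y
        (flux (chartGram g x y) p (chartForm α x y)) := by
  rw [coNorm, coInner_eq_chart g x hy α α, coInner_eq_chart g x hy α (dif φ),
    chartForm_dif φ x hy hφ, flux, map_smul, smul_eq_mul, mul_assoc]

/-- A test function supported in a chart domain, in coordinates. -/
theorem IsTest.exists_chart [T2Space M] {φ : M → ℝ} (hφ : IsTest n φ) {x : M}
    (hs : tsupport φ ⊆ (chartAt (E n) x).source) :
    ∃ ζ : E n → ℝ, ContDiff ℝ ∞ ζ ∧ HasCompactSupport ζ ∧ tsupport ζ ⊆ (chartAt (E n) x).target ∧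
      (∀ y ∈ (chartAt (E n) x).target, ζ y = φ ((chartAt (E n) x).symm y)) ∧
      ∀ y ∉ (chartAt (E n) x).target, ζ y = 0 := by
  classical
  set e := chartAt (E n) x
  set ζ : E n → ℝ := fun y => if y ∈ e.target then φ (e.symm y) else 0 with hζ
  have h1 : ∀ y ∈ e.target, ζ y = φ (e.symm y) := fun y hy => if_pos hy
  have h2 : ∀ y ∉ e.target, ζ y = 0 := fun y hy => if_neg hy
  set K := e '' tsupport φ with hK
  have hKc : IsCompact K := hφ.2.image_of_continuousOn (e.continuousOn.mono hs)
  have hsK : Function.support ζ ⊆ K := by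
    intro y hy
    by_cases hyt : y ∈ e.target
    · refine ⟨e.symm y, subset_tsupport φ ?_, e.right_inv hyt⟩
      rw [Function.mem_support, ← h1 y hyt]
      exact hy
    · exact absurd (h2 y hyt) hy
  -- The compact image `K` is closed and inside the target, so the extension by zero is smooth
  -- across the boundary of the target.
  have hts : tsupport ζ ⊆ K := closure_minimal hsK hKc.isClosed
  have hKt : K ⊆ e.target := by
    rintro _ ⟨z, hz, rfl⟩
    exact e.map_source (hs hz)
  refine ⟨ζ, ?_, HasCompactSupport.intro hKc fun y hy => by_contra fun h => hy (hsK h),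
    hts.trans hKt, h1, h2⟩
  rw [contDiff_iff_contDiffAt]
  intro y
  by_cases hy : y ∈ e.target
  · have h3 := (contMDiffOn_chart_symm_apply x hφ.1.contMDiffOn).contDiffAt
      (e.open_target.mem_nhds hy)
    refine h3.congr_of_eventuallyEq ?_
    filter_upwards [e.open_target.mem_nhds hy] with z hz using h1 z hz
  · have h3 : y ∉ tsupport ζ := fun h => hy (hKt (hts h))
    exact contDiffAt_const.congr_of_eventuallyEq (notMem_tsupport_iff_eventuallyEq.1 h3)

/-- A test function on a chart target, carried to the manifold. -/
theorem exists_isTest_of_chart [T2Space M] {Ω : Set M} {x : M} {ζ : E n → ℝ}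
    (hζ : ContDiff ℝ ∞ ζ) (hc : HasCompactSupport ζ) (hs : tsupport ζ ⊆ chartRegion n Ω x) :
    ∃ φ : M → ℝ, IsTest n φ ∧ tsupport φ ⊆ Ω ∩ (chartAt (E n) x).source ∧
      ∀ y ∈ (chartAt (E n) x).target, φ ((chartAt (E n) x).symm y) = ζ y := by
  classical
  set e := chartAt (E n) x
  set φ : M → ℝ := fun z => if z ∈ e.source then ζ (e z) else 0 with hφ
  have h1 : ∀ z ∈ e.source, φ z = ζ (e z) := fun z hz => if_pos hz
  have h2 : ∀ z ∉ e.source, φ z = 0 := fun z hz => if_neg hz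
  set K := e.symm '' tsupport ζ with hK
  have hKc : IsCompact K := hc.isCompact.image_of_continuousOn
    (e.continuousOn_symm.mono fun y hy => (hs hy).1)
  have hsK : Function.support φ ⊆ K := by
    intro z hz
    by_cases hzs : z ∈ e.source
    · refine ⟨e z, subset_tsupport ζ ?_, e.left_inv hzs⟩
      rw [Function.mem_support, ← h1 z hzs]
      exact hz
    · exact absurd (h2 z hzs) hz
  -- The Hausdorff property is needed here: the compact set `K` has to be closed in `M`.
  have hts : tsupport φ ⊆ K := closure_minimal hsK hKc.isClosed
  have hKt : K ⊆ Ω ∩ e.source := by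
    rintro _ ⟨y, hy, rfl⟩
    exact ⟨(hs hy).2, e.map_target (hs hy).1⟩
  refine ⟨φ, ⟨?_, HasCompactSupport.intro hKc fun y hy => by_contra fun h => hy (hsK h)⟩,
    hts.trans hKt, fun y hy => ?_⟩
  · intro z
    by_cases hz : z ∈ e.source
    · have h3 : ContMDiffAt (𝓡 n) 𝓘(ℝ, ℝ) ∞ (ζ ∘ e) z := hζ.contMDiff.contMDiffAt.comp z
        ((contMDiffOn_chart (I := 𝓡 n)).contMDiffAt (e.open_source.mem_nhds hz))
      refine h3.congr_of_eventuallyEq ?_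
      filter_upwards [e.open_source.mem_nhds hz] with w hw using h1 w hw
    · have h3 : z ∉ tsupport φ := fun h => hz (hKt (hts h)).2
      exact contMDiffAt_const.congr_of_eventuallyEq (notMem_tsupport_iff_eventuallyEq.1 h3)
  · rw [h1 _ (e.map_target hy), e.right_inv hy]

section Integral

variable {p : ℝ} {g : Metric n M} {x : M} {α : (z : M) → TangentSpace (𝓡 n) z →L[ℝ] ℝ}
  {φ : M → ℝ} {ζ : E n → ℝ}

theorem coInner_dif_eq_zero {z : M} (hz : z ∉ tsupport φ) :
    coNorm g (α z) ^ (p - 2) * coInner g (α z) (dif φ z) = 0 := by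
  rw [dif_eq_zero_of_notMem_tsupport hz]
  simp [coInner]

theorem density_mul_coInner_of_eq (hφ : MDifferentiable (𝓡 n) 𝓘(ℝ, ℝ) φ)
    (hζ : ∀ y ∈ (chartAt (E n) x).target, φ ((chartAt (E n) x).symm y) = ζ y) {y : E n}
    (hy : y ∈ (chartAt (E n) x).target) :
    density (chartGram g x y) * (coNorm g (α ((chartAt (E n) x).symm y)) ^ (p - 2) *
        coInner g (α ((chartAt (E n) x).symm y)) (dif φ ((chartAt (E n) x).symm y))) =
      fderiv ℝ ζ y (flux (chartGram g x y) p (chartForm α x y)) := by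
  rw [density_mul_coInner g p x hy α (hφ _)]
  have h : (fun y => φ ((chartAt (E n) x).symm y)) =ᶠ[𝓝 y] ζ := by
    filter_upwards [(chartAt (E n) x).open_target.mem_nhds hy] with z hz using hζ z hz
  rw [h.fderiv_eq]

variable [MeasurableSpace M] [BorelSpace M]

/-- Both integrands vanish outside the chart, so the two full integrals reduce to the chart formula
for the measure. -/
theorem integral_vol_eq_integral_flux (hφ : MDifferentiable (𝓡 n) 𝓘(ℝ, ℝ) φ)
    (hs : tsupport φ ⊆ (chartAt (E n) x).source) (hsζ : tsupport ζ ⊆ (chartAt (E n) x).target)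
    (hζ : ∀ y ∈ (chartAt (E n) x).target, φ ((chartAt (E n) x).symm y) = ζ y) :
    ∫ z, coNorm g (α z) ^ (p - 2) * coInner g (α z) (dif φ z) ∂(vol g) =
      ∫ y, fderiv ℝ ζ y (flux (chartGram g x y) p (chartForm α x y)) := by
  rw [← setIntegral_eq_integral_of_forall_compl_eq_zero (s := (chartAt (E n) x).source)
    fun z hz => coInner_dif_eq_zero fun h => hz (hs h), setIntegral_source_vol,
    ← setIntegral_eq_integral_of_forall_compl_eq_zero (s := (chartAt (E n) x).target)
    (f := fun y => fderiv ℝ ζ y (flux (chartGram g x y) p (chartForm α x y)))]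
  · exact setIntegral_congr_fun (chartAt (E n) x).open_target.measurableSet fun y hy =>
      density_mul_coInner_of_eq hφ hζ hy
  · intro y hy
    rw [fderiv_of_notMem_tsupport (𝕜 := ℝ) fun h => hy (hsζ h)]
    rfl

theorem integrable_vol_iff_integrable_flux (hφ : MDifferentiable (𝓡 n) 𝓘(ℝ, ℝ) φ)
    (hs : tsupport φ ⊆ (chartAt (E n) x).source) (hsζ : tsupport ζ ⊆ (chartAt (E n) x).target)
    (hζ : ∀ y ∈ (chartAt (E n) x).target, φ ((chartAt (E n) x).symm y) = ζ y) :
    Integrable (fun z => coNorm g (α z) ^ (p - 2) * coInner g (α z) (dif φ z)) (vol g) ↔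
      Integrable fun y => fderiv ℝ ζ y (flux (chartGram g x y) p (chartForm α x y)) := by
  rw [← integrableOn_iff_integrable_of_support_subset (s := (chartAt (E n) x).source)
      fun z hz => by_contra fun h => hz (coInner_dif_eq_zero fun h' => h (hs h')),
    integrableOn_source_vol,
    ← integrableOn_iff_integrable_of_support_subset (s := (chartAt (E n) x).target)
      (f := fun y => fderiv ℝ ζ y (flux (chartGram g x y) p (chartForm α x y)))]
  · exact integrableOn_congr_fun (fun y hy => density_mul_coInner_of_eq hφ hζ hy)
      (chartAt (E n) x).open_target.measurableSet
  · intro y hy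
    by_contra h
    refine hy ?_
    simp only
    rw [fderiv_of_notMem_tsupport (𝕜 := ℝ) fun h' => h (hsζ h')]
    rfl

end Integral

end Transfer

/-! ### Partition of unity and the weak inequality on the manifold. -/

section Glue

variable {n : ℕ} {M : Type*} [TopologicalSpace M] [ChartedSpace (E n) M]

theorem IsTest.mdifferentiable {φ : M → ℝ} (hφ : IsTest n φ) :
    MDifferentiable (𝓡 n) 𝓘(ℝ, ℝ) φ := hφ.1.mdifferentiable (by simp)

theorem dif_sum_apply {ι : Type*} {s : Finset ι} {ψ : ι → M → ℝ}
    (h : ∀ i, MDifferentiable (𝓡 n) 𝓘(ℝ, ℝ) (ψ i)) (z : M) (v : TangentSpace (𝓡 n) z) :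
    dif (n := n) (fun z => ∑ i ∈ s, ψ i z) z v = ∑ i ∈ s, dif (ψ i) z v := by
  classical
  -- Additivity of the differential needs the partial sums to be differentiable, so this is carried
  -- along in the induction.
  suffices h1 : MDifferentiableAt (𝓡 n) 𝓘(ℝ, ℝ) (fun z => ∑ i ∈ s, ψ i z) z ∧
      dif (n := n) (fun z => ∑ i ∈ s, ψ i z) z v = ∑ i ∈ s, dif (ψ i) z v from h1.2
  induction s using Finset.induction_on with
  | empty =>
    simp only [Finset.sum_empty]
    refine ⟨mdifferentiableAt_const, ?_⟩
    rw [dif, mfderiv_const]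
    rfl
  | insert a s ha ih =>
    simp only [Finset.sum_insert ha]
    have h2 := (h a z).hasMFDerivAt.add ih.1.hasMFDerivAt
    refine ⟨h2.mdifferentiableAt, ?_⟩
    rw [← ih.2]
    exact congrArg (fun L : E n →L[ℝ] ℝ => L v) h2.mfderiv

variable [IsManifold (𝓡 n) ∞ M]

/-- A test function is a finite sum of test functions supported in chart domains. -/
theorem IsTest.exists_sum [T2Space M] [SecondCountableTopology M] {φ : M → ℝ} (hφ : IsTest n φ)
    (h0 : ∀ x, 0 ≤ φ x) :
    ∃ (s : Finset M) (ψ : M → M → ℝ), (∀ i, IsTest n (ψ i)) ∧ (∀ i x, 0 ≤ ψ i x) ∧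
      (∀ i, tsupport (ψ i) ⊆ (chartAt (E n) i).source) ∧ φ = fun z => ∑ i ∈ s, ψ i z := by
  have : LocallyCompactSpace M := ChartedSpace.locallyCompactSpace (E n) M
  have : SigmaCompactSpace M := sigmaCompactSpace_of_locallyCompact_secondCountable
  obtain ⟨ρ, hρ⟩ := SmoothPartitionOfUnity.exists_isSubordinate_chartAt_source (𝓡 n) M
  -- Local finiteness on the compact support of `φ` leaves finitely many nonzero products `ρ i * φ`.
  have hfin := ρ.locallyFinite.finite_nonempty_inter_compact hφ.2.isCompact
  refine ⟨hfin.toFinset, fun i z => ρ i z * φ z, fun i => ⟨?_, hφ.2.mul_left⟩,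
    fun i z => mul_nonneg (ρ.nonneg i z) (h0 z), fun i => ?_, ?_⟩
  · exact (ρ i).contMDiff.mul hφ.1
  · exact (tsupport_mul_subset_left (f := ρ i)).trans (hρ i)
  · ext z
    rw [← Finset.sum_mul]
    by_cases hz : φ z = 0
    · simp [hz]
    · have h1 := ρ.sum_eq_one (mem_univ z)
      rw [finsum_eq_sum_of_support_subset (s := hfin.toFinset)] at h1
      · rw [h1, one_mul]
      · intro i hi
        simp only [Finite.coe_toFinset, mem_ofPred_eq]
        exact ⟨z, hi, subset_tsupport φ hz⟩

theorem coInner_dif_sum (g : Metric n M) {ι : Type*} {s : Finset ι} {ψ : ι → M → ℝ}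
    (h : ∀ i, MDifferentiable (𝓡 n) 𝓘(ℝ, ℝ) (ψ i)) {z : M} (α : TangentSpace (𝓡 n) z →L[ℝ] ℝ) :
    coInner g α (dif (fun z => ∑ i ∈ s, ψ i z) z) = ∑ i ∈ s, coInner g α (dif (ψ i) z) :=
  dif_sum_apply h z _

theorem fderiv_chart_ne_zero (g : Metric n M) {f : M → ℝ} {x : M} {y : E n}
    (hy : y ∈ (chartAt (E n) x).target)
    (hf : MDifferentiableAt (𝓡 n) 𝓘(ℝ, ℝ) f ((chartAt (E n) x).symm y))
    (hd : coNorm g (dif f ((chartAt (E n) x).symm y)) ≠ 0) :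
    fderiv ℝ (fun y => f ((chartAt (E n) x).symm y)) y ≠ 0 := by
  intro h
  apply hd
  rw [coNorm, coInner_eq_chart g x hy (dif f) (dif f), chartForm_dif f x hy hf, h]
  simp

theorem integrable_fderiv_apply {V : E n → E n} {U : Set (E n)} (hU : IsOpen U)
    (hV : ContinuousOn V U) {ζ : E n → ℝ} (hζ : ContDiff ℝ 1 ζ) (hc : HasCompactSupport ζ)
    (hs : tsupport ζ ⊆ U) : Integrable fun y => fderiv ℝ ζ y (V y) := by
  have h1 : ∀ y ∉ tsupport ζ, (fun y => fderiv ℝ ζ y (V y)) =ᶠ[𝓝 y] fun _ => 0 := by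
    intro y hy
    filter_upwards [(isClosed_tsupport ζ).isOpen_compl.mem_nhds hy] with z hz
    rw [fderiv_of_notMem_tsupport (𝕜 := ℝ) hz]
    rfl
  refine Continuous.integrable_of_hasCompactSupport ?_ ?_
  · rw [continuous_iff_continuousAt]
    intro y
    by_cases hy : y ∈ U
    · exact (hζ.continuous_fderiv one_ne_zero).continuousAt.clm_apply
        (hV.continuousAt (hU.mem_nhds hy))
    · exact continuousAt_const.congr (h1 y fun h => hy (hs h)).symm
  · exact HasCompactSupport.intro hc.isCompact fun y hy => (h1 y hy).self_of_nhds

variable [MeasurableSpace M] [BorelSpace M]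

/-- The condition is linear in the test function, so one chart suffices. There the flux is C¹
because `df` does not vanish, and integration by parts turns the integral into minus that of a
nonnegative divergence times a nonnegative function. -/
theorem isSubsolution_of_hess_nonneg [T2Space M] [SecondCountableTopology M] (g : Metric n M)
    {f : M → ℝ} {p : ℝ} (hp : 1 ≤ p) (hf : ContMDiff (𝓡 n) 𝓘(ℝ, ℝ) 2 f)
    (hd : ∀ x : M, coNorm g (dif f x) ≠ 0)
    (hH : ∀ x : M, ∀ y ∈ (chartAt (E n) x).target, ∀ v, 0 ≤ hess (chartGram g x)
      (fun y => f ((chartAt (E n) x).symm y)) y v v) : IsSubsolution g p f := by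
  intro φ hφ hφ0
  obtain ⟨s, ψ, hψ, hψ0, hψs, rfl⟩ := hφ.exists_sum hφ0
  have hfd : MDifferentiable (𝓡 n) 𝓘(ℝ, ℝ) f := hf.mdifferentiable (by simp)
  have key : ∀ i, Integrable
      (fun x => coNorm g (dif f x) ^ (p - 2) * coInner g (dif f x) (dif (ψ i) x)) (vol g) ∧
      ∫ x, coNorm g (dif f x) ^ (p - 2) * coInner g (dif f x) (dif (ψ i) x) ∂(vol g) ≤ 0 := by
    intro x
    obtain ⟨ζ, hζ, hζc, hζs, hζe, hζo⟩ := (hψ x).exists_chart (hψs x)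
    have hζe' : ∀ y ∈ (chartAt (E n) x).target, ψ x ((chartAt (E n) x).symm y) = ζ y :=
      fun y hy => (hζe y hy).symm
    set F : E n → ℝ := fun y => f ((chartAt (E n) x).symm y) with hF
    set G := chartGram g x
    have hU := (chartAt (E n) x).open_target
    have hFc : ∀ y ∈ (chartAt (E n) x).target, ContDiffAt ℝ 2 F y := fun y hy => by
      have : IsManifold (𝓡 n) 2 M := IsManifold.of_le (n := ∞)
        (show ((2 : ℕ∞) : WithTop ℕ∞) ≤ (∞ : WithTop ℕ∞) from mod_cast le_top)
      exact (contMDiffOn_chart_symm_apply x hf.contMDiffOn).contDiffAt (hU.mem_nhds hy)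
    have hGc : ∀ y ∈ (chartAt (E n) x).target, ContDiffAt ℝ 1 G y := fun y hy =>
      ((contDiffOn_chartGram g x).contDiffAt (hU.mem_nhds hy)).of_le (by exact_mod_cast le_top)
    have hne : ∀ y ∈ (chartAt (E n) x).target, fderiv ℝ F y ≠ 0 := fun y hy =>
      fderiv_chart_ne_zero g hy (hfd _) (hd _)
    set V : E n → E n := fun y => flux (G y) p (fderiv ℝ F y) with hV
    have hVc : ContDiffOn ℝ 1 V (chartAt (E n) x).target := fun y hy =>
      (contDiffAt_flux p (hGc y hy) (isInner_chartGram g x hy)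
        ((hFc y hy).fderiv_right (by norm_num)) (hne y hy)).contDiffWithinAt
    have hcongr : ∀ y, fderiv ℝ ζ y (flux (G y) p (chartForm (dif f) x y)) =
        fderiv ℝ ζ y (V y) := by
      intro y
      by_cases hy : y ∈ (chartAt (E n) x).target
      · rw [chartForm_dif f x hy (hfd _)]
      · rw [fderiv_of_notMem_tsupport (𝕜 := ℝ) fun h => hy (hζs h)]
        rfl
    rw [integrable_vol_iff_integrable_flux (hψ x).mdifferentiable (hψs x) hζs hζe',
      integral_vol_eq_integral_flux (hψ x).mdifferentiable (hψs x) hζs hζe']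
    rw [show (fun y => fderiv ℝ ζ y (flux (chartGram g x y) p (chartForm (dif f) x y))) =
      fun y => fderiv ℝ ζ y (V y) from funext hcongr]
    have hζ1 : ContDiff ℝ 1 ζ := hζ.of_le (by exact_mod_cast le_top)
    refine ⟨integrable_fderiv_apply hU hVc.continuousOn hζ1 hζc hζs, ?_⟩
    rw [integral_fderiv_apply hU hVc hζ1 hζc hζs, neg_nonpos]
    refine integral_nonneg fun y => ?_
    by_cases hy : y ∈ (chartAt (E n) x).target
    · refine mul_nonneg (divergence_flux_nonneg hp (hGc y hy) ?_ (hFc y hy) (hne y hy)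
        (hH x y hy)) ?_
      · filter_upwards [hU.mem_nhds hy] with z hz using isInner_chartGram g x hz
      · rw [hζe y hy]
        exact hψ0 x _
    · simp [hζo y hy]
  have hsum : (fun x => coNorm g (dif f x) ^ (p - 2) *
      coInner g (dif f x) (dif (fun z => ∑ i ∈ s, ψ i z) x)) = fun x => ∑ i ∈ s,
      coNorm g (dif f x) ^ (p - 2) * coInner g (dif f x) (dif (ψ i) x) := by
    ext x
    rw [coInner_dif_sum g fun i => (hψ i).mdifferentiable, Finset.mul_sum]
  rw [hsum, integral_finsetSum s fun i _ => (key i).1]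
  exact ⟨integrable_finsetSum s fun i _ => (key i).1, Finset.sum_nonpos fun i _ => (key i).2⟩

end Glue

/-! ### Local geodesics. -/

section GeodesicField

variable {n : ℕ}

/-- The contracted Christoffel symbols of the first kind of the metric `G`, as a covector. -/
def christoffelForm (G : E n → Form n) (y w : E n) : E n →L[ℝ] ℝ :=
  fderiv ℝ (fun z : E n × E n => G z.1 z.2) (y, w) (w, 0) -
    (1 / 2 : ℝ) • (fderiv ℝ (fun z : E n × E n => G z.1 z.2 z.2) (y, w)).comp
      (ContinuousLinearMap.inl ℝ (E n) (E n))

theorem contDiffAt_christoffelForm {G : E n → Form n} {z : E n × E n}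
    (hG : ContDiffAt (F := Form n) ℝ 2 G z.1) :
    ContDiffAt ℝ 1 (fun z : E n × E n => christoffelForm G z.1 z.2) z := by
  have h1 : ContDiffAt (F := Form n) ℝ 2 (fun z : E n × E n => G z.1) z :=
    ContDiffAt.comp (𝕜 := ℝ) (G := Form n) z hG contDiffAt_fst
  have h2 : ContDiffAt ℝ 2 (fun z : E n × E n => G z.1 z.2) z :=
    ContDiffAt.clm_apply (𝕜 := ℝ) (F := E n) (G := E n →L[ℝ] ℝ) h1 contDiffAt_snd
  have h3 : ContDiffAt ℝ 2 (fun z : E n × E n => G z.1 z.2 z.2) z := h2.clm_apply contDiffAt_snd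
  have h4 : ContDiffAt ℝ 1 (fderiv ℝ fun z : E n × E n => G z.1 z.2) z :=
    h2.fderiv_right (by norm_num)
  have h5 : ContDiffAt ℝ 1 (fderiv ℝ fun z : E n × E n => G z.1 z.2 z.2) z :=
    h3.fderiv_right (by norm_num)
  exact (h4.clm_apply (contDiffAt_snd.prodMk contDiffAt_const)).sub
    ((h5.clm_comp contDiffAt_const).const_smul (1 / 2 : ℝ))

/-- `christoffelForm` is written with joint derivatives in position and velocity, which makes its
regularity in both evident. Since only position increments are inserted, just derivatives of `G`
remain. -/
theorem christoffelForm_apply {G : E n → Form n} {y : E n} (hG : DifferentiableAt ℝ G y)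
    (w v : E n) : christoffelForm G y w v = fderiv ℝ G y w w v - fderiv ℝ G y v w w / 2 := by
  have h1 : HasFDerivAt (𝕜 := ℝ) (F := Form n) (fun z : E n × E n => G z.1)
      ((fderiv ℝ G y).comp (ContinuousLinearMap.fst ℝ (E n) (E n))) (y, w) :=
    HasFDerivAt.comp (𝕜 := ℝ) (G := Form n) (y, w) hG.hasFDerivAt hasFDerivAt_fst
  have h2 : HasFDerivAt (fun z : E n × E n => G z.1 z.2) (_ : E n × E n →L[ℝ] E n →L[ℝ] ℝ) (y, w) :=
    HasFDerivAt.clm_apply (𝕜 := ℝ) h1 hasFDerivAt_snd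
  have h3 : HasFDerivAt (fun z : E n × E n => G z.1 z.2 z.2) (_ : E n × E n →L[ℝ] ℝ) (y, w) :=
    h2.clm_apply hasFDerivAt_snd
  rw [christoffelForm, h2.fderiv, h3.fderiv]
  simp
  ring

/-- The geodesic vector field of the metric `G` on the tangent bundle of the model space. -/
def geodesicField (G : E n → Form n) (z : E n × E n) : E n × E n :=
  (z.2, -raise (G z.1) (christoffelForm G z.1 z.2))

variable {G : E n → Form n} {U : Set (E n)}

theorem contDiffAt_geodesicField (hU : IsOpen U) (hG : ContDiffOn ℝ ∞ G U)
    (hI : ∀ y ∈ U, IsInner (G y)) {z : E n × E n} (hz : z.1 ∈ U) :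
    ContDiffAt ℝ 1 (geodesicField G) z := by
  have h1 : ContDiffAt ℝ 1 (fun z : E n × E n => (G z.1).inverse) z := by
    have h := ContDiffAt.comp (𝕜 := ℝ) (F := Form n) z.1 (hI _ hz).contDiffAt_inverse
      ((hG.contDiffAt (hU.mem_nhds hz)).of_le (m := 1)
        (show ((1 : ℕ∞) : WithTop ℕ∞) ≤ (∞ : WithTop ℕ∞) from mod_cast le_top))
    exact ContDiffAt.comp (𝕜 := ℝ) z h contDiffAt_fst
  have h2 : ContDiffAt (F := Form n) ℝ 2 G z.1 := (hG.contDiffAt (hU.mem_nhds hz)).of_le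
    (show ((2 : ℕ∞) : WithTop ℕ∞) ≤ (∞ : WithTop ℕ∞) from mod_cast le_top)
  exact contDiffAt_snd.prodMk (h1.clm_apply (contDiffAt_christoffelForm h2)).neg

/-- Picard–Lindelöf for the first-order system of position and velocity; the time interval is then
shrunk so that the curve stays in `U`. -/
theorem exists_geodesic (hU : IsOpen U) (hG : ContDiffOn ℝ ∞ G U) (hI : ∀ y ∈ U, IsInner (G y))
    {y : E n} (hy : y ∈ U) (v : E n) :
    ∃ ε > 0, ∃ u w : ℝ → E n, u 0 = y ∧ w 0 = v ∧ ∀ t ∈ Ioo (-ε) ε, u t ∈ U ∧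
      HasDerivAt u (w t) t ∧ HasDerivAt w (-raise (G (u t)) (christoffelForm G (u t) (w t))) t := by
  obtain ⟨α, hα0, δ, hδ, hα⟩ :=
    (contDiffAt_geodesicField (z := (y, v)) hU hG hI hy).exists_forall_mem_closedBall_exists_eq_forall_mem_Ioo_hasDerivAt₀ 0
  rw [zero_sub, zero_add] at hα
  have h0 : ContinuousAt (fun t => (α t).1) 0 :=
    continuous_fst.continuousAt.comp (hα 0 ⟨by linarith, hδ⟩).continuousAt
  have h1 : ∀ᶠ t in 𝓝 (0 : ℝ), (α t).1 ∈ U :=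
    h0.eventually_mem (hU.mem_nhds (by rw [hα0]; exact hy))
  obtain ⟨η, hη, h2⟩ := Metric.eventually_nhds_iff.1 h1
  refine ⟨min δ η, lt_min hδ hη, fun t => (α t).1, fun t => (α t).2, by simp [hα0],
    by simp [hα0], fun t ht => ⟨h2 ?_, ?_, ?_⟩⟩
  · rw [Real.dist_0_eq_abs, abs_lt]
    exact ⟨by linarith [ht.1, min_le_right δ η], by linarith [ht.2, min_le_right δ η]⟩
  · exact (hα t ⟨by linarith [ht.1, min_le_left δ η], by linarith [ht.2, min_le_left δ η]⟩).fst
  · exact (hα t ⟨by linarith [ht.1, min_le_left δ η], by linarith [ht.2, min_le_left δ η]⟩).snd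

theorem contDiffOn_two_of_hasDerivAt {s : Set ℝ} (hs : IsOpen s) {F : Type*}
    [NormedAddCommGroup F] [NormedSpace ℝ F] {u w a : ℝ → F}
    (hu : ∀ t ∈ s, HasDerivAt u (w t) t) (hw : ∀ t ∈ s, HasDerivAt w (a t) t)
    (ha : ContinuousOn a s) : ContDiffOn ℝ 2 u s := by
  have h1 : ContDiffOn ℝ 1 w s := by
    rw [show (1 : WithTop ℕ∞) = 0 + 1 from rfl, contDiffOn_succ_iff_deriv_of_isOpen hs]
    refine ⟨fun t ht => (hw t ht).differentiableAt.differentiableWithinAt, by simp, ?_⟩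
    rw [contDiffOn_zero]
    exact ha.congr fun t ht => (hw t ht).deriv
  rw [show (2 : WithTop ℕ∞) = 1 + 1 from rfl, contDiffOn_succ_iff_deriv_of_isOpen hs]
  exact ⟨fun t ht => (hu t ht).differentiableAt.differentiableWithinAt, by simp,
    h1.congr fun t ht => (hu t ht).deriv⟩

/-- The second derivative of `F` along a geodesic is the covariant Hessian. -/
theorem hasDerivAt_fderiv_geodesic {F : E n → ℝ} {y : E n} (hI : IsInner (G y))
    (hG : DifferentiableAt ℝ G y) (hF : ContDiffAt ℝ 2 F y) {u w : ℝ → E n} {t : ℝ} (hut : u t = y)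
    (hu : HasDerivAt u (w t) t)
    (hw : HasDerivAt w (-raise (G (u t)) (christoffelForm G (u t) (w t))) t) :
    HasDerivAt (fun t => fderiv ℝ F (u t) (w t)) (hess G F y (w t) (w t)) t := by
  subst hut
  have h1 : HasFDerivAt (fderiv ℝ F) (fderiv ℝ (fderiv ℝ F) (u t)) (u t) :=
    ((hF.fderiv_right (m := 1) (by norm_num)).differentiableAt one_ne_zero).hasFDerivAt
  have h2 := (h1.comp_hasDerivAt t hu).clm_apply hw
  refine h2.congr_deriv ?_
  -- The acceleration is minus the dual of the Christoffel covector. By symmetry of the metric, `dF`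
  -- of that dual is the Christoffel covector on the gradient, which is the correction term in
  -- `hess`.
  have h3 := hI.raise_comm (fderiv ℝ F (u t)) (christoffelForm G (u t) (w t))
  rw [christoffelForm_apply hG] at h3
  rw [hess_apply, map_neg]
  simp only [Function.comp]
  rw [h3]
  ring

end GeodesicField

/-! ### Geodesic convexity gives a nonnegative Hessian. -/

section Convexity

variable {n : ℕ} {M : Type*} [TopologicalSpace M] [ChartedSpace (E n) M] [IsManifold (𝓡 n) ∞ M]

theorem differentiableAt_chartGram (g : Metric n M) {x : M} {y : E n}
    (hy : y ∈ (chartAt (E n) x).target) : DifferentiableAt ℝ (chartGram g x) y :=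
  ((contDiffOn_chartGram g x).contDiffAt ((chartAt (E n) x).open_target.mem_nhds hy)).differentiableAt
    (by simp)

theorem christoffel_eq (g : Metric n M) {x : M} {y : E n} (hy : y ∈ (chartAt (E n) x).target)
    (w v : E n) : christoffel g x y w w v = christoffelForm (chartGram g x) y w v := by
  have hG := differentiableAt_chartGram g hy
  have h1 : ∀ a b c, fderiv ℝ (fun z => chartMetric g x z a b) y c =
      fderiv ℝ (chartGram g x) y c a b := fun a b c => fderiv_apply₂ hG a b c
  rw [christoffel, h1, h1, christoffelForm_apply hG]
  ring

/-- A solution of the geodesic equation in a chart is a geodesic. -/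
theorem isGeodesicOn_chart_symm (g : Metric n M) (x : M) {s : Set ℝ} (hs : IsOpen s)
    {u w : ℝ → E n} (h : ∀ t ∈ s, u t ∈ (chartAt (E n) x).target ∧ HasDerivAt u (w t) t ∧
      HasDerivAt w (-raise (chartGram g x (u t)) (christoffelForm (chartGram g x) (u t) (w t))) t) :
    IsGeodesicOn g (fun t => (chartAt (E n) x).symm (u t)) s := by
  have hu : ContDiffOn ℝ 2 u s := by
    refine contDiffOn_two_of_hasDerivAt hs (fun t ht => (h t ht).2.1) (fun t ht => (h t ht).2.2) ?_
    intro t ht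
    have h1 := (contDiffAt_geodesicField (z := (u t, w t)) (chartAt (E n) x).open_target
      (contDiffOn_chartGram g x) (fun y hy => isInner_chartGram g x hy) (h t ht).1).continuousAt
    have h2 : ContinuousAt (fun t => (u t, w t)) t :=
      (h t ht).2.1.continuousAt.prodMk (h t ht).2.2.continuousAt
    exact (continuous_snd.continuousAt.comp
      (ContinuousAt.comp (f := fun t => (u t, w t)) h1 h2)).continuousWithinAt
  have : IsManifold (𝓡 n) 2 M := IsManifold.of_le (n := ∞)
    (show ((2 : ℕ∞) : WithTop ℕ∞) ≤ (∞ : WithTop ℕ∞) from mod_cast le_top)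
  refine ⟨(contMDiffOn_chart_symm (I := 𝓡 n)).comp hu.contMDiffOn fun t ht => (h t ht).1,
    fun t ht => ⟨x, (chartAt (E n) x).map_target (h t ht).1, fun v => ?_⟩⟩
  have h1 : ∀ t ∈ s, (fun r => chartAt (E n) x ((chartAt (E n) x).symm (u r))) =ᶠ[𝓝 t] u := by
    intro t ht
    filter_upwards [hs.mem_nhds ht] with r hr using (chartAt (E n) x).right_inv (h r hr).1
  have h2 : ∀ t ∈ s, deriv (fun r => chartAt (E n) x ((chartAt (E n) x).symm (u r))) t = w t :=
    fun t ht => (h1 t ht).deriv_eq.trans (h t ht).2.1.deriv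
  have h3 : deriv (deriv fun r => chartAt (E n) x ((chartAt (E n) x).symm (u r))) t =
      -raise (chartGram g x (u t)) (christoffelForm (chartGram g x) (u t) (w t)) := by
    rw [← (h t ht).2.2.deriv]
    refine Filter.EventuallyEq.deriv_eq ?_
    filter_upwards [hs.mem_nhds ht] with r hr using h2 r hr
  rw [h3, h2 t ht]
  beta_reduce
  rw [(chartAt (E n) x).right_inv (h t ht).1, ← chartGram_apply, christoffel_eq g (h t ht).1, map_neg,
    neg_apply, (isInner_chartGram g x (h t ht).1).apply_raise]
  exact neg_add_cancel _

/-- Along the geodesic from `y` with velocity `v`, convexity makes the first derivative of `f`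
nondecreasing, so its derivative at time 0, which is the Hessian on `v`, is nonnegative. -/
theorem IsConvex.hess_nonneg {g : Metric n M} {f : M → ℝ} (hc : IsConvex g f)
    (hf : ContMDiff (𝓡 n) 𝓘(ℝ, ℝ) 2 f) (x : M) {y : E n} (hy : y ∈ (chartAt (E n) x).target)
    (v : E n) : 0 ≤ hess (chartGram g x) (fun y => f ((chartAt (E n) x).symm y)) y v v := by
  set F : E n → ℝ := fun y => f ((chartAt (E n) x).symm y) with hF
  have hU := (chartAt (E n) x).open_target
  have hFc : ∀ y ∈ (chartAt (E n) x).target, ContDiffAt ℝ 2 F y := fun y hy => by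
    have : IsManifold (𝓡 n) 2 M := IsManifold.of_le (n := ∞)
      (show ((2 : ℕ∞) : WithTop ℕ∞) ≤ (∞ : WithTop ℕ∞) from mod_cast le_top)
    exact (contMDiffOn_chart_symm_apply x hf.contMDiffOn).contDiffAt (hU.mem_nhds hy)
  obtain ⟨ε, hε, u, w, hu0, hw0, h⟩ := exists_geodesic hU (contDiffOn_chartGram g x)
    (fun y hy => isInner_chartGram g x hy) hy v
  have hconv := hc ε hε _ (isGeodesicOn_chart_symm g x isOpen_Ioo h)
  have hd : ∀ t ∈ Ioo (-ε) ε, HasDerivAt (fun t => F (u t)) (fderiv ℝ F (u t) (w t)) t :=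
    fun t ht => (((hFc _ (h t ht).1).differentiableAt (by simp)).hasFDerivAt).comp_hasDerivAt t
      (h t ht).2.1
  have hmono := hconv.monotoneOn_deriv fun t ht => (hd t ht).differentiableAt
  have h0 : (0 : ℝ) ∈ Ioo (-ε) ε := ⟨by linarith, hε⟩
  have h2 := hasDerivAt_fderiv_geodesic (isInner_chartGram g x hy)
    (differentiableAt_chartGram g hy) (hFc y hy) hu0 (h 0 h0).2.1 (h 0 h0).2.2
  rw [hw0] at h2
  have h3 : HasDerivAt (deriv fun t => F (u t)) (hess (chartGram g x) F y v v) 0 := by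
    refine h2.congr_of_eventuallyEq ?_
    filter_upwards [isOpen_Ioo.mem_nhds h0] with t ht using (hd t ht).deriv
  refine (h3.hasDerivWithinAt (s := Ioo (-ε) ε)).nonneg_of_monotoneOn ?_ hmono
  have h4 : AccPt (0 : ℝ) (𝓟 (Ioo (-ε) ε ∩ univ)) :=
    (PerfectSpace.univ_preperfect 0 (mem_univ 0)).nhds_inter (isOpen_Ioo.mem_nhds h0)
  rwa [inter_univ] at h4

end Convexity

/-! ### Perturbations of the subsolution and their Hessians. -/

section Perturbation

variable {n : ℕ} {G : E n → Form n} {F Q : E n → ℝ} {y : E n}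

theorem eventually_differentiableAt (hF : ContDiffAt ℝ 2 F y) :
    ∀ᶠ z in 𝓝 y, DifferentiableAt ℝ F z :=
  (hF.eventually (by simp)).mono fun _ hz => hz.differentiableAt (by simp)

theorem hasFDerivAt_fderiv (hF : ContDiffAt ℝ 2 F y) :
    HasFDerivAt (fderiv ℝ F) (fderiv ℝ (fderiv ℝ F) y) y :=
  ((hF.fderiv_right (m := 1) (by norm_num)).differentiableAt one_ne_zero).hasFDerivAt

theorem fderiv_real_comp {φ φ₁ : ℝ → ℝ} (h : ∀ t, HasDerivAt φ (φ₁ t) t)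
    (hF : DifferentiableAt ℝ F y) :
    fderiv ℝ (fun z => φ (F z)) y = φ₁ (F y) • fderiv ℝ F y :=
  ((h (F y)).comp_hasFDerivAt y hF.hasFDerivAt).fderiv

theorem fderiv_fderiv_real_comp {φ φ₁ φ₂ : ℝ → ℝ} (h : ∀ t, HasDerivAt φ (φ₁ t) t)
    (h' : ∀ t, HasDerivAt φ₁ (φ₂ t) t) (hF : ContDiffAt ℝ 2 F y) (v w : E n) :
    fderiv ℝ (fderiv ℝ fun z => φ (F z)) y v w =
      φ₁ (F y) * fderiv ℝ (fderiv ℝ F) y v w + φ₂ (F y) * fderiv ℝ F y v * fderiv ℝ F y w := by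
  have h1 : fderiv ℝ (fun z => φ (F z)) =ᶠ[𝓝 y] fun z => φ₁ (F z) • fderiv ℝ F z :=
    (eventually_differentiableAt hF).mono fun z hz => fderiv_real_comp h hz
  have h2 := ((h' (F y)).comp_hasFDerivAt y (hF.differentiableAt (by simp)).hasFDerivAt).smul
    (hasFDerivAt_fderiv hF)
  have h3 : HasFDerivAt (fun z => φ₁ (F z) • fderiv ℝ F z) _ y := h2
  rw [h1.fderiv_eq, h3.fderiv]
  simp

/-- A convex `φ` adds a nonnegative multiple of `dF ⊗ dF`: this supplies strict positivity in the
gradient direction. -/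
theorem hess_real_comp {φ φ₁ φ₂ : ℝ → ℝ} (h : ∀ t, HasDerivAt φ (φ₁ t) t)
    (h' : ∀ t, HasDerivAt φ₁ (φ₂ t) t) (hF : ContDiffAt ℝ 2 F y) (v w : E n) :
    hess G (fun z => φ (F z)) y v w =
      φ₁ (F y) * hess G F y v w + φ₂ (F y) * fderiv ℝ F y v * fderiv ℝ F y w := by
  rw [hess_apply, hess_apply, fderiv_fderiv_real_comp h h' hF,
    fderiv_real_comp h (hF.differentiableAt (by simp)), raise_smul]
  simp only [map_smul, smul_apply, smul_eq_mul]
  ring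

theorem fderiv_sub_of_fderiv_eq_zero (hF : ContDiffAt ℝ 2 F y) (hQ : ContDiffAt ℝ 2 Q y)
    (h1 : fderiv ℝ Q y = 0) : fderiv ℝ (fun z => F z - Q z) y = fderiv ℝ F y := by
  have := (hF.differentiableAt (by simp)).hasFDerivAt.sub (hQ.differentiableAt (by simp)).hasFDerivAt
  rw [h1, sub_zero] at this
  exact this.fderiv

/-- Subtracting a function with vanishing second order jet does not change the Hessian. -/
theorem hess_sub_of_fderiv_eq_zero (hF : ContDiffAt ℝ 2 F y) (hQ : ContDiffAt ℝ 2 Q y)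
    (h1 : fderiv ℝ Q y = 0) (h2 : ∀ v w, fderiv ℝ (fderiv ℝ Q) y v w = 0) (v w : E n) :
    hess G (fun z => F z - Q z) y v w = hess G F y v w := by
  have h3 : fderiv ℝ (fun z => F z - Q z) =ᶠ[𝓝 y] fun z => fderiv ℝ F z - fderiv ℝ Q z := by
    filter_upwards [eventually_differentiableAt hF, eventually_differentiableAt hQ] with z hz hz'
    exact fderiv_fun_sub hz hz'
  have h4 := (hasFDerivAt_fderiv hF).sub (hasFDerivAt_fderiv hQ)
  have h5 : HasFDerivAt (fun z => fderiv ℝ F z - fderiv ℝ Q z) _ y := h4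
  have h6 : fderiv ℝ (fderiv ℝ (fun z => F z - Q z)) y v w = fderiv ℝ (fderiv ℝ F) y v w := by
    rw [h3.fderiv_eq, h5.fderiv, sub_apply, sub_apply, h2, sub_zero]
  rw [hess_apply, hess_apply, fderiv_sub_of_fderiv_eq_zero hF hQ h1, h6]

theorem contDiff_norm_sub_sq (y₀ : E n) : ContDiff ℝ 2 fun y : E n => ‖y - y₀‖ ^ 2 :=
  (contDiff_id.sub contDiff_const).norm_sq ℝ

theorem fderiv_norm_sub_pow_four (y₀ : E n) :
    fderiv ℝ (fun y : E n => (‖y - y₀‖ ^ 2) ^ 2) y₀ = 0 := by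
  rw [fderiv_real_comp (φ := fun t => t ^ 2) (φ₁ := fun t => 2 * t)
    (fun t => by simpa using hasDerivAt_pow 2 t)
    ((contDiff_norm_sub_sq y₀).contDiffAt.differentiableAt (by simp))]
  simp

/-- For `q = ‖y - y₀‖ ^ 2` the second derivative of `q ^ 2` is `2 q d²q + 2 dq ⊗ dq`, and both `q`
and `dq` vanish at the minimum `y₀`. -/
theorem fderiv_fderiv_norm_sub_pow_four (y₀ v w : E n) :
    fderiv ℝ (fderiv ℝ fun y : E n => (‖y - y₀‖ ^ 2) ^ 2) y₀ v w = 0 := by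
  have hmin : IsLocalMin (fun y : E n => ‖y - y₀‖ ^ 2) y₀ :=
    Filter.Eventually.of_forall fun y => by simp
  rw [fderiv_fderiv_real_comp (φ := fun t => t ^ 2) (φ₁ := fun t => 2 * t) (φ₂ := fun _ => 2)
    (fun t => by simpa using hasDerivAt_pow 2 t)
    (fun t => by simpa using (hasDerivAt_id t).const_mul 2)
    (contDiff_norm_sub_sq y₀).contDiffAt, hmin.fderiv_eq_zero]
  simp

end Perturbation

/-! ### The comparison principle. -/

section Comparison

variable {n : ℕ} {M : Type*} [TopologicalSpace M] [ChartedSpace (E n) M]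

theorem isOpen_chartRegion {Ω : Set M} (hΩ : IsOpen Ω) (x : M) : IsOpen (chartRegion n Ω x) :=
  (chartAt (E n) x).isOpen_inter_preimage_symm hΩ

variable [IsManifold (𝓡 n) ∞ M] [T2Space M] [MeasurableSpace M] [BorelSpace M]

theorem isBelowPHarmonic_of_hess_nonneg (g : Metric n M) {f : M → ℝ} {p : ℝ} (hp : 1 < p)
    (hf : ContMDiff (𝓡 n) 𝓘(ℝ, ℝ) 2 f) (hd : ∀ x : M, coNorm g (dif f x) ≠ 0)
    (hH : ∀ x : M, ∀ y ∈ (chartAt (E n) x).target, ∀ v, 0 ≤ hess (chartGram g x)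
      (fun y => f ((chartAt (E n) x).symm y)) y v v) : IsBelowPHarmonic g p f := by
  intro Ω hΩ _ hΩc h hh ⟨hhΩ, α, hα, hsol⟩ hle x₁ hx₁
  by_contra! hlt
  set m := f x₁ - h x₁ with hm
  have hm0 : 0 < m := sub_pos.2 hlt
  obtain ⟨C, hC⟩ := hΩc.bddAbove_image hf.continuous.continuousOn
  have hfC : ∀ x ∈ closure Ω, f x ≤ C := fun x hx => hC (mem_image_of_mem f hx)
  -- Chosen so that `κ exp f ≤ m / 2` on the closure of `Ω`.
  set κ := m / 2 * Real.exp (-C) with hκ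
  have hκ0 : 0 < κ := by positivity
  have hκC : ∀ x ∈ closure Ω, κ * Real.exp (f x) ≤ m / 2 := by
    intro x hx
    calc κ * Real.exp (f x) ≤ κ * Real.exp C := by gcongr; exact hfC x hx
      _ = m / 2 := by rw [hκ, mul_assoc, ← Real.exp_add]; simp
  obtain ⟨x₀, hx₀c, hmax⟩ := hΩc.exists_isMaxOn ⟨x₁, subset_closure hx₁⟩
    (f := fun x => f x + κ * Real.exp (f x) - h x)
    (((hf.continuous.add (continuous_const.mul (Real.continuous_exp.comp
      hf.continuous))).continuousOn).sub hh)
  have hmax' : ∀ x ∈ closure Ω,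
      f x + κ * Real.exp (f x) - h x ≤ f x₀ + κ * Real.exp (f x₀) - h x₀ := fun x hx => hmax hx
  -- On the frontier the perturbed difference is at most `m / 2`, while at `x₁` it exceeds `m`.
  have hx₀ : x₀ ∈ Ω := by
    by_contra hx
    have h1 : x₀ ∈ frontier Ω := by
      rw [hΩ.frontier_eq]
      exact ⟨hx₀c, hx⟩
    have h2 := hle x₀ h1
    have h3 := hκC x₀ hx₀c
    have h4 := hmax' x₁ (subset_closure hx₁)
    have h5 : 0 < κ * Real.exp (f x₁) := by positivity
    linarith
  set e := chartAt (E n) x₀ with he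
  set U := chartRegion n Ω x₀ with hU
  have hUo : IsOpen U := isOpen_chartRegion hΩ x₀
  set y₀ := e x₀ with hy₀
  have hsy₀ : e.symm y₀ = x₀ := e.left_inv (mem_chart_source (E n) x₀)
  have hy₀t : y₀ ∈ e.target := mem_chart_target (E n) x₀
  have hy₀U : y₀ ∈ U := ⟨hy₀t, by rw [mem_preimage]; exact hsy₀.symm ▸ hx₀⟩
  have hUt : U ⊆ e.target := fun y hy => hy.1
  have hM : IsManifold (𝓡 n) 2 M := IsManifold.of_le (n := ∞)
    (show ((2 : ℕ∞) : WithTop ℕ∞) ≤ (∞ : WithTop ℕ∞) from mod_cast le_top)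
  set F : E n → ℝ := fun y => f (e.symm y) with hF
  have hFc : ContDiffOn ℝ 2 F e.target := contMDiffOn_chart_symm_apply x₀ hf.contMDiffOn
  have hFy : ContDiffAt ℝ 2 F y₀ := hFc.contDiffAt (e.open_target.mem_nhds hy₀t)
  set φ : ℝ → ℝ := fun t => t + κ * Real.exp t with hφ
  set φ₁ : ℝ → ℝ := fun t => 1 + κ * Real.exp t with hφ₁
  have hφd : ∀ t, HasDerivAt φ (φ₁ t) t := fun t =>
    (hasDerivAt_id t).add ((Real.hasDerivAt_exp t).const_mul κ)
  have hφd' : ∀ t, HasDerivAt φ₁ (κ * Real.exp t) t := fun t =>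
    ((Real.hasDerivAt_exp t).const_mul κ).const_add 1
  have hφ₁0 : ∀ t, 0 < φ₁ t := fun t => by positivity
  have hφF : ContDiffOn ℝ 2 (fun y => φ (F y)) e.target :=
    hFc.add (contDiffOn_const.mul hFc.exp)
  have hQ : ContDiff ℝ 2 fun y : E n => (‖y - y₀‖ ^ 2) ^ 2 := (contDiff_norm_sub_sq y₀).pow 2
  -- The quartic makes the maximum at `y₀` strict and, having zero 2-jet there, does not affect the
  -- divergence of the flux at `y₀`.
  set F' : E n → ℝ := fun y => φ (F y) - (‖y - y₀‖ ^ 2) ^ 2 with hF'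
  have hφFy := hφF.contDiffAt (e.open_target.mem_nhds hy₀t)
  have hne : fderiv ℝ F y₀ ≠ 0 :=
    fderiv_chart_ne_zero g hy₀t (hf.mdifferentiable (by simp) _) (hd _)
  have hdF' : fderiv ℝ F' y₀ = φ₁ (F y₀) • fderiv ℝ F y₀ := by
    rw [← fderiv_real_comp hφd (hFy.differentiableAt (by simp))]
    exact fderiv_sub_of_fderiv_eq_zero hφFy hQ.contDiffAt (fderiv_norm_sub_pow_four y₀)
  have hdF'0 : fderiv ℝ F' y₀ ≠ 0 := by
    rw [hdF']
    exact smul_ne_zero (hφ₁0 _).ne' hne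
  set G := chartGram g x₀ with hG
  have hhess : ∀ v, hess G F' y₀ v v = φ₁ (F y₀) * hess G F y₀ v v +
      κ * Real.exp (F y₀) * fderiv ℝ F y₀ v ^ 2 := by
    intro v
    have h1 := hess_sub_of_fderiv_eq_zero (G := G) hφFy hQ.contDiffAt (fderiv_norm_sub_pow_four y₀)
      (fderiv_fderiv_norm_sub_pow_four y₀) v v
    have h2 := hess_real_comp (G := G) hφd hφd' hFy v v
    rw [h1.trans h2]
    ring
  have hF'c : ContDiffOn ℝ 2 F' e.target := hφF.sub hQ.contDiffOn
  have hGc : ContDiffOn ℝ 1 G e.target := fun y hy =>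
    ContDiffWithinAt.of_le (𝕜 := ℝ) (F := Form n) (contDiffOn_chartGram g x₀ y hy)
      (show ((1 : ℕ∞) : WithTop ℕ∞) ≤ (∞ : WithTop ℕ∞) from mod_cast le_top)
  have hIy : ∀ y ∈ e.target, IsInner (G y) := fun y hy => isInner_chartGram g x₀ hy
  have hdiv : 0 < divergence (fun z => flux (G z) p (fderiv ℝ F' z)) y₀ := by
    refine divergence_flux_pos hp (hGc.contDiffAt (e.open_target.mem_nhds hy₀t)) ?_
      (hF'c.contDiffAt (e.open_target.mem_nhds hy₀t)) hdF'0 (fun v => ?_) ?_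
    · filter_upwards [e.open_target.mem_nhds hy₀t] with z hz using hIy z hz
    · rw [hhess]
      have h1 := hH x₀ y₀ hy₀t v
      have h2 := hφ₁0 (F y₀)
      positivity
    · rw [hhess]
      have h1 := hH x₀ y₀ hy₀t (raise (G y₀) (fderiv ℝ F' y₀))
      have h2 := hφ₁0 (F y₀)
      have h3 : 0 < fderiv ℝ F y₀ (raise (G y₀) (fderiv ℝ F' y₀)) := by
        rw [hdF', raise_smul, map_smul]
        exact mul_pos h2 ((hIy y₀ hy₀t).raise_pos hne)
      positivity
  refine not_eventually_sub_lt_of_divergence_pos hUo (hGc.mono hUt) (fun y hy => hIy y (hUt hy)) hp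
    hy₀U (hF'c.mono hUt) hdF'0 hdiv (h := fun y => h (e.symm y))
    (hhΩ.comp (e.continuousOn_symm.mono hUt) fun y hy => hy.2) (hα x₀).1
    (fun K hK hKU => ((hα x₀).2 K hK hKU).2) ?_ ?_
  · intro ζ hζ hζc hζs
    obtain ⟨ψ, hψ, hψs, hψe⟩ := exists_isTest_of_chart hζ hζc hζs
    rw [← integral_vol_eq_integral_flux hψ.mdifferentiable (fun z hz => (hψs hz).2)
      (fun y hy => hUt (hζs hy)) hψe, ← setIntegral_eq_integral_of_forall_compl_eq_zero (s := Ω)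
      fun z hz => coInner_dif_eq_zero fun h' => hz (hψs h').1]
    exact hsol ψ hψ fun z hz => (hψs hz).1
  · filter_upwards [self_mem_nhdsWithin, mem_nhdsWithin_of_mem_nhds (hUo.mem_nhds hy₀U)]
      with y hyne hyU
    have h1 := hmax' (e.symm y) (subset_closure hyU.2)
    have h2 : 0 < ‖y - y₀‖ := norm_pos_iff.2 (sub_ne_zero.2 hyne)
    have h3 : 0 < (‖y - y₀‖ ^ 2) ^ 2 := by positivity
    simp only [hF', hφ, hF, hsy₀, sub_self, norm_zero]
    linarith

end Comparison

theorem IsConvex.isPSubharmonic {n : ℕ} {M : Type*} [TopologicalSpace M] [ChartedSpace (E n) M]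
    [IsManifold (𝓡 n) ∞ M] [T2Space M] [SecondCountableTopology M] [MeasurableSpace M]
    [BorelSpace M] {g : Metric n M} {f : M → ℝ} (hc : IsConvex g f)
    (hf : ContMDiff (𝓡 n) 𝓘(ℝ, ℝ) 2 f) (hd : ∀ x : M, coNorm g (dif f x) ≠ 0) {p : ℝ}
    (hp : 1 ≤ p) : IsPSubharmonic g p f :=
  ⟨hf.continuous.upperSemicontinuous,
    isSubsolution_of_hess_nonneg g hp hf hd fun x _ hy v => hc.hess_nonneg hf x hy v,
    fun hp' => isBelowPHarmonic_of_hess_nonneg g hp' hf hd fun x _ hy v =>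
      hc.hess_nonneg hf x hy v⟩

/-! ### The Euclidean metric on open subsets, where every chart is the inclusion. -/

section EuclideanOpens

variable {n : ℕ} {U : TopologicalSpace.Opens (E n)}

theorem opens_chartAt_source (x : U) : (chartAt (E n) x).source = univ := by
  rw [TopologicalSpace.Opens.chartAt_eq, OpenPartialHomeomorph.subtypeRestr_source]
  simp [chartAt_self_eq]

theorem mem_opens_chartAt_target (x : U) {y : E n} : y ∈ (chartAt (E n) x).target ↔ y ∈ U := by
  rw [← (chartAt (E n) x).image_source_eq_target, opens_chartAt_source, image_univ]
  exact ⟨fun ⟨z, hz⟩ => hz ▸ z.2, fun h => ⟨⟨y, h⟩, rfl⟩⟩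

theorem coe_opens_chartAt_symm (x : U) {y : E n} (hy : y ∈ (chartAt (E n) x).target) :
    ((chartAt (E n) x).symm y : E n) = y :=
  (chartAt (E n) x).right_inv hy

theorem inclDeriv_eq_id (x : U) : inclDeriv x = (ContinuousLinearMap.id ℝ (E n) : _) := by
  have hd : MDifferentiableAt (𝓡 n) 𝓘(ℝ, E n) (Subtype.val : U → E n) x :=
    (contMDiff_subtype_val (n := 1)).mdifferentiable (by simp) x
  have h1 : HasFDerivWithinAt
      (writtenInExtChartAt (𝓡 n) 𝓘(ℝ, E n) x (Subtype.val : U → E n))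
      (ContinuousLinearMap.id ℝ (E n)) (range (𝓡 n)) (extChartAt (𝓡 n) x x) := by
    have h2 : writtenInExtChartAt (𝓡 n) 𝓘(ℝ, E n) x (Subtype.val : U → E n)
        =ᶠ[𝓝 (extChartAt (𝓡 n) x x)] id := by
      filter_upwards [(chartAt (E n) x).open_target.mem_nhds (mem_chart_target (E n) x)] with y hy
      exact coe_opens_chartAt_symm x hy
    exact ((hasFDerivAt_id _).congr_of_eventuallyEq h2).hasFDerivWithinAt
  have h3 : HasMFDerivAt (𝓡 n) 𝓘(ℝ, E n) (Subtype.val : U → E n) x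
      (ContinuousLinearMap.id ℝ (E n)) := ⟨hd.continuousAt, h1⟩
  exact h3.mfderiv

theorem isVonNBounded_inner_lt_one :
    Bornology.IsVonNBounded ℝ {v : E n | inner ℝ v v < 1} := by
  have : Metric.ball (0 : E n) 1 = {v : E n | inner ℝ v v < 1} := by
    ext v
    rw [mem_ball_zero_iff, mem_ofPred_eq, real_inner_self_eq_norm_sq, sq_lt_one_iff₀ (norm_nonneg v)]
  rw [← this]
  exact NormedSpace.isVonNBounded_ball ℝ (E n) 1

/-- The inner product of Euclidean space on a tangent space of an open subset. -/
def euclideanInner (x : U) : TangentSpace (𝓡 n) x →L[ℝ] TangentSpace (𝓡 n) x →L[ℝ] ℝ :=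
  (innerSL ℝ : E n →L[ℝ] E n →L[ℝ] ℝ)

/-- All points have the same chart, so the coordinate change of the tangent bundle is the identity.
-/
theorem symmL_trivializationAt_opens (x z : U) (v : E n) :
    (trivializationAt (E n) (TangentSpace (𝓡 n)) x).symmL ℝ z v = v := by
  rw [TangentBundle.symmL_trivializationAt_eq_core (by rw [opens_chartAt_source]; trivial)]
  have h : achart (E n) x = achart (E n) z := Subtype.ext rfl
  rw [h]
  exact (tangentBundleCore (𝓡 n) U).coordChange_self (achart (E n) z) z (mem_chart_source (E n) z) v

/-- In the trivialization the section is the constant standard inner product. -/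
theorem contMDiff_euclideanInner : ContMDiff (𝓡 n) ((𝓡 n).prod 𝓘(ℝ, E n →L[ℝ] E n →L[ℝ] ℝ)) ∞
    (fun b : U => Bundle.TotalSpace.mk' (E n →L[ℝ] E n →L[ℝ] ℝ)
      (E := fun b : U => TangentSpace (𝓡 n) b →L[ℝ] TangentSpace (𝓡 n) b →L[ℝ] ℝ)
      b (euclideanInner b)) := by
  intro x
  rw [Bundle.contMDiffAt_section]
  convert! contMDiffAt_const (c := (innerSL ℝ : E n →L[ℝ] E n →L[ℝ] ℝ)) with z
  ext v w
  rw [hom_trivializationAt_apply]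
  simp [ContinuousLinearMap.inCoordinates]
  rw [Bundle.Trivialization.coe_linearMapAt_of_mem _ (by
    rw [hom_trivializationAt_baseSet]
    simp [opens_chartAt_source])]
  beta_reduce
  rw [hom_trivializationAt_apply]
  simp [ContinuousLinearMap.inCoordinates]
  rw [symmL_trivializationAt_opens, symmL_trivializationAt_opens]
  rfl

variable (U) in
/-- The Euclidean metric of an open subset of Euclidean space. -/
def euclideanMetric : Metric n U where
  inner := euclideanInner
  symm _ _ w := real_inner_comm (F := E n) w _
  pos _ _ hv := real_inner_self_pos (F := E n).2 hv
  isVonNBounded _ := isVonNBounded_inner_lt_one (n := n)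
  contMDiff := contMDiff_euclideanInner

theorem isEuclidean_euclideanMetric : IsEuclidean (euclideanMetric U) := by
  intro x v w
  rw [inclDeriv_eq_id]
  rfl

end EuclideanOpens

/-! ### The p-Laplacian of exp(|y|²) in Euclidean space. -/

section ExpNormSq

variable {n : ℕ}

/-- The function `exp (‖y‖ ^ 2)` on Euclidean space. -/
def expNormSq (n : ℕ) (y : E n) : ℝ := Real.exp (‖y‖ ^ 2)

theorem contDiff_expNormSq : ContDiff ℝ 2 (expNormSq n) := (contDiff_id.norm_sq ℝ).exp

theorem fderiv_norm_sq (y : E n) :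
    fderiv ℝ (fun y : E n => ‖y‖ ^ 2) y = (2 : ℝ) • (innerSL ℝ y : E n →L[ℝ] ℝ) := by
  rw [fderiv_norm_sq_apply]
  ext v
  simp

theorem fderiv_expNormSq_apply (y v : E n) :
    fderiv ℝ (expNormSq n) y v = expNormSq n y * (2 * inner ℝ y v) := by
  have h := fderiv_real_comp (φ := Real.exp) (φ₁ := Real.exp) Real.hasDerivAt_exp
    (((contDiff_id.norm_sq ℝ : ContDiff ℝ 2 fun y : E n => ‖y‖ ^ 2).contDiffAt
      (x := y)).differentiableAt (by simp))
  have h1 : fderiv ℝ (expNormSq n) y = Real.exp (‖y‖ ^ 2) • fderiv ℝ (fun y : E n => ‖y‖ ^ 2) y := h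
  rw [h1, fderiv_norm_sq]
  simp [expNormSq]

theorem fderiv_fderiv_expNormSq_apply (y v w : E n) :
    fderiv ℝ (fderiv ℝ (expNormSq n)) y v w =
      expNormSq n y * (2 * inner ℝ v w + 4 * inner ℝ y v * inner ℝ y w) := by
  have h := fderiv_fderiv_real_comp (F := fun y : E n => ‖y‖ ^ 2) (φ := Real.exp) (φ₁ := Real.exp) (φ₂ := Real.exp)
    Real.hasDerivAt_exp Real.hasDerivAt_exp
    ((contDiff_id.norm_sq ℝ : ContDiff ℝ 2 fun y : E n => ‖y‖ ^ 2).contDiffAt (x := y)) v w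
  have h2 : fderiv ℝ (fderiv ℝ fun y : E n => ‖y‖ ^ 2) y v w = 2 * inner ℝ v w := by
    have h3 : (fderiv ℝ fun y : E n => ‖y‖ ^ 2) =
        fun y : E n => ((2 : ℝ) • (innerSL ℝ : E n →L[ℝ] E n →L[ℝ] ℝ)) y :=
      funext fderiv_norm_sq
    rw [h3, ContinuousLinearMap.fderiv]
    simp
    rfl
  have h1 : fderiv ℝ (fderiv ℝ (expNormSq n)) y v w = _ := h
  rw [h1, h2, fderiv_norm_sq]
  simp [expNormSq]
  ring

/-- The Euclidean inner product. -/
def innerForm (n : ℕ) : Form n := (innerSL ℝ : E n →L[ℝ] E n →L[ℝ] ℝ)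

theorem innerForm_apply (v w : E n) : innerForm n v w = inner ℝ v w := rfl

theorem isInner_innerForm : IsInner (innerForm n) :=
  ⟨fun v w => real_inner_comm w v, fun _ hv => real_inner_self_pos.2 hv⟩

theorem fderiv_expNormSq_ne_zero {y : E n} (hy : y ≠ 0) : fderiv ℝ (expNormSq n) y ≠ 0 := by
  intro h
  have h1 := fderiv_expNormSq_apply y y
  rw [h] at h1
  have h2 : 0 < inner ℝ y y := real_inner_self_pos.2 hy
  have h3 : 0 < expNormSq n y := Real.exp_pos _
  have h4 : 0 < expNormSq n y * (2 * inner ℝ y y) := by positivity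
  exact h4.ne h1

/-- The sign of the `p`-Laplacian of `exp (‖y‖ ^ 2)`. -/
theorem divergence_flux_expNormSq_neg {G : E n → Form n} {p : ℝ} {y : E n} (hy : y ≠ 0)
    (hG : G =ᶠ[𝓝 y] fun _ => innerForm n) (h : 2 * n + 2 * (p - 2) < 4 * (1 - p) * ‖y‖ ^ 2) :
    divergence (fun z => flux (G z) p (fderiv ℝ (expNormSq n) z)) y < 0 := by
  have hGy : G y = innerForm n := hG.self_of_nhds
  have hG1 : ContDiffAt ℝ 1 G y := (contDiffAt_const (𝕜 := ℝ) (F := Form n)).congr_of_eventuallyEq hG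
  have hI : ∀ᶠ z in 𝓝 y, IsInner (G z) := hG.mono fun z hz => hz ▸ isInner_innerForm
  have hdG : fderiv ℝ G y = 0 := by
    rw [hG.fderiv_eq]
    exact fderiv_const_apply (𝕜 := ℝ) (F := Form n) _
  have h0 := fderiv_expNormSq_ne_zero hy
  have he : ∀ i j, G y ((EuclideanSpace.basisFun (Fin n) ℝ).toBasis i)
      ((EuclideanSpace.basisFun (Fin n) ℝ).toBasis j) = if i = j then 1 else 0 := by
    intro i j
    rw [hGy, innerForm_apply, OrthonormalBasis.coe_toBasis]
    exact orthonormal_iff_ite.1 (EuclideanSpace.basisFun (Fin n) ℝ).orthonormal i j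
  have hhess : ∀ v w, hess G (expNormSq n) y v w =
      expNormSq n y * (2 * inner ℝ v w + 4 * inner ℝ y v * inner ℝ y w) := by
    intro v w
    rw [hess_apply, hdG, fderiv_fderiv_expNormSq_apply]
    simp
  set X := raise (G y) (fderiv ℝ (expNormSq n) y) with hX
  have hXe : X = (2 * expNormSq n y) • y := by
    rw [hX, hGy]
    refine (isInner_innerForm.raise_eq_iff _ _).2 fun w => ?_
    rw [fderiv_expNormSq_apply, innerForm_apply, real_inner_smul_left]
    ring
  rw [divergence_flux p hG1 hI contDiff_expNormSq.contDiffAt h0 he]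
  have hm : 0 < expNormSq n y := Real.exp_pos _
  have hr : 0 < ‖y‖ ^ 2 := by positivity
  have hq : fderiv ℝ (expNormSq n) y X = 4 * expNormSq n y ^ 2 * ‖y‖ ^ 2 := by
    rw [fderiv_expNormSq_apply, hXe, real_inner_smul_right, real_inner_self_eq_norm_sq]
    ring
  have hqpos : 0 < fderiv ℝ (expNormSq n) y X := by rw [hq]; positivity
  refine mul_neg_of_pos_of_neg (mul_pos (hGy ▸ isInner_innerForm.density_pos)
    (Real.rpow_pos_of_pos (Real.sqrt_pos.2 hqpos) _)) ?_
  have hsum : ∑ i, hess G (expNormSq n) y ((EuclideanSpace.basisFun (Fin n) ℝ).toBasis i)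
      ((EuclideanSpace.basisFun (Fin n) ℝ).toBasis i) =
      expNormSq n y * (2 * n + 4 * ‖y‖ ^ 2) := by
    simp only [hhess, ← Finset.mul_sum, Finset.sum_add_distrib]
    congr 2
    · simp
    · rw [EuclideanSpace.real_norm_sq_eq, Finset.mul_sum]
      refine Finset.sum_congr rfl fun i _ => ?_
      simp [EuclideanSpace.inner_single_right]
      ring
  -- The gradient is radial, so this is the radial eigenvalue of the Hessian; the remaining `n - 1`
  -- eigenvalues are `2 exp(‖y‖²)`.
  have hXX : hess G (expNormSq n) y X X / fderiv ℝ (expNormSq n) y X =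
      expNormSq n y * (2 + 4 * ‖y‖ ^ 2) := by
    rw [hhess, hq, hXe, real_inner_smul_right, real_inner_smul_right, real_inner_smul_left,
      real_inner_self_eq_norm_sq]
    field_simp
    ring
  rw [hsum, mul_div_assoc, hXX]
  have : expNormSq n y * (2 * n + 4 * ‖y‖ ^ 2) + (p - 2) * (expNormSq n y * (2 + 4 * ‖y‖ ^ 2)) =
    expNormSq n y * (2 * n + 2 * (p - 2) - 4 * (1 - p) * ‖y‖ ^ 2) := by ring
  rw [this]
  exact mul_neg_of_pos_of_neg hm (by linarith)

end ExpNormSq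

/-! ### Euclidean geodesics and convexity of exp(|x|²). -/

section EuclideanChart

variable {n : ℕ} {U : TopologicalSpace.Opens (E n)} {g : Metric n U}

theorem frameL_opens (x : U) {y : E n} (hy : y ∈ (chartAt (E n) x).target) :
    frameL x y = ContinuousLinearMap.id ℝ (E n) := by
  have hd : MDifferentiableAt (𝓡 n) 𝓘(ℝ, E n) (Subtype.val : U → E n)
      ((chartAt (E n) x).symm y) :=
    (contMDiff_subtype_val (n := 1)).mdifferentiable (by simp) _
  have h1 := mfderiv_comp y hd (mdifferentiableAt_chartAt_symm x hy)
  have h2 : (Subtype.val : U → E n) ∘ (chartAt (E n) x).symm =ᶠ[𝓝 y] id := by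
    filter_upwards [(chartAt (E n) x).open_target.mem_nhds hy] with z hz
    exact coe_opens_chartAt_symm x hz
  rw [mfderiv_eq_fderiv, h2.fderiv_eq, fderiv_id] at h1
  have h3 : ∀ v, frameL x y v = inclDeriv ((chartAt (E n) x).symm y) (frame x y v) := by
    intro v
    rw [inclDeriv_eq_id]
    rfl
  ext1 v
  rw [h3]
  exact (congrArg (fun L : E n →L[ℝ] E n => L v) h1).symm

theorem IsEuclidean.chartGram_eq (hg : IsEuclidean g) (x : U) {y : E n}
    (hy : y ∈ (chartAt (E n) x).target) : chartGram g x y = innerForm n := by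
  ext v w
  have h : chartGram g x y v w = inner ℝ (frameL x y v) (frameL x y w) := by
    rw [chartGram_apply, chartMetric, hg, inclDeriv_eq_id]
    rfl
  rw [h, frameL_opens x hy]
  rfl

theorem IsEuclidean.chartGram_eventuallyEq (hg : IsEuclidean g) (x : U) {y : E n}
    (hy : y ∈ (chartAt (E n) x).target) : chartGram g x =ᶠ[𝓝 y] fun _ => innerForm n := by
  filter_upwards [(chartAt (E n) x).open_target.mem_nhds hy] with z hz using hg.chartGram_eq x hz

theorem IsEuclidean.christoffel_eq_zero (hg : IsEuclidean g) (x : U) {y : E n}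
    (hy : y ∈ (chartAt (E n) x).target) (a b w : E n) : christoffel g x y a b w = 0 := by
  have h : ∀ a b, fderiv ℝ (fun z => chartMetric g x z a b) y = 0 := by
    intro a b
    have h1 : (fun z => chartMetric g x z a b) =ᶠ[𝓝 y] fun _ => innerForm n a b :=
      (hg.chartGram_eventuallyEq x hy).mono fun z hz =>
        congrArg (fun B : Form n => B a b) hz
    rw [h1.fderiv_eq]
    exact fderiv_const_apply _
  rw [christoffel, h, h, h]
  simp

/-- Geodesics of the Euclidean metric have vanishing acceleration. -/
theorem IsGeodesicOn.deriv_deriv_coe (hg : IsEuclidean g) {c : ℝ → U} {s : Set ℝ}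
    (hc : IsGeodesicOn g c s) {t : ℝ} (ht : t ∈ s) :
    deriv (deriv fun r => (c r : E n)) t = 0 := by
  obtain ⟨x, hx, h⟩ := hc.2 t ht
  have hy := (chartAt (E n) x).map_source hx
  -- The geodesic equation is tested on the acceleration itself, so its squared norm vanishes.
  have h1 := h (deriv (deriv fun r => (c r : E n)) t)
  rw [hg.christoffel_eq_zero x hy, add_zero, ← chartGram_apply, hg.chartGram_eq x hy,
    innerForm_apply] at h1
  exact inner_self_eq_zero.1 h1

theorem IsGeodesicOn.contDiffOn_coe {c : ℝ → U} {s : Set ℝ} (hc : IsGeodesicOn g c s) :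
    ContDiffOn ℝ 2 (fun r => (c r : E n)) s :=
  (contMDiff_subtype_val.comp_contMDiffOn hc.1).contDiffOn

/-- With zero acceleration the second derivative is `exp(‖u‖²) ((2⟨u, w⟩)² + 2‖w‖²)`, which is
nonnegative. -/
theorem convexOn_exp_norm_sq {u w : ℝ → E n} {s : Set ℝ} (hc : Convex ℝ s)
    (hu : ∀ t ∈ s, HasDerivAt u (w t) t) (hw : ∀ t ∈ s, HasDerivAt w 0 t) :
    ConvexOn ℝ s fun t => Real.exp (‖u t‖ ^ 2) := by
  have h1 : ∀ t ∈ s, HasDerivAt (fun t => Real.exp (‖u t‖ ^ 2))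
      (Real.exp (‖u t‖ ^ 2) * (2 * inner ℝ (u t) (w t))) t := fun t ht => (hu t ht).norm_sq.exp
  have h2 : ∀ t ∈ s, HasDerivAt (fun t => Real.exp (‖u t‖ ^ 2) * (2 * inner ℝ (u t) (w t)))
      (Real.exp (‖u t‖ ^ 2) * (2 * inner ℝ (u t) (w t)) * (2 * inner ℝ (u t) (w t)) +
        Real.exp (‖u t‖ ^ 2) * (2 * (inner ℝ (u t) 0 + inner ℝ (w t) (w t)))) t := fun t ht =>
    (h1 t ht).mul (((hu t ht).inner ℝ (hw t ht)).const_mul 2)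
  refine convexOn_of_hasDerivWithinAt2_nonneg hc
    (fun t ht => (h1 t ht).continuousAt.continuousWithinAt)
    (fun t ht => (h1 t (interior_subset ht)).hasDerivWithinAt)
    (fun t ht => (h2 t (interior_subset ht)).hasDerivWithinAt) fun t _ => ?_
  rw [inner_zero_right, zero_add, mul_assoc, ← mul_add, real_inner_self_eq_norm_sq]
  have := mul_self_nonneg (2 * inner ℝ (u t) (w t))
  positivity

theorem isConvex_exp_norm_sq (hg : IsEuclidean g) :
    IsConvex g (fun x : U => Real.exp (‖(x : E n)‖ ^ 2)) := by
  intro ε _ c hc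
  have h1 := hc.contDiffOn_coe
  have h2 := (contDiffOn_succ_iff_deriv_of_isOpen (n := 1) isOpen_Ioo).1 h1
  refine convexOn_exp_norm_sq (convex_Ioo _ _)
    (w := deriv fun r => (c r : E n)) (fun t ht => ?_) fun t ht => ?_
  · exact (h2.1.differentiableAt (isOpen_Ioo.mem_nhds ht)).hasDerivAt
  · rw [← hc.deriv_deriv_coe hg ht]
    exact ((h2.2.2.differentiableOn one_ne_zero).differentiableAt
      (isOpen_Ioo.mem_nhds ht)).hasDerivAt

theorem contMDiff_exp_norm_sq :
    ContMDiff (𝓡 n) 𝓘(ℝ, ℝ) 2 (fun x : U => Real.exp (‖(x : E n)‖ ^ 2)) :=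
  contDiff_expNormSq.contMDiff.comp contMDiff_subtype_val

theorem exp_norm_sq_chart_eventuallyEq (x : U) {y : E n} (hy : y ∈ (chartAt (E n) x).target) :
    (fun y => Real.exp (‖((chartAt (E n) x).symm y : E n)‖ ^ 2)) =ᶠ[𝓝 y] expNormSq n := by
  filter_upwards [(chartAt (E n) x).open_target.mem_nhds hy] with z hz
  rw [coe_opens_chartAt_symm x hz, expNormSq]

theorem chartForm_dif_exp_norm_sq (x : U) {y : E n} (hy : y ∈ (chartAt (E n) x).target) :
    chartForm (dif fun x : U => Real.exp (‖(x : E n)‖ ^ 2)) x y = fderiv ℝ (expNormSq n) y := by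
  rw [chartForm_dif _ x hy (contMDiff_exp_norm_sq.mdifferentiable (by simp) _)]
  exact (exp_norm_sq_chart_eventuallyEq x hy).fderiv_eq

theorem coNorm_dif_exp_norm_sq_ne_zero (x : U) (hx : (x : E n) ≠ 0) :
    coNorm g (dif (fun x : U => Real.exp (‖(x : E n)‖ ^ 2)) x) ≠ 0 := by
  set y := chartAt (E n) x x with hy
  have hyt : y ∈ (chartAt (E n) x).target := mem_chart_target (E n) x
  have hxy : (chartAt (E n) x).symm y = x := (chartAt (E n) x).left_inv (mem_chart_source (E n) x)
  have h1 := coInner_eq_chart g x hyt (dif fun x : U => Real.exp (‖(x : E n)‖ ^ 2))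
    (dif fun x : U => Real.exp (‖(x : E n)‖ ^ 2))
  rw [hxy, chartForm_dif_exp_norm_sq x hyt] at h1
  rw [coNorm, h1]
  exact (Real.sqrt_pos.2 ((isInner_chartGram g x hyt).raise_pos
    (fderiv_expNormSq_ne_zero hx))).ne'

end EuclideanChart

/-! ### Failure of the weak inequality for p < 1. -/

section Sharpness

variable {n : ℕ} {g : Metric n (punctured n)}

theorem not_isPSubharmonic_exp_norm_sq (hn : 1 ≤ n) (hg : IsEuclidean g) {p : ℝ} (hp : p < 1) :
    ¬ IsPSubharmonic g p (fun x : punctured n => Real.exp (‖(x : E n)‖ ^ 2)) := by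
  rintro ⟨-, hsub, -⟩
  obtain ⟨R, hR⟩ : ∃ R : ℝ, ∀ r, R < r → 2 * n + 2 * (p - 2) < 4 * (1 - p) * r ^ 2 := by
    -- The quotient is the threshold for `r` in place of `r ^ 2`; requiring `r > 1` makes `r ^ 2`
    -- the larger of the two.
    refine ⟨max 1 ((2 * n + 2 * (p - 2)) / (4 * (1 - p))), fun r hr => ?_⟩
    have h1 : 1 < r := (le_max_left _ _).trans_lt hr
    have h2 := (le_max_right 1 ((2 * n + 2 * (p - 2)) / (4 * (1 - p)))).trans_lt hr
    rw [div_lt_iff₀ (by linarith)] at h2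
    have h3 : r * (4 * (1 - p)) ≤ r * (4 * (1 - p)) * r :=
      le_mul_of_one_le_right (by nlinarith) h1.le
    linarith [show r * (4 * (1 - p)) * r = 4 * (1 - p) * r ^ 2 by ring]
  -- The unit ball around `y₁` stays at distance at least `max R 0 + 1` from the origin, inside the
  -- region of negative divergence and away from the puncture.
  set y₁ : E n := EuclideanSpace.single ⟨0, hn⟩ (max R 0 + 2) with hy₁
  have hm := le_max_right R 0
  have hy₁n : ‖y₁‖ = max R 0 + 2 := by
    rw [hy₁, PiLp.norm_single, Real.norm_of_nonneg (by linarith)]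
  set b : ContDiffBump y₁ := ⟨1 / 2, 1, by norm_num, by norm_num⟩ with hb
  have hball : ∀ y ∈ tsupport b, R < ‖y‖ ∧ y ≠ 0 := by
    intro y hy
    rw [b.tsupport_eq, mem_closedBall_iff_norm] at hy
    have h1 : ‖y₁‖ ≤ ‖y‖ + ‖y - y₁‖ := by
      have := norm_sub_le y (y - y₁)
      rwa [sub_sub_cancel] at this
    have h2 : ‖y - y₁‖ ≤ 1 := hy
    have h3 := le_max_left R 0
    exact ⟨by linarith, norm_pos_iff.1 (by linarith)⟩
  have hy₁0 : y₁ ≠ 0 := norm_pos_iff.1 (by linarith)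
  set x : punctured n := ⟨y₁, hy₁0⟩
  have hT : ∀ {y : E n}, y ∈ (chartAt (E n) x).target ↔ y ≠ 0 := mem_opens_chartAt_target x
  have hbT : tsupport b ⊆ (chartAt (E n) x).target := fun y hy => hT.2 (hball y hy).2
  obtain ⟨φ, hφ, hφs, hφe⟩ := exists_isTest_of_chart (Ω := univ) (x := x) (ζ := b)
    b.contDiff b.hasCompactSupport fun y hy => ⟨hbT hy, trivial⟩
  have hφ0 : ∀ z, 0 ≤ φ z := by
    intro z
    have hz : z ∈ (chartAt (E n) x).source := by
      rw [opens_chartAt_source]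
      trivial
    rw [← (chartAt (E n) x).left_inv hz, hφe _ ((chartAt (E n) x).map_source hz)]
    exact b.nonneg
  have hle := (hsub φ hφ hφ0).2
  rw [integral_vol_eq_integral_flux hφ.mdifferentiable (fun z hz => (hφs hz).2) hbT hφe] at hle
  set V : E n → E n := fun y => flux (chartGram g x y) p (fderiv ℝ (expNormSq n) y) with hV
  have hcongr : ∀ y, fderiv ℝ b y (flux (chartGram g x y) p
      (chartForm (dif fun x : punctured n => Real.exp (‖(x : E n)‖ ^ 2)) x y)) =
      fderiv ℝ b y (V y) := by
    intro y
    by_cases hy : y ∈ (chartAt (E n) x).target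
    · rw [chartForm_dif_exp_norm_sq x hy]
    · rw [fderiv_of_notMem_tsupport (𝕜 := ℝ) fun h => hy (hbT h)]
      rfl
  have hU := (chartAt (E n) x).open_target
  have hVc : ContDiffOn ℝ 1 V (chartAt (E n) x).target := fun y hy =>
    (contDiffAt_flux p ((contDiffAt_const (𝕜 := ℝ) (F := Form n)).congr_of_eventuallyEq
      (hg.chartGram_eventuallyEq x hy)) (isInner_chartGram g x hy)
      (contDiff_expNormSq.contDiffAt.fderiv_right (by norm_num))
      (fderiv_expNormSq_ne_zero (hT.1 hy))).contDiffWithinAt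
  rw [integral_congr_ae (Eventually.of_forall hcongr),
    integral_fderiv_apply hU hVc b.contDiff b.hasCompactSupport hbT, ← integral_neg] at hle
  -- After integration by parts the weak integral is that of `-divergence V * b`, hence strictly
  -- positive, against `hle`.
  have hneg : ∀ y ∈ tsupport b, divergence V y < 0 := fun y hy =>
    divergence_flux_expNormSq_neg (hball y hy).2 (hg.chartGram_eventuallyEq x (hbT hy))
      (hR _ (hball y hy).1)
  have hcont : Continuous fun y => divergence V y * b y :=
    continuous_mul_of_tsupport_subset hU (continuousOn_divergence hU hVc) b.continuous hbT
  refine hle.not_gt (hcont.neg.integral_pos_of_hasCompactSupport_nonneg_nonzero (x := y₁) ?_ ?_ ?_)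
  · exact (b.hasCompactSupport.mul_left (f := divergence V)).neg
  · intro y
    rw [Pi.zero_apply, neg_nonneg]
    by_cases hy : y ∈ tsupport b
    · exact mul_nonpos_of_nonpos_of_nonneg (hneg y hy).le b.nonneg
    · rw [image_eq_zero_of_notMem_tsupport hy, mul_zero]
  · have hb1 : b y₁ = 1 := b.one_of_mem_closedBall (Metric.mem_closedBall_self b.rIn_pos.le)
    have hy₁s : y₁ ∈ tsupport b := subset_tsupport b (by simp [hb1])
    simp only [hb1, mul_one]
    exact (neg_pos.2 (hneg y₁ hy₁s)).ne'

end Sharpness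

end PSub

end

theorem theorem1p3 :
    (∀ (n : ℕ) (M : Type u) [TopologicalSpace M] [ChartedSpace (PSub.E n) M]
        [IsManifold (𝓡 n) ∞ M] [T2Space M] [SecondCountableTopology M]
        [MeasurableSpace M] [BorelSpace M] (g : PSub.Metric n M) (f : M → ℝ),
      ContMDiff (𝓡 n) 𝓘(ℝ, ℝ) 2 f → PSub.IsConvex g f →
      (∀ x : M, PSub.coNorm g (PSub.dif f x) ≠ 0) →
      ∀ p : ℝ, 1 ≤ p → PSub.IsPSubharmonic g p f) ∧
    (∀ n : ℕ, 1 ≤ n → ∃ g : PSub.Metric n (PSub.punctured n), PSub.IsEuclidean g ∧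
      ContMDiff (𝓡 n) 𝓘(ℝ, ℝ) 2
        (fun x : PSub.punctured n => Real.exp (‖(x : PSub.E n)‖ ^ 2)) ∧
      PSub.IsConvex g (fun x : PSub.punctured n => Real.exp (‖(x : PSub.E n)‖ ^ 2)) ∧
      (∀ x : PSub.punctured n, PSub.coNorm g
        (PSub.dif (fun x : PSub.punctured n => Real.exp (‖(x : PSub.E n)‖ ^ 2)) x) ≠ 0) ∧
      ∀ p : ℝ, p < 1 → ¬ PSub.IsPSubharmonic g p
        (fun x : PSub.punctured n => Real.exp (‖(x : PSub.E n)‖ ^ 2))) := by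
  refine ⟨fun n M _ _ _ _ _ _ _ g f hf hc hd p hp => hc.isPSubharmonic hf hd hp, fun n hn =>
    ⟨PSub.euclideanMetric (PSub.punctured n), PSub.isEuclidean_euclideanMetric,
      PSub.contMDiff_exp_norm_sq, PSub.isConvex_exp_norm_sq PSub.isEuclidean_euclideanMetric,
      fun x => PSub.coNorm_dif_exp_norm_sq_ne_zero x x.2, fun p hp =>
        PSub.not_isPSubharmonic_exp_norm_sq hn PSub.isEuclidean_euclideanMetric hp⟩⟩
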